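/- **Setting.** Let $d\ge 1$, $\gamma\ge 1$, $T>0$, $\mathbb T^d=\mathbb R^d/\mathbb Z^d$, $p(s)=s^\gamma$, $E(s)=\int_0^s p(r)\,dr$, $Q(s)=\int_0^s\sqrt r\,p'(r)\,dr$. The dissipative Aw–Rascle system is $$\partial_t\varrho+\operatorname{div}(\varrho w)-\operatorname{div}(\sqrt\varrho\,\nabla Q(\varrho))=0,\qquad \partial_t(\varrho w)+\operatorname{div}(\varrho w\otimes w)=\operatorname{div}(\nabla Q(\varrho)\otimes\sqrt\varrho\, w).\tag{1}$$ **Measure-valued solutions.** Let $\mathcal V=\{\mathcal V_{t,x}\}$ be a weak-(*) measurable family of probability measures on $[0,\infty)\times\mathbb R^d\times\mathbb R^d\ni(s,W,F)$, $(t,x)\in(0,T)\times\mathbb T^d$. Let $\mathcal V_0=\{\mathcal V_{0,x}\}$ be a measurable family of probability measures on $[0,\infty)\times\mathbb R^d\ni(s,W)$ with $\int_{\mathbb T^d}\langle\mathcal V_{0,x};\tfrac12|W|^2+E(s)\rangle\,dx<\infty$, let $\mathcal D\in L^\infty(0,T)$, $\mathcal D\ge0$, and write $\varrho=\langle\mathcal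 V_{t,x};s\rangle$, $\varrho_0=\langle\mathcal V_{0,x};s\rangle$. $(\mathcal V,\mathcal D)$ is a measure-valued solution of (1) with initial datum $\mathcal V_0$ and dissipation defect $\mathcal D$ if $\langle\mathcal V_{t,x};\tfrac12|W|^2+E(s)\rangle$ and $\langle\mathcal V_{t,x};|F|^2\rangle$ are integrable on $(0,T)\times\mathbb T^d$ and: * $\varrho\in C_{\rm weak}(0,T;L^{\gamma+1}(\mathbb T^d))$; for all $0<\alpha<\gamma+1$, $\varrho^\alpha=\langle\mathcal V_{t,x};s^\alpha\rangle$ a.e. and $\varrho^\alpha\in C_{\rm weak}(0,T;L^{(\gamma+1)/\alpha}(\mathbb T^d))$; $\langle\mathcal V_{t,x};W\rangle\in L^\infty(0,T;L^2(\mathbb T^d))$ and $\sqrt\varrho\,\langle\mathcal V_{t,x};W\rangle=\langle\mathcal V_{t,x};\sqrt s\,W\rangle$ a.e.; $Q(\varrho)=\langle\mathcal V_{t,x};Q(s)\rangle\in L^2(0,T;W^{1,2}(\mathbb T^d))$ with $\nabla Q(\varrho)=\langle\mathcal V_{t,x};F\rangle$. * For a.e. $\tau\in(0,T)$ and all $\psi\in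 C^1([0,T]\times\mathbb T^d)$, $$\int_{\mathbb T^d}\varrho(\tau)\psi(\tau)\,dx-\int_{\mathbb T^d}\varrho_0\psi(0)\,dx=\int_0^\tau\!\!\int_{\mathbb T^d}\big[\varrho\,\partial_t\psi+\sqrt\varrho\,\langle\mathcal V_{t,x};W\rangle\cdot\nabla\psi-\sqrt\varrho\,\nabla Q(\varrho)\cdot\nabla\psi\big]dx\,dt.$$ * There are $r^M\in L^\infty_{\text{weak-}(*)}(0,T;\mathcal M(\mathbb T^d;\mathbb R^{d\times d}))+\mathcal M([0,T]\times\mathbb T^d;\mathbb R^{d\times d})$ and $\xi\in L^1(0,T)$ such that for a.e. $\tau\in(0,T)$, all $\epsilon>0$ and all $\phi\in C^1([0,T]\times\mathbb T^d;\mathbb R^d)$, $$\int_{\mathbb T^d}\sqrt{\varrho}\,\langle\mathcal V_{\tau,x};W\rangle\cdot\phi(\tau)\,dx-\int_{\mathbb T^d}\langle\mathcal V_{0,x};\sqrt s\,W\rangle\cdot\phi(0)\,dx$$ $$=\int_0^\tau\!\!\int_{\mathbb T^d}\big[\sqrt\varrho\,\langle\mathcal V_{t,x};W\rangle\cdot\partial_t\phi+\langle\mathcal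 V_{t,x};W\otimes W\rangle:\nabla\phi-\langle\mathcal V_{t,x};W\otimes F\rangle:\nabla\phi\big]dx\,dt+\int_{[0,\tau]\times\mathbb T^d}\nabla\phi:dr^M,$$ $$\Big|\int_{[0,\tau]\times\mathbb T^d}\nabla\phi:dr^M\Big|\le\Big(1+\frac1{4\epsilon}\Big)\int_0^\tau\xi(t)\mathcal D(t)\|\phi(t)\|_{C^1(\mathbb T^d)}dt+\epsilon\,\|\phi\|_{C^1([0,\tau]\times\mathbb T^d)}\mathcal D(\tau),$$ where $(\nabla\phi)_{ij}=\partial_j\phi_i$. * There are $\mathcal R\in L^\infty_{\text{weak-}(*)}(0,T;\mathcal M(\mathbb T^d))+\mathcal M([0,T]\times\mathbb T^d)$ and a constant $C$ such that for a.e. $\tau\in(0,T)$ and all $\epsilon>0$, $$\int_{\mathbb T^d}\langle\mathcal V_{\tau,x};\tfrac12|W|^2+E(s)\rangle dx+\int_0^\tau\!\!\int_{\mathbb T^d}\langle\mathcal V_{t,x};|F|^2\rangle dx\,dt+\mathcal D(\tau)$$ $$\le\int_{\mathbb T^d}\langle\mathcal V_{0,x};\tfrac12|W|^2+E(s)\rangle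 dx+\int_0^\tau\!\!\int_{\mathbb T^d}\langle\mathcal V_{t,x};W\cdot F\rangle dx\,dt+\mathcal R((0,\tau)\times\mathbb T^d),$$ $$|\mathcal R((0,\tau)\times\mathbb T^d)|\le C\Big(1+\frac1{4\epsilon}\Big)\int_0^\tau\mathcal D(t)\,dt+\epsilon\,\mathcal D(\tau).$$ **Theorem.** Let $(\mathcal V,\mathcal D)$ be a measure-valued solution of (1) with initial datum $\mathcal V_0$. Let $\bar\varrho\in C^1([0,T];C^2(\mathbb T^d))$ with $\bar\varrho>0$ on $[0,T]\times\mathbb T^d$ and $\bar w\in C^1([0,T];C^2(\mathbb T^d;\mathbb R^d))$ satisfy (1) pointwise in $(0,T)\times\mathbb T^d$, and put $\bar\varrho_0=\bar\varrho(0,\cdot)$, $\bar w_0=\bar w(0,\cdot)$. If $$\mathcal V_{0,x}=\delta_{\{\bar\varrho_0(x),\ \sqrt{\bar\varrho_0(x)}\,\bar w_0(x)\}}\quad\text{for a.e. }x\in\mathbb T^d,$$ then $\mathcal D=0$ a.e. in $(0,T)$ and $$\mathcal V_{\tau,x}=\delta_{\{\bar\varrho(\tau,x),\ \sqrt{\bar\varrho}\,\bar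 w(\tau,x),\ \nabla Q(\bar\varrho)(\tau,x)\}}\quad\text{for a.e. }(\tau,x)\in(0,T)\times\mathbb T^d.$$ -/

import Mathlib

open MeasureTheory ProbabilityTheory Set
open scoped NNReal ENNReal ContDiff

noncomputable section

namespace DissipativeAR

/-- The flat torus `ℝ^d / ℤ^d`; its `volume` is the normalised Haar (Lebesgue) measure. -/
abbrev Torus (d : ℕ) : Type := UnitAddTorus (Fin d)

abbrev Vec (d : ℕ) : Type := EuclideanSpace ℝ (Fin d)

/-! ### Calculus on the torus -/

/-- Quotient map `ℝ^d → ℝ^d / ℤ^d`. -/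
def toTorus {d : ℕ} (y : Fin d → ℝ) : Torus d := fun i => (y i : UnitAddCircle)

/-- `g ∈ C^k(𝕋^d)`: its periodic lift to `ℝ^d` is of class `C^k`. -/
def IsCk {d : ℕ} (k : ℕ∞) (g : Torus d → ℝ) : Prop :=
  ContDiff ℝ (k : WithTop ℕ∞) (fun y : Fin d → ℝ => g (toTorus y))

/-- Partial derivative `∂_j g` on the torus, by translation in the `j`-th coordinate. -/
def pd {d : ℕ} (j : Fin d) (g : Torus d → ℝ) (x : Torus d) : ℝ :=
  deriv (fun h : ℝ => g (x + toTorus (Pi.single j h))) 0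

def grad {d : ℕ} (g : Torus d → ℝ) (x : Torus d) : Vec d :=
  WithLp.toLp 2 (fun j => pd j g x)

/-- Time derivative on `[0,T]`, one-sided at the end points. -/
def dt {d : ℕ} (T : ℝ) (g : ℝ → Torus d → ℝ) (t : ℝ) (x : Torus d) : ℝ :=
  derivWithin (fun s => g s x) (Icc 0 T) t

/-- `g` is continuous on `[0,T] × 𝕋^d` and has there a continuous time derivative, that is,
`g ∈ C^1([0,T]; C(𝕋^d))`. -/
structure TimeC1 {d : ℕ} (T : ℝ) (g : ℝ → Torus d → ℝ) : Prop where
  cont : ContinuousOn (fun z : ℝ × Torus d => g z.1 z.2) (Icc 0 T ×ˢ univ)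
  diff : ∀ x, DifferentiableOn ℝ (fun t => g t x) (Icc 0 T)
  cont_dt : ContinuousOn (fun z : ℝ × Torus d => dt T g z.1 z.2) (Icc 0 T ×ˢ univ)

/-- `g ∈ C^1([0,T] × 𝕋^d)`. -/
structure IsC1 {d : ℕ} (T : ℝ) (g : ℝ → Torus d → ℝ) : Prop where
  time : TimeC1 T g
  space : ∀ t ∈ Icc 0 T, IsCk 1 (g t)
  cont_pd : ∀ j, ContinuousOn (fun z : ℝ × Torus d => pd j (g z.1) z.2) (Icc 0 T ×ˢ univ)

/-- `g ∈ C^1([0,T]; C^2(𝕋^d))`: each `g(t)` is of class `C^2` and all spatial derivatives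
`∂^α g`, `|α| ≤ 2`, belong to `C^1([0,T]; C(𝕋^d))`. -/
structure IsC1C2 {d : ℕ} (T : ℝ) (g : ℝ → Torus d → ℝ) : Prop where
  space : ∀ t ∈ Icc 0 T, IsCk 2 (g t)
  time : TimeC1 T g
  time_pd : ∀ j, TimeC1 T (fun t => pd j (g t))
  time_pd_pd : ∀ i j, TimeC1 T (fun t => pd i (pd j (g t)))

/-- `‖φ‖_{C^1(𝕋^d; ℝ^d)}`. -/
def normC1 {d : ℕ} (φ : Torus d → Vec d) : ℝ :=
  ∑ i, ((⨆ x, |φ x i|) + ∑ j, ⨆ x, |pd j (fun y => φ y i) x|)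

/-- `‖φ‖_{C^1([0,τ] × 𝕋^d; ℝ^d)}` for `φ` of class `C^1` on `[0,T] × 𝕋^d`, where `τ ≤ T`. -/
def normC1T {d : ℕ} (T τ : ℝ) (φ : ℝ → Torus d → Vec d) : ℝ :=
  ∑ i, ((⨆ z : Icc (0 : ℝ) τ × Torus d, |φ z.1 z.2 i|) +
    (⨆ z : Icc (0 : ℝ) τ × Torus d, |dt T (fun t x => φ t x i) z.1 z.2|) +
    ∑ j, ⨆ z : Icc (0 : ℝ) τ × Torus d, |pd j (fun y => φ z.1 y i) z.2|)

/-! ### Constitutive functions -/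

/-- Cost function `p(s) = s^γ`. -/
def p (γ s : ℝ) : ℝ := s ^ γ

/-- `E(s) = ∫₀ˢ p(r) dr`. -/
def E (γ s : ℝ) : ℝ := ∫ r in (0 : ℝ)..s, p γ r

/-- `Q' = √s p'(s)`, normalised by `Q(0) = 0`. -/
def Q (γ s : ℝ) : ℝ := ∫ r in (0 : ℝ)..s, √r * deriv (p γ) r

/-! ### Strong solutions -/

/-- Classical solution on `[0,T] × 𝕋^d` with positive density, in the class
`C^1([0,T]; C^2(𝕋^d))`, of
`∂_t ρ + div (ρ w) - div (√ρ ∇Q(ρ)) = 0`,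
`∂_t (ρ w) + div (ρ w ⊗ w) = div (∇Q(ρ) ⊗ √ρ w)`. -/
structure IsStrongSolution (d : ℕ) (γ T : ℝ) (ρ : ℝ → Torus d → ℝ) (w : ℝ → Torus d → Vec d) :
    Prop where
  reg_density : IsC1C2 T ρ
  reg_velocity : ∀ i, IsC1C2 T (fun t x => w t x i)
  pos : ∀ t ∈ Icc 0 T, ∀ x, 0 < ρ t x
  continuity : ∀ t ∈ Ioo 0 T, ∀ x,
    dt T ρ t x + ∑ j, pd j (fun y => ρ t y * w t y j) x
      - ∑ j, pd j (fun y => √(ρ t y) * pd j (fun y' => Q γ (ρ t y')) y) x = 0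
  momentum : ∀ t ∈ Ioo 0 T, ∀ x, ∀ i,
    dt T (fun s y => ρ s y * w s y i) t x + ∑ j, pd j (fun y => ρ t y * w t y j * w t y i) x
      = ∑ j, pd j (fun y => pd j (fun y' => Q γ (ρ t y')) y * (√(ρ t y) * w t y i)) x

/-! ### Young measures and function spaces -/

/-- Phase space `[0,∞) × ℝ^d × ℝ^d`; the components stand for `ρ`, `√ρ w` and `∇Q(ρ)`. -/
abbrev Phase (d : ℕ) : Type := ℝ≥0 × Vec d × Vec d

/-- A Young measure, as a measurable family of measures (an everywhere defined representative;
probability is the class `IsMarkovKernel`); only its values for almost every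
`(t,x) ∈ (0,T) × 𝕋^d` matter. -/
abbrev YoungMeasure (d : ℕ) : Type := Kernel (ℝ × Torus d) (Phase d)

/-- Initial Young measure, on the phase space of `(ρ, √ρ w)`. -/
abbrev InitialYoungMeasure (d : ℕ) : Type := Kernel (Torus d) (ℝ≥0 × Vec d)

/-- Lebesgue measure on `(0,T)`. -/
abbrev timeMeasure (T : ℝ) : Measure ℝ := volume.restrict (Ioo 0 T)

/-- Lebesgue measure on `(0,T) × 𝕋^d`. -/
abbrev cylMeasure (d : ℕ) (T : ℝ) : Measure (ℝ × Torus d) := (timeMeasure T).prod volume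

/-- `⟨V_{t,x}; f⟩`. -/
def av {d : ℕ} {G : Type*} [NormedAddCommGroup G] [NormedSpace ℝ G] (V : YoungMeasure d)
    (f : Phase d → G) (t : ℝ) (x : Torus d) : G :=
  ∫ y, f y ∂(V (t, x))

/-- The density `ρ(t,x) = ⟨V_{t,x}; s⟩`. -/
def dens {d : ℕ} (V : YoungMeasure d) (t : ℝ) (x : Torus d) : ℝ :=
  av V (fun y => (y.1 : ℝ)) t x

/-- `⟨V_{t,x}; W⟩`, where `W` is the second phase variable (standing for `√ρ w`). -/
def avW {d : ℕ} (V : YoungMeasure d) (t : ℝ) (x : Torus d) : Vec d :=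
  av V (fun y => y.2.1) t x

/-- `⟨V_{t,x}; D⟩`, where `D` is the third phase variable (standing for `∇Q(ρ)`). -/
def avD {d : ℕ} (V : YoungMeasure d) (t : ℝ) (x : Torus d) : Vec d :=
  av V (fun y => y.2.2) t x

/-- `f ∈ C_weak(0,T; L^q(𝕋^d))` for `1 < q < ∞` and `f` defined almost everywhere: some
representative has values in `L^q` and is weakly continuous. -/
def CWeak {d : ℕ} (T q : ℝ) (f : ℝ → Torus d → ℝ) : Prop :=
  ∃ g : ℝ → Torus d → ℝ,
    (∀ᵐ z ∂(cylMeasure d T), g z.1 z.2 = f z.1 z.2) ∧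
    (∀ t ∈ Ioo 0 T, MemLp (g t) (ENNReal.ofReal q) volume) ∧
    ∀ ψ : Torus d → ℝ, MemLp ψ (ENNReal.ofReal (Real.conjExponent q)) volume →
      ContinuousOn (fun t => ∫ x, g t x * ψ x) (Ioo 0 T)

/-- `G` is the weak gradient of `g` on the torus. -/
def IsWeakGrad {d : ℕ} (g : Torus d → ℝ) (G : Torus d → Vec d) : Prop :=
  Integrable g volume ∧ Integrable G volume ∧
  ∀ (j : Fin d) (η : Torus d → ℝ), IsCk ⊤ η →
    ∫ x, g x * pd j η x = - ∫ x, G x j * η x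

/-- `g ∈ L²(0,T; W^{1,2}(𝕋^d))` with `∇g = G`. -/
def IsL2W12WithGrad {d : ℕ} (T : ℝ) (g : ℝ → Torus d → ℝ) (G : ℝ → Torus d → Vec d) : Prop :=
  MemLp (fun z : ℝ × Torus d => g z.1 z.2) 2 (cylMeasure d T) ∧
  MemLp (fun z : ℝ × Torus d => G z.1 z.2) 2 (cylMeasure d T) ∧
  ∀ᵐ t ∂(timeMeasure T), IsWeakGrad (g t) (G t)

/-- An element `slice + total` of
`L^∞_{weak-(*)}(0,T; M(𝕋^d)) + M([0,T] × 𝕋^d)`. Only the restriction of `total` to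
`[0,T] × 𝕋^d` is used. -/
structure DefectMeasure (d : ℕ) (T : ℝ) where
  slice : ℝ → SignedMeasure (Torus d)
  total : SignedMeasure (ℝ × Torus d)
  slice_measurable : ∀ g : C(Torus d, ℝ),
    AEStronglyMeasurable (fun t => ∫ᵛ x, g x ∂•(slice t)) (timeMeasure T)
  slice_bounded : ∃ C : ℝ≥0, ∀ᵐ t ∂(timeMeasure T), (slice t).variation univ ≤ C

/-- The integral of `g` over `A × 𝕋^d` with respect to a defect measure. -/
def DefectMeasure.pair {d : ℕ} {T : ℝ} (r : DefectMeasure d T) (A : Set ℝ)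
    (g : ℝ → Torus d → ℝ) : ℝ :=
  (∫ t in A, ∫ᵛ x, g t x ∂•(r.slice t)) + ∫ᵛ z in A ×ˢ univ, g z.1 z.2 ∂•r.total

/-! ### Measure-valued solutions -/

/-- Continuity equation with test function `ψ`, on the time interval `(0,τ)`. -/
def ContinuityEq {d : ℕ} (T : ℝ) (V₀ : InitialYoungMeasure d) (V : YoungMeasure d) (τ : ℝ)
    (ψ : ℝ → Torus d → ℝ) : Prop :=
  (∫ x, dens V τ x * ψ τ x) - (∫ x, (∫ y, (y.1 : ℝ) ∂(V₀ x)) * ψ 0 x)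
    = ∫ t in Ioo 0 τ, ∫ x,
        (dens V t x * dt T ψ t x
          + √(dens V t x) * ∑ j, avW V t x j * pd j (ψ t) x
          - √(dens V t x) * ∑ j, avD V t x j * pd j (ψ t) x)

/-- Momentum equation with test function `φ` and matrix-valued defect `r`, on `(0,τ)`. -/
def MomentumEq {d : ℕ} (T : ℝ) (V₀ : InitialYoungMeasure d) (V : YoungMeasure d)
    (r : Fin d → Fin d → DefectMeasure d T) (τ : ℝ) (φ : ℝ → Torus d → Vec d) : Prop :=
  (∫ x, √(dens V τ x) * ∑ i, avW V τ x i * φ τ x i)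
      - (∫ x, ∑ i, (∫ y, √(y.1 : ℝ) * y.2 i ∂(V₀ x)) * φ 0 x i)
    = (∫ t in Ioo 0 τ, ∫ x,
        (√(dens V t x) * ∑ i, avW V t x i * dt T (fun s y => φ s y i) t x
          + ∑ i, ∑ j, av V (fun y => y.2.1 i * y.2.1 j) t x * pd j (fun y => φ t y i) x
          - ∑ i, ∑ j, av V (fun y => y.2.1 i * y.2.2 j) t x * pd j (fun y => φ t y i) x))
      + ∑ i, ∑ j, (r i j).pair (Icc 0 τ) (fun t x => pd j (fun y => φ t y i) x)

/-- Energy inequality with scalar defect `R`, on `(0,τ)`. -/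
def EnergyIneq {d : ℕ} (γ T : ℝ) (V₀ : InitialYoungMeasure d) (V : YoungMeasure d) (D : ℝ → ℝ)
    (R : DefectMeasure d T) (τ : ℝ) : Prop :=
  (∫ x, av V (fun y => 1 / 2 * ‖y.2.1‖ ^ 2 + E γ y.1) τ x)
      + (∫ t in Ioo 0 τ, ∫ x, av V (fun y => ‖y.2.2‖ ^ 2) t x) + D τ
    ≤ (∫ x, ∫ y, (1 / 2 * ‖y.2‖ ^ 2 + E γ y.1) ∂(V₀ x))
      + (∫ t in Ioo 0 τ, ∫ x, av V (fun y => inner ℝ y.2.1 y.2.2) t x)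
      + R.pair (Ioo 0 τ) (fun _ _ => 1)

/-- Measure-valued solution on `(0,T) × 𝕋^d` with initial Young measure `V₀` and dissipation
defect `D`. The fields `integrable_*` say that the integrals in the definition exist. -/
structure IsMeasureValuedSolution (d : ℕ) (γ T : ℝ) (V₀ : InitialYoungMeasure d)
    (V : YoungMeasure d) (D : ℝ → ℝ) : Prop where
  /-- Initial data of bounded energy. -/
  integrable_initial :
    Integrable (fun z : Torus d × (ℝ≥0 × Vec d) => 1 / 2 * ‖z.2.2‖ ^ 2 + E γ z.2.1)
      (volume ⊗ₘ V₀)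
  defect_bounded : MemLp D ⊤ (timeMeasure T)
  defect_nonneg : ∀ᵐ t ∂(timeMeasure T), 0 ≤ D t
  integrable_energy :
    Integrable (fun z : (ℝ × Torus d) × Phase d => 1 / 2 * ‖z.2.2.1‖ ^ 2 + E γ z.2.1)
      (cylMeasure d T ⊗ₘ V)
  integrable_dissipation :
    Integrable (fun z : (ℝ × Torus d) × Phase d => ‖z.2.2.2‖ ^ 2) (cylMeasure d T ⊗ₘ V)
  density_cweak : CWeak T (γ + 1) (dens V)
  density_power : ∀ α ∈ Ioo 0 (γ + 1),
    (∀ᵐ z ∂(cylMeasure d T), dens V z.1 z.2 ^ α = av V (fun y => (y.1 : ℝ) ^ α) z.1 z.2) ∧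
    CWeak T (1 / α * (γ + 1)) (fun t x => dens V t x ^ α)
  momentum_bounded : ∃ C : ℝ≥0, ∀ᵐ t ∂(timeMeasure T), eLpNorm (avW V t) 2 volume ≤ C
  momentum_factor : ∀ᵐ z ∂(cylMeasure d T),
    √(dens V z.1 z.2) • avW V z.1 z.2 = av V (fun y => √(y.1 : ℝ) • y.2.1) z.1 z.2
  Q_factor : ∀ᵐ z ∂(cylMeasure d T),
    Q γ (dens V z.1 z.2) = av V (fun y => Q γ y.1) z.1 z.2
  Q_sobolev : IsL2W12WithGrad T (fun t x => Q γ (dens V t x)) (avD V)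
  continuity : ∀ᵐ τ ∂(timeMeasure T), ∀ ψ : ℝ → Torus d → ℝ, IsC1 T ψ →
    ContinuityEq T V₀ V τ ψ
  momentum : ∃ (r : Fin d → Fin d → DefectMeasure d T) (ξ : ℝ → ℝ),
    Integrable ξ (timeMeasure T) ∧
    ∀ᵐ τ ∂(timeMeasure T), ∀ ε : ℝ, 0 < ε → ∀ φ : ℝ → Torus d → Vec d,
      (∀ i, IsC1 T (fun t x => φ t x i)) →
      MomentumEq T V₀ V r τ φ ∧
      |∑ i, ∑ j, (r i j).pair (Icc 0 τ) (fun t x => pd j (fun y => φ t y i) x)|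
        ≤ (1 + 1 / (4 * ε)) * (∫ t in Ioo 0 τ, ξ t * D t * normC1 (φ t))
          + ε * normC1T T τ φ * D τ
  energy : ∃ (R : DefectMeasure d T) (C : ℝ),
    ∀ᵐ τ ∂(timeMeasure T), ∀ ε : ℝ, 0 < ε →
      EnergyIneq γ T V₀ V D R τ ∧
      |R.pair (Ioo 0 τ) (fun _ _ => 1)|
        ≤ C * (1 + 1 / (4 * ε)) * (∫ t in Ioo 0 τ, D t) + ε * D τ

end DissipativeAR

end

/-! The proof is a relative energy argument. Put P = ∇p(ρ̄) and u = w̄ − P. Since √ρ ∇Q(ρ) = ρ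
∇p(ρ), the strong solution satisfies ∂_t ρ̄ + div(ρ̄ u) = 0 and ∂_t w̄ + u·∇w̄ = 0
(`continuity_vel`, `transport`). The distance of a phase point (s, W, F) from the strong state is
measured by the relative energy ½|W − √s w̄|² + E(s) − E(ρ̄) − p(ρ̄)(s − ρ̄) and the relative
dissipation |F − √s P|². Expanding the relative energy (`relEnergy_eq`) leaves only quantities
governed by the energy inequality, by the momentum equation tested with w̄, by the continuity
equation tested with ½|w̄|² − p(ρ̄), and the function γE(ρ̄) of the strong solution. The resulting
rate of change is computed pointwise in phase space (`production_identity`). It consists of a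
remainder controlled by the relative energy and half of the relative dissipation (`production_le`),
the term √s F·u + γE(s) div u, and the exact divergence −div(γE(ρ̄)u).

The analytic core is that √s F·u + γE(s) div u has zero integral. The density does not oscillate:
the mean of √s equals the square root of the mean of s, which is equality in Jensen's inequality
(`ae_eq_mean_of_sqrt`). The claim thus becomes √ϱ ∇Q(ϱ) = ∇(γE(ϱ)) in the weak sense. Only Q(ϱ) is
known to be a Sobolev function, and √ϱ is not a Lipschitz function of Q(ϱ), so the standard chain
rule does not apply. However, γE is a convex function of Q with derivative √ϱ. Hence, for η ≥ 0, the
integral of η(x)[γE(ϱ)(x + he_j) − √ϱ(x) Q(ϱ)(x + he_j)] is minimal at h = 0, and the vanishing of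
its derivative there is the chain rule (`integral_mul_pd_of_convex`). The part with Q(ϱ) is
differentiable in h because translates of a Sobolev function are weakly differentiable in L², which
is checked on Fourier modes.

Finally, ε is chosen so that the two defect measures cost at most half of D(τ). A Grönwall argument
with a merely integrable weight (`ae_eq_zero_of_le_integral_mul`) makes the relative energy and D
vanish, and what remains of the inequality makes the relative dissipation vanish. Strict convexity
of E then pins down the phase point. -/

namespace DissipativeAR

open Filter Topology

/-! ### Calculus on the torus -/

section Calculus

variable {d : ℕ}

/-- The point `h e_j` of the torus. -/
def shift (j : Fin d) (h : ℝ) : Torus d := toTorus (Pi.single j h)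

lemma toTorus_add (a b : Fin d → ℝ) : toTorus (a + b) = toTorus a + toTorus b := by
  ext i; simp [toTorus]

lemma isOpenQuotientMap_toTorus : IsOpenQuotientMap (toTorus : (Fin d → ℝ) → Torus d) :=
  IsOpenQuotientMap.piMap (f := fun _ : Fin d => ((↑) : ℝ → UnitAddCircle))
    fun _ => QuotientAddGroup.isOpenQuotientMap_mk

lemma shift_add (j : Fin d) (a b : ℝ) : shift j (a + b) = shift j a + shift j b := by
  rw [shift, Pi.single_add, toTorus_add]; rfl

@[simp] lemma shift_zero (j : Fin d) : shift j 0 = 0 := by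
  ext i; simp [shift, toTorus]

lemma IsCk.continuous {k : ℕ∞} {g : Torus d → ℝ} (hg : IsCk k g) : Continuous g :=
  isOpenQuotientMap_toTorus.isQuotientMap.continuous_iff.2 (ContDiff.continuous hg)

lemma IsCk.of_le {m n : ℕ∞} {g : Torus d → ℝ} (hg : IsCk n g) (h : m ≤ n) : IsCk m g :=
  ContDiff.of_le hg (by exact_mod_cast h)

lemma IsCk.hasDerivAt_lift {k : ℕ∞} {g : Torus d → ℝ} (hg : IsCk k g) (hk : 1 ≤ k) (j : Fin d)
    (y : Fin d → ℝ) : HasDerivAt (fun h : ℝ => g (toTorus y + shift j h))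
      (fderiv ℝ (fun y : Fin d → ℝ => g (toTorus y)) y (Pi.single j 1)) 0 := by
  have h1 : HasFDerivAt (fun y : Fin d → ℝ => g (toTorus y))
      (fderiv ℝ (fun y : Fin d → ℝ => g (toTorus y)) y) (y + Pi.single j 0) := by
    rw [Pi.single_zero, add_zero]
    exact (ContDiff.differentiable hg (by
      have : k ≠ 0 := by rintro rfl; simp at hk
      exact_mod_cast this) y).hasFDerivAt
  have h2 : HasDerivAt (fun h : ℝ => y + Pi.single j h) (Pi.single j (1 : ℝ)) 0 :=
    (hasDerivAt_single j (0 : ℝ)).const_add y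
  refine (h1.comp_hasDerivAt (0 : ℝ) h2).congr_of_eventuallyEq (Eventually.of_forall fun h => ?_)
  simp [toTorus_add, shift]

lemma IsCk.pd_toTorus {k : ℕ∞} {g : Torus d → ℝ} (hg : IsCk k g) (hk : 1 ≤ k) (j : Fin d)
    (y : Fin d → ℝ) : pd j g (toTorus y)
      = fderiv ℝ (fun y : Fin d → ℝ => g (toTorus y)) y (Pi.single j 1) :=
  (hg.hasDerivAt_lift hk j y).deriv

lemma IsCk.hasDerivAt_zero {k : ℕ∞} {g : Torus d → ℝ} (hg : IsCk k g) (hk : 1 ≤ k) (j : Fin d)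
    (x : Torus d) : HasDerivAt (fun h : ℝ => g (x + shift j h)) (pd j g x) 0 := by
  obtain ⟨y, rfl⟩ := isOpenQuotientMap_toTorus.surjective x
  exact (hg.hasDerivAt_lift hk j y).differentiableAt.hasDerivAt

lemma IsCk.hasDerivAt {k : ℕ∞} {g : Torus d → ℝ} (hg : IsCk k g) (hk : 1 ≤ k) (j : Fin d)
    (x : Torus d) (s : ℝ) :
    HasDerivAt (fun h : ℝ => g (x + shift j h)) (pd j g (x + shift j s)) s := by
  have h1 := hg.hasDerivAt_zero hk j (x + shift j s)
  have h2 : HasDerivAt (fun h : ℝ => h - s) 1 s := (hasDerivAt_id s).sub_const s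
  have h3 := HasDerivAt.comp_of_eq s h1 h2 (by simp)
  rw [mul_one] at h3
  refine h3.congr_of_eventuallyEq (Eventually.of_forall fun h => ?_)
  simp [add_assoc, ← shift_add]

lemma IsCk.pd {m n : ℕ∞} {g : Torus d → ℝ} (hg : IsCk n g) (h : m + 1 ≤ n) (j : Fin d) :
    IsCk m (pd j g) := by
  have h1 : 1 ≤ n := le_trans le_add_self h
  have h2 : (fun y : Fin d → ℝ => DissipativeAR.pd j g (toTorus y)) =
      fun y => fderiv ℝ (fun y : Fin d → ℝ => g (toTorus y)) y (Pi.single j 1) :=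
    funext fun y => hg.pd_toTorus h1 j y
  unfold IsCk
  rw [h2]
  exact (ContDiff.fderiv_right (m := (m : WithTop ℕ∞)) hg (by exact_mod_cast h)).clm_apply
    contDiff_const

lemma IsCk.continuous_pd {n : ℕ∞} {g : Torus d → ℝ} (hg : IsCk n g) (h : 1 ≤ n) (j : Fin d) :
    Continuous (DissipativeAR.pd j g) :=
  (hg.pd (m := 0) (by simpa using h) j).continuous

lemma IsCk.add {k : ℕ∞} {f g : Torus d → ℝ} (hf : IsCk k f) (hg : IsCk k g) :
    IsCk k (fun x => f x + g x) := ContDiff.add hf hg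

lemma IsCk.sub {k : ℕ∞} {f g : Torus d → ℝ} (hf : IsCk k f) (hg : IsCk k g) :
    IsCk k (fun x => f x - g x) := ContDiff.sub hf hg

lemma IsCk.mul {k : ℕ∞} {f g : Torus d → ℝ} (hf : IsCk k f) (hg : IsCk k g) :
    IsCk k (fun x => f x * g x) := ContDiff.mul hf hg

lemma isCk_const {k : ℕ∞} (c : ℝ) : IsCk k (fun _ : Torus d => c) := contDiff_const

lemma IsCk.rpow {k : ℕ∞} {f : Torus d → ℝ} (hf : IsCk k f) (h0 : ∀ x, 0 < f x) (α : ℝ) :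
    IsCk k (fun x => f x ^ α) :=
  ContDiff.rpow_const_of_ne hf fun _ => (h0 _).ne'

lemma pd_add {f g : Torus d → ℝ} (hf : IsCk 1 f) (hg : IsCk 1 g) (j : Fin d) (x : Torus d) :
    pd j (fun x => f x + g x) x = pd j f x + pd j g x :=
  ((hf.hasDerivAt_zero le_rfl j x).add (hg.hasDerivAt_zero le_rfl j x)).deriv

lemma pd_sub {f g : Torus d → ℝ} (hf : IsCk 1 f) (hg : IsCk 1 g) (j : Fin d) (x : Torus d) :
    pd j (fun x => f x - g x) x = pd j f x - pd j g x :=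
  ((hf.hasDerivAt_zero le_rfl j x).sub (hg.hasDerivAt_zero le_rfl j x)).deriv

lemma pd_mul {f g : Torus d → ℝ} (hf : IsCk 1 f) (hg : IsCk 1 g) (j : Fin d) (x : Torus d) :
    pd j (fun x => f x * g x) x = pd j f x * g x + f x * pd j g x := by
  have := ((hf.hasDerivAt_zero le_rfl j x).mul (hg.hasDerivAt_zero le_rfl j x)).deriv
  simp only [shift_zero, add_zero] at this
  exact this

lemma pd_comp {f : Torus d → ℝ} (hf : IsCk 1 f) {φ : ℝ → ℝ} {φ' : ℝ} (j : Fin d) (x : Torus d)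
    (hφ : HasDerivAt φ φ' (f x)) : pd j (fun x => φ (f x)) x = φ' * pd j f x :=
  (HasDerivAt.comp_of_eq (0 : ℝ) hφ (hf.hasDerivAt_zero le_rfl j x) (by simp)).deriv

lemma pd_const (c : ℝ) (j : Fin d) (x : Torus d) : pd j (fun _ => c) x = 0 := by simp [pd]

end Calculus

/-! ### Differentiation under translations -/

section Translation

variable {d : ℕ}

lemma hasDerivAt_integral_mul_translate {k η : Torus d → ℝ} (hk : Integrable k) (hη : IsCk 1 η)
    (j : Fin d) (s : ℝ) : HasDerivAt (fun h : ℝ => ∫ x, k x * η (x + shift j h))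
      (∫ x, k x * pd j η (x + shift j s)) s := by
  obtain ⟨C, hC⟩ := isCompact_univ.exists_bound_of_continuousOn
    (hη.continuous_pd le_rfl j).continuousOn
  obtain ⟨C', hC'⟩ := isCompact_univ.exists_bound_of_continuousOn hη.continuous.continuousOn
  have hc : ∀ {f : Torus d → ℝ} (s : ℝ), Continuous f → Continuous fun x => f (x + shift j s) :=
    fun s hf => hf.comp (continuous_add_const _)
  refine (hasDerivAt_integral_of_dominated_loc_of_deriv_le (s := univ)
    (F := fun h x => k x * η (x + shift j h)) (F' := fun h x => k x * pd j η (x + shift j h))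
    (bound := fun x => C * ‖k x‖) univ_mem ?_ ?_ ?_ ?_ (hk.norm.const_mul C) ?_).2
  · exact Eventually.of_forall fun h =>
      hk.aestronglyMeasurable.mul (hc h hη.continuous).aestronglyMeasurable
  · exact hk.mul_bdd (c := C') (hc s hη.continuous).aestronglyMeasurable
      (Eventually.of_forall fun x => hC' _ (mem_univ _))
  · exact hk.aestronglyMeasurable.mul (hc s (hη.continuous_pd le_rfl j)).aestronglyMeasurable
  · refine Eventually.of_forall fun x h _ => ?_
    rw [norm_mul, mul_comm]
    gcongr
    exact hC _ (mem_univ _)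
  · exact Eventually.of_forall fun x h _ => (hη.hasDerivAt le_rfl j x h).const_mul (k x)

/-- The integral of a partial derivative over the torus vanishes. -/
lemma integral_pd_eq_zero {η : Torus d → ℝ} (hη : IsCk 1 η) (j : Fin d) :
    ∫ x, pd j η x = 0 := by
  have h := hasDerivAt_integral_mul_translate (integrable_const (1 : ℝ)) hη j 0
  simp only [one_mul, shift_zero, add_zero] at h
  -- By translation invariance the differentiated integral does not depend on h.
  simp_rw [integral_add_right_eq_self η] at h
  exact h.unique (hasDerivAt_const _ _)

lemma eLpNorm_translate {E : Type*} [NormedAddCommGroup E] {p : ℝ≥0∞} {g : Torus d → E}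
    (hg : AEStronglyMeasurable g) (a : Torus d) :
    eLpNorm (fun x => g (x + a)) p volume = eLpNorm g p volume :=
  eLpNorm_comp_measurePreserving hg (measurePreserving_add_right _ a)

lemma memLp_translate {E : Type*} [NormedAddCommGroup E] {p : ℝ≥0∞} {g : Torus d → E}
    (hg : MemLp g p) (a : Torus d) : MemLp (fun x => g (x + a)) p :=
  hg.comp_measurePreserving (measurePreserving_add_right _ a)

/-! ### Fourier modes and weak differentiability of translates -/

open UnitAddTorus ComplexConjugate in
lemma mFourier_shift (n : Fin d → ℤ) (j : Fin d) (s : ℝ) :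
    mFourier n (shift j s) = Complex.exp (2 * Real.pi * Complex.I * n j * s) := by
  simp only [mFourier, ContinuousMap.coe_mk, shift, toTorus]
  rw [Finset.prod_eq_single j]
  · rw [fourier_coe_apply]; simp
  · intro i _ hi; simp [hi]
  · simp

open UnitAddTorus in
lemma mFourier_apply_add (n : Fin d → ℤ) (x y : Torus d) :
    mFourier n (x + y) = mFourier n x * mFourier n y := by
  simp [mFourier, fourier_apply, Finset.prod_mul_distrib, AddCircle.toCircle_add]

open UnitAddTorus in
lemma contDiff_mFourier (n : Fin d → ℤ) {k : WithTop ℕ∞} :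
    ContDiff ℝ k (fun y : Fin d → ℝ => mFourier n (toTorus y)) := by
  simp only [mFourier, ContinuousMap.coe_mk, toTorus, fourier_coe_apply]
  refine contDiff_prod fun i _ => ?_
  have : ContDiff ℝ k (fun y : Fin d → ℝ => ((y i : ℝ) : ℂ)) :=
    Complex.ofRealCLM.contDiff.comp (contDiff_apply ℝ ℝ i)
  fun_prop

open UnitAddTorus in
lemma hasDerivAt_mFourier_shift (n : Fin d → ℤ) (j : Fin d) (x : Torus d) (s : ℝ) :
    HasDerivAt (fun h : ℝ => mFourier n (x + shift j h))
      (2 * Real.pi * Complex.I * n j * mFourier n (x + shift j s)) s := by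
  simp only [mFourier_apply_add, mFourier_shift]
  have h0 : HasDerivAt (fun h : ℝ => (2 * Real.pi * Complex.I * n j * h : ℂ))
      (2 * Real.pi * Complex.I * n j) s := by
    simpa using (Complex.ofRealCLM.hasDerivAt (x := s)).const_mul (2 * Real.pi * Complex.I * n j)
  have h := (h0.cexp).const_mul (mFourier n x)
  exact h.congr_deriv (by ring)

open UnitAddTorus in
/-- The weak gradient, tested with exponential monomials. -/
lemma IsWeakGrad.integral_mFourier {g : Torus d → ℝ} {G : Torus d → Vec d} (h : IsWeakGrad g G)
    (j : Fin d) (n : Fin d → ℤ) :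
    ∫ x, mFourier n x * (G x j : ℂ) = -(2 * Real.pi * Complex.I * n j * ∫ x, mFourier n x * g x) := by
  have hGj : Integrable (fun x => G x j) := (EuclideanSpace.proj (𝕜 := ℝ) j).integrable_comp h.2.1
  set m := mFourier n with hm
  have hint : ∀ {f : Torus d → ℝ}, Integrable f → Integrable (fun x => m x * (f x : ℂ)) :=
    fun hf => hf.ofReal.bdd_mul (c := 1) m.continuous.aestronglyMeasurable
      (Eventually.of_forall fun x => (m.norm_coe_le_norm x).trans mFourier_norm.le)
  -- Weak gradients are tested with real functions only, so the exponential is split into its real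
  -- and imaginary parts and reassembled through `key`.
  have hre : IsCk ⊤ (fun x => (m x).re) := Complex.reCLM.contDiff.comp (contDiff_mFourier n)
  have him : IsCk ⊤ (fun x => (m x).im) := Complex.imCLM.contDiff.comp (contDiff_mFourier n)
  have dre : ∀ x, pd j (fun x => (m x).re) x = (2 * Real.pi * Complex.I * n j * m x).re := by
    intro x
    have := Complex.reCLM.hasFDerivAt.comp_hasDerivAt (0 : ℝ) (hasDerivAt_mFourier_shift n j x 0)
    simp only [shift_zero, add_zero] at this
    exact this.deriv
  have dim : ∀ x, pd j (fun x => (m x).im) x = (2 * Real.pi * Complex.I * n j * m x).im := by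
    intro x
    have := Complex.imCLM.hasFDerivAt.comp_hasDerivAt (0 : ℝ) (hasDerivAt_mFourier_shift n j x 0)
    simp only [shift_zero, add_zero] at this
    exact this.deriv
  have e1 := h.2.2 j _ hre
  have e2 := h.2.2 j _ him
  simp only [dre] at e1
  simp only [dim] at e2
  have key : ∀ f : Torus d → ℝ, Integrable f → ∀ c : ℂ, c * ∫ x, m x * f x
      = ((∫ x, f x * (c * m x).re : ℝ) : ℂ) + ((∫ x, f x * (c * m x).im : ℝ) : ℂ) * Complex.I := by
    intro f hf c
    have hi : Integrable (fun x => c * (m x * (f x : ℂ))) := (hint hf).const_mul c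
    rw [← integral_const_mul, ← integral_re_add_im hi]
    simp only [RCLike.re_to_complex, RCLike.im_to_complex, RCLike.I_to_complex, Complex.coe_algebraMap]
    congr 3
    · funext x
      simp only [← mul_assoc, Complex.re_mul_ofReal]; ring
    · congr 1
      funext x
      simp only [← mul_assoc, Complex.im_mul_ofReal]; ring
  rw [key g h.1, e1, e2]
  have := key _ hGj 1
  simp only [one_mul] at this
  rw [this]
  push_cast
  ring

/-- The translate of a square integrable function, as an element of complex `L²`. -/
noncomputable def translateLp {g : Torus d → ℝ} (hg : MemLp g 2) (a : Torus d) :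
    Lp ℂ 2 (volume : Measure (Torus d)) :=
  (memLp_translate (E := ℂ) hg.ofReal a).toLp _

lemma norm_translateLp {g : Torus d → ℝ} (hg : MemLp g 2) (a : Torus d) :
    ‖translateLp hg a‖ = ‖translateLp hg 0‖ := by
  simp only [translateLp, Lp.norm_toLp]
  congr 1
  have h : AEStronglyMeasurable (fun x => (g x : ℂ)) (volume : Measure (Torus d)) :=
    hg.ofReal.aestronglyMeasurable
  exact (eLpNorm_translate h a).trans (eLpNorm_translate h 0).symm

lemma inner_translateLp {g : Torus d → ℝ} (hg : MemLp g 2) (a : Torus d)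
    (f : Lp ℂ 2 (volume : Measure (Torus d))) {f' : Torus d → ℂ} (hf : f =ᵐ[volume] f') :
    inner ℂ f (translateLp hg a) = ∫ x, (starRingEnd ℂ) (f' x) * (g (x + a) : ℂ) := by
  rw [L2.inner_def]
  refine integral_congr_ae ?_
  filter_upwards [hf, (memLp_translate (E := ℂ) hg.ofReal a).coeFn_toLp] with x h1 h2
  rw [translateLp, h2, h1, RCLike.inner_apply, mul_comm]
  rfl

open UnitAddTorus in
-- Translation acts on a Fourier coefficient by a phase. The dependence on `s` is therefore explicit
-- and smooth, whatever the regularity of `g`.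
lemma inner_mFourier_translateLp {g : Torus d → ℝ} (hg : MemLp g 2) (n : Fin d → ℤ) (j : Fin d)
    (s : ℝ) :
    inner ℂ (ContinuousMap.toLp (E := ℂ) 2 (volume : Measure (Torus d)) ℂ (mFourier n))
      (translateLp hg (shift j s)) =
        Complex.exp (2 * Real.pi * Complex.I * n j * s) * ∫ x, mFourier (-n) x * (g x : ℂ) := by
  rw [inner_translateLp hg _ _ (ContinuousMap.coeFn_toLp _ _), ← mFourier_shift,
    ← integral_add_right_eq_self (fun x => mFourier (-n) x * (g x : ℂ)) (shift j s), ← integral_const_mul]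
  refine integral_congr_ae (Eventually.of_forall fun x => ?_)
  have h1 : mFourier n (shift j s) * mFourier (-n) (shift j s) = 1 := by
    rw [← mFourier_add, add_neg_cancel, mFourier_zero, ContinuousMap.one_apply]
  simp only [← mFourier_neg, mFourier_apply_add (-n)]
  linear_combination (-(mFourier (-n) x * (g (x + shift j s) : ℂ))) * h1

/-- Weak differentiability of a bounded curve in a Hilbert space may be tested on a set with dense
span. -/
lemma hasDerivAt_inner_of_span_dense {H : Type*} [NormedAddCommGroup H] [InnerProductSpace ℂ H]
    {S₀ : Set H} (hspan : (Submodule.span ℂ S₀).topologicalClosure = ⊤) {u v : ℝ → H} {M N : ℝ}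
    (hu : ∀ s, ‖u s‖ ≤ M) (hv : ∀ s, ‖v s‖ ≤ N)
    (h : ∀ f ∈ S₀, ∀ s, HasDerivAt (fun s : ℝ => inner ℂ f (u s)) (inner ℂ f (v s)) s)
    (f : H) (s : ℝ) : HasDerivAt (fun s : ℝ => inner ℂ f (u s)) (inner ℂ f (v s)) s := by
  let S : Submodule ℂ H :=
    { carrier := {f | ∀ s : ℝ, HasDerivAt (fun s : ℝ => inner ℂ f (u s)) (inner ℂ f (v s)) s}
      add_mem' := fun ha hb s => by
        simp only [inner_add_left]
        exact (ha s).add (hb s)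
      zero_mem' := fun s => by simpa only [inner_zero_left] using hasDerivAt_const s (0 : ℂ)
      smul_mem' := fun c _ ha s => by
        simp only [inner_smul_left]
        exact (ha s).const_mul _ }
  have hdist : ∀ (a b : H) {w : H} {C : ℝ}, ‖w‖ ≤ C →
      dist (inner ℂ a w) (inner ℂ b w) ≤ ‖a - b‖ * C := fun a b w C hw => by
    rw [dist_eq_norm, ← inner_sub_left]
    exact (norm_inner_le_norm _ _).trans (by gcongr)
  have hlim : ∀ (c : ℝ) {a : ℕ → H} {b : H}, Tendsto a atTop (𝓝 b) →
      Tendsto (fun n => ‖b - a n‖ * c) atTop (𝓝 0) := fun c a b hab => by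
    simpa using ((tendsto_const_nhds (x := b)).sub hab).norm.mul_const c
  -- The admissible `f` form a closed subspace: the bound on `v` makes the derivatives converge
  -- uniformly in `s`, the bound on `u` makes the functions converge pointwise, and
  -- differentiability passes to such limits.
  have hcl : IsClosed (S : Set H) := by
    refine IsSeqClosed.isClosed fun a b ha hab s => ?_
    refine hasDerivAt_of_tendstoUniformly (l := atTop) (f := fun n s => inner ℂ (a n) (u s))
      (f' := fun n s => inner ℂ (a n) (v s)) (g' := fun s => inner ℂ b (v s))
      ?_ (Eventually.of_forall fun n => ha n) ?_ s
    · rw [Metric.tendstoUniformly_iff]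
      intro ε hε
      filter_upwards [(hlim N hab).eventually (gt_mem_nhds hε)] with n hn x
      exact (hdist _ _ (hv x)).trans_lt hn
    · intro x
      rw [tendsto_iff_dist_tendsto_zero]
      refine squeeze_zero (fun _ => dist_nonneg) (fun n => ?_) (hlim M hab)
      rw [dist_comm]
      exact hdist _ _ (hu x)
  have hS : (Submodule.span ℂ S₀).topologicalClosure ≤ S :=
    Submodule.topologicalClosure_minimal _ (Submodule.span_le.2 h) hcl
  exact hS (hspan ▸ Submodule.mem_top) s

open UnitAddTorus in
-- Against a Fourier mode, differentiating the phase produces the factor 2πi n_j, which is exactly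
-- how the weak gradient acts on Fourier coefficients. Trigonometric polynomials are dense in L² and
-- translation preserves the norm, so the general case follows from
-- `hasDerivAt_inner_of_span_dense`.
lemma hasDerivAt_inner_translateLp {g : Torus d → ℝ} {G : Torus d → Vec d} (hg : MemLp g 2)
    (j : Fin d) (hG : MemLp (fun x => G x j) 2) (h : IsWeakGrad g G)
    (f : Lp ℂ 2 (volume : Measure (Torus d))) (s : ℝ) :
    HasDerivAt (fun s : ℝ => inner ℂ f (translateLp hg (shift j s)))
      (inner ℂ f (translateLp hG (shift j s))) s := by
  have hspan : (Submodule.span ℂ (range fun n : Fin d → ℤ => ContinuousMap.toLp (E := ℂ) 2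
      (volume : Measure (Torus d)) ℂ (mFourier n))).topologicalClosure = ⊤ := by
    simpa only [Submodule.map_span, ContinuousLinearMap.coe_coe, ← range_comp, Function.comp_def]
      using (ContinuousMap.toLp_denseRange ℂ (volume : Measure (Torus d)) ℂ
        (by simp)).topologicalClosure_map_submodule span_mFourier_closure_eq_top
  refine hasDerivAt_inner_of_span_dense hspan (fun s => (norm_translateLp hg (shift j s)).le)
    (fun s => (norm_translateLp hG (shift j s)).le) ?_ f s
  rintro _ ⟨n, rfl⟩ s
  simp only [inner_mFourier_translateLp]
  have h0 : HasDerivAt (fun h : ℝ => (2 * Real.pi * Complex.I * n j * h : ℂ))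
      (2 * Real.pi * Complex.I * n j) s := by
    simpa using (Complex.ofRealCLM.hasDerivAt (x := s)).const_mul (2 * Real.pi * Complex.I * n j)
  rw [h.integral_mFourier j (-n)]
  refine (h0.cexp.mul_const _).congr_deriv ?_
  simp only [Pi.neg_apply, Int.cast_neg]
  ring

/-- Translates of a Sobolev function are weakly differentiable in `L²`. -/
lemma hasDerivAt_integral_translate_weakGrad {g f : Torus d → ℝ} {G : Torus d → Vec d}
    (hf : MemLp f 2) (hg : MemLp g 2) (j : Fin d) (hG : MemLp (fun x => G x j) 2)
    (h : IsWeakGrad g G) :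
    HasDerivAt (fun s : ℝ => ∫ x, f x * g (x + shift j s)) (∫ x, f x * G x j) 0 := by
  have hf' : MemLp (fun x => (f x : ℂ)) 2 := hf.ofReal
  have h1 := hasDerivAt_inner_translateLp hg j hG h (hf'.toLp _) 0
  have e : ∀ {k : Torus d → ℝ} (hk : MemLp k 2) (a : Torus d),
      inner ℂ (hf'.toLp _) (translateLp hk a)
        = ((∫ x, f x * k (x + a) : ℝ) : ℂ) := by
    intro k hk a
    rw [inner_translateLp hk a _ hf'.coeFn_toLp, ← integral_complex_ofReal]
    refine integral_congr_ae (Eventually.of_forall fun x => ?_)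
    simp
  simp only [e] at h1
  have h2 := Complex.reCLM.hasFDerivAt.comp_hasDerivAt (0 : ℝ) h1
  simpa [Function.comp_def] using h2

/-- Chain rule for a Sobolev function `g` and `Φ = φ ∘ g`, `σ = φ' ∘ g`, where `φ` is convex. -/
lemma integral_mul_pd_of_convex {g Φ σ η : Torus d → ℝ} {G : Torus d → Vec d} (hg : MemLp g 2)
    (j : Fin d) (hG : MemLp (fun x => G x j) 2) (h : IsWeakGrad g G) (hΦ : Integrable Φ)
    (hσ : MemLp σ 2) (hconv : ∀ x y, σ x * (g y - g x) ≤ Φ y - Φ x) (hη : IsCk 1 η) :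
    ∫ x, Φ x * pd j η x = - ∫ x, σ x * G x j * η x := by
  have main : ∀ η : Torus d → ℝ, IsCk 1 η → (∀ x, 0 ≤ η x) →
      ∫ x, Φ x * pd j η x = - ∫ x, σ x * G x j * η x := by
    intro η hη hpos
    obtain ⟨C, hC⟩ := isCompact_univ.exists_bound_of_continuousOn hη.continuous.continuousOn
    have hση : MemLp (fun x => η x * σ x) 2 := by
      refine (hσ.const_mul C).mono (hη.continuous.aestronglyMeasurable.mul hσ.1)
        (Eventually.of_forall fun x => ?_)
      rw [norm_mul, norm_mul]
      gcongr
      exact (hC x (mem_univ _)).trans (le_abs_self C)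
    have d1 := hasDerivAt_integral_translate_weakGrad hση hg j hG h
    -- No differentiability of `Φ` is available, so the shift is moved onto `η` by translation
    -- invariance; this reverses its direction and accounts for the sign.
    have d2 : HasDerivAt (fun s : ℝ => ∫ x, η x * Φ (x + shift j s))
        (-∫ x, Φ x * pd j η x) 0 := by
      have h0 : HasDerivAt (fun h : ℝ => ∫ x, Φ x * η (x + shift j h))
          (∫ x, Φ x * pd j η x) (-0) := by
        simpa using hasDerivAt_integral_mul_translate hΦ hη j 0
      have h1 := h0.comp (0 : ℝ) (hasDerivAt_neg (0 : ℝ))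
      rw [mul_neg, mul_one] at h1
      refine h1.congr_of_eventuallyEq (Eventually.of_forall fun s => ?_)
      simp only [Function.comp_apply]
      rw [← integral_add_right_eq_self (fun x => Φ x * η (x + shift j (-s))) (shift j s)]
      refine integral_congr_ae (Eventually.of_forall fun x => ?_)
      simp [add_assoc, ← shift_add, mul_comm]
    -- The subgradient inequality between `x` and its translate, weighted by `η ≥ 0`, makes `s = 0`
    -- a global minimum. Both terms are differentiable there, so their derivatives agree.
    have hmin : IsLocalMin (fun s : ℝ => (∫ x, η x * Φ (x + shift j s))
        - ∫ x, η x * σ x * g (x + shift j s)) 0 := by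
      refine Eventually.of_forall fun s => ?_
      have i1 : ∀ s, Integrable (fun x => η x * Φ (x + shift j s)) := fun s =>
        (hΦ.comp_add_right (shift j s)).bdd_mul (c := C) hη.continuous.aestronglyMeasurable
          (Eventually.of_forall fun x => hC x (mem_univ _))
      have i2 : ∀ s, Integrable (fun x => η x * σ x * g (x + shift j s)) := fun s =>
        hση.integrable_mul (memLp_translate hg _)
      simp only
      rw [← integral_sub (i1 _) (i2 _), ← integral_sub (i1 _) (i2 _)]
      refine integral_mono ((i1 _).sub (i2 _)) ((i1 _).sub (i2 _)) fun x => ?_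
      have := mul_le_mul_of_nonneg_left (hconv x (x + shift j s)) (hpos x)
      simp only [shift_zero, add_zero]
      linarith
    have h3 := hmin.hasDerivAt_eq_zero (d2.sub d1)
    have h4 : ∫ x, η x * σ x * G x j = ∫ x, σ x * G x j * η x :=
      integral_congr_ae (Eventually.of_forall fun x => by ring)
    linarith
  obtain ⟨C, hC⟩ := isCompact_univ.exists_bound_of_continuousOn hη.continuous.continuousOn
  have hC' : ∀ x, |η x| ≤ |C| := fun x => (hC x (mem_univ _)).trans (le_abs_self C)
  -- Both sides are linear in `η`. A general `η` is the difference of the nonnegative functions `η +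
  -- |C|` and `|C|`.
  have e1 := main (fun x => η x + |C|) (hη.add (isCk_const _)) fun x => by
    linarith [neg_abs_le (η x), hC' x]
  have e2 := main (fun _ => |C|) (isCk_const _) fun x => abs_nonneg C
  simp only [pd_add hη (isCk_const _), pd_const, add_zero, mul_zero, integral_zero] at e1 e2
  rw [e1]
  have i1 : Integrable (fun x => σ x * G x j * |C|) := (hσ.integrable_mul hG).mul_const _
  have i2 : Integrable (fun x => σ x * G x j * η x) := (hσ.integrable_mul hG).mul_bdd (c := C)
    hη.continuous.aestronglyMeasurable (Eventually.of_forall fun x => hC x (mem_univ _))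
  simp only [mul_add]
  rw [integral_add i2 i1]
  linarith

end Translation
/-! ### Functions of class `C¹` in time and space -/

section TimeCalculus

variable {d : ℕ} {T : ℝ}

/-- Continuity of `c` on `[0,T] × 𝕋^d`. -/
def ContCyl {d : ℕ} (T : ℝ) (c : ℝ → Torus d → ℝ) : Prop :=
  ContinuousOn (fun z : ℝ × Torus d => c z.1 z.2) (Icc 0 T ×ˢ univ)

lemma ContCyl.congr {c c' : ℝ → Torus d → ℝ} (h : ContCyl T c)
    (h' : ∀ t ∈ Icc 0 T, ∀ x, c' t x = c t x) : ContCyl T c' :=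
  ContinuousOn.congr h fun z hz => h' z.1 hz.1 z.2

lemma ContCyl.add {c c' : ℝ → Torus d → ℝ} (h : ContCyl T c) (h' : ContCyl T c') :
    ContCyl T (fun t x => c t x + c' t x) := ContinuousOn.add h h'

lemma ContCyl.sub {c c' : ℝ → Torus d → ℝ} (h : ContCyl T c) (h' : ContCyl T c') :
    ContCyl T (fun t x => c t x - c' t x) := ContinuousOn.sub h h'

lemma ContCyl.neg {c : ℝ → Torus d → ℝ} (h : ContCyl T c) :
    ContCyl T (fun t x => - c t x) := ContinuousOn.neg h

lemma ContCyl.mul {c c' : ℝ → Torus d → ℝ} (h : ContCyl T c) (h' : ContCyl T c') :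
    ContCyl T (fun t x => c t x * c' t x) := ContinuousOn.mul h h'

lemma ContCyl.div {c c' : ℝ → Torus d → ℝ} (h : ContCyl T c) (h' : ContCyl T c')
    (h0 : ∀ t ∈ Icc 0 T, ∀ x, c' t x ≠ 0) :
    ContCyl T (fun t x => c t x / c' t x) := ContinuousOn.div h h' fun z hz => h0 z.1 hz.1 z.2

lemma ContCyl.const_mul {c : ℝ → Torus d → ℝ} (h : ContCyl T c) (a : ℝ) :
    ContCyl T (fun t x => a * c t x) := ContinuousOn.mul continuousOn_const h

lemma ContCyl.sum {ι : Type*} {s : Finset ι} {c : ι → ℝ → Torus d → ℝ}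
    (h : ∀ i, ContCyl T (c i)) :
    ContCyl T (fun t x => ∑ i ∈ s, c i t x) := continuousOn_finsetSum s fun i _ => h i

lemma ContCyl.rpow {c : ℝ → Torus d → ℝ} (h : ContCyl T c)
    (h0 : ∀ t ∈ Icc 0 T, ∀ x, 0 < c t x) (α : ℝ) : ContCyl T (fun t x => c t x ^ α) :=
  ContinuousOn.rpow_const h fun z hz => Or.inl (h0 z.1 hz.1 z.2).ne'

lemma ContCyl.exists_bound {c : ℝ → Torus d → ℝ} (h : ContCyl T c) :
    ∃ C, 0 ≤ C ∧ ∀ t ∈ Icc 0 T, ∀ x, |c t x| ≤ C := by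
  obtain ⟨C, hC⟩ := (isCompact_Icc.prod isCompact_univ).exists_bound_of_continuousOn h
  exact ⟨|C|, abs_nonneg C, fun t ht x => (hC (t, x) ⟨ht, mem_univ _⟩).trans (le_abs_self C)⟩

lemma ContCyl.continuous {c : ℝ → Torus d → ℝ} (h : ContCyl T c) {t : ℝ} (ht : t ∈ Icc 0 T) :
    Continuous (c t) := by
  rw [← continuousOn_univ]
  exact ContinuousOn.comp h (f := fun x => (t, x)) (by fun_prop) fun x _ => ⟨ht, mem_univ _⟩

lemma ContCyl.continuousOn_time {c : ℝ → Torus d → ℝ} (h : ContCyl T c) (x : Torus d) :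
    ContinuousOn (fun t => c t x) (Icc 0 T) :=
  ContinuousOn.comp h (f := fun t => (t, x)) (by fun_prop) fun t ht => ⟨ht, mem_univ _⟩

lemma TimeC1.hasDerivWithinAt {g : ℝ → Torus d → ℝ} (h : TimeC1 T g) {t : ℝ} (ht : t ∈ Icc 0 T)
    (x : Torus d) : HasDerivWithinAt (fun t => g t x) (dt T g t x) (Icc 0 T) t :=
  (h.diff x t ht).hasDerivWithinAt

lemma dt_eq (hT : 0 < T) {g : ℝ → Torus d → ℝ} {g' t : ℝ} {x : Torus d} (ht : t ∈ Icc 0 T)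
    (h : HasDerivWithinAt (fun t => g t x) g' (Icc 0 T) t) : dt T g t x = g' :=
  h.derivWithin (uniqueDiffOn_Icc hT t ht)

lemma timeC1_of_hasDerivWithinAt (hT : 0 < T) {g g' : ℝ → Torus d → ℝ} (hg : ContCyl T g)
    (hg' : ContCyl T g')
    (h : ∀ t ∈ Icc 0 T, ∀ x, HasDerivWithinAt (fun t => g t x) (g' t x) (Icc 0 T) t) :
    TimeC1 T g where
  cont := hg
  diff x t ht := (h t ht x).differentiableWithinAt
  cont_dt := ContCyl.congr hg' fun t ht x => dt_eq hT ht (h t ht x)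

lemma IsC1.contCyl {g : ℝ → Torus d → ℝ} (h : IsC1 T g) : ContCyl T g := h.time.cont

lemma IsC1.contCyl_dt {g : ℝ → Torus d → ℝ} (h : IsC1 T g) : ContCyl T (dt T g) := h.time.cont_dt

lemma IsC1.contCyl_pd {g : ℝ → Torus d → ℝ} (h : IsC1 T g) (j : Fin d) :
    ContCyl T (fun t => pd j (g t)) := h.cont_pd j

lemma IsC1C2.isC1 {g : ℝ → Torus d → ℝ} (h : IsC1C2 T g) : IsC1 T g where
  time := h.time
  space t ht := (h.space t ht).of_le (by norm_num)
  cont_pd j := (h.time_pd j).cont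

lemma isC1_const (hT : 0 < T) (c : ℝ) : IsC1 T (fun (_ : ℝ) (_ : Torus d) => c) where
  time := timeC1_of_hasDerivWithinAt hT (g' := fun _ _ => 0) continuousOn_const continuousOn_const
    fun t _ _ => hasDerivWithinAt_const t _ c
  space _ _ := isCk_const c
  cont_pd j := by simpa only [pd_const] using continuousOn_const

lemma dt_add (hT : 0 < T) {f g : ℝ → Torus d → ℝ} (hf : IsC1 T f) (hg : IsC1 T g) {t : ℝ}
    (ht : t ∈ Icc 0 T) (x : Torus d) :
    dt T (fun t x => f t x + g t x) t x = dt T f t x + dt T g t x :=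
  dt_eq hT ht ((hf.time.hasDerivWithinAt ht x).add (hg.time.hasDerivWithinAt ht x))

lemma IsC1.add (hT : 0 < T) {f g : ℝ → Torus d → ℝ} (hf : IsC1 T f) (hg : IsC1 T g) :
    IsC1 T (fun t x => f t x + g t x) where
  time := timeC1_of_hasDerivWithinAt hT (hf.contCyl.add hg.contCyl)
    (hf.contCyl_dt.add hg.contCyl_dt) fun _ ht x =>
      (hf.time.hasDerivWithinAt ht x).add (hg.time.hasDerivWithinAt ht x)
  space t ht := (hf.space t ht).add (hg.space t ht)
  cont_pd j := ((hf.contCyl_pd j).add (hg.contCyl_pd j)).congr fun t ht x =>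
    pd_add (hf.space t ht) (hg.space t ht) j x

lemma dt_mul (hT : 0 < T) {f g : ℝ → Torus d → ℝ} (hf : IsC1 T f) (hg : IsC1 T g) {t : ℝ}
    (ht : t ∈ Icc 0 T) (x : Torus d) :
    dt T (fun t x => f t x * g t x) t x = dt T f t x * g t x + f t x * dt T g t x :=
  dt_eq hT ht ((hf.time.hasDerivWithinAt ht x).mul (hg.time.hasDerivWithinAt ht x))

lemma IsC1.mul (hT : 0 < T) {f g : ℝ → Torus d → ℝ} (hf : IsC1 T f) (hg : IsC1 T g) :
    IsC1 T (fun t x => f t x * g t x) where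
  time := timeC1_of_hasDerivWithinAt hT (hf.contCyl.mul hg.contCyl)
    ((hf.contCyl_dt.mul hg.contCyl).add (hf.contCyl.mul hg.contCyl_dt)) fun _ ht x =>
      (hf.time.hasDerivWithinAt ht x).mul (hg.time.hasDerivWithinAt ht x)
  space t ht := (hf.space t ht).mul (hg.space t ht)
  cont_pd j := (((hf.contCyl_pd j).mul hg.contCyl).add (hf.contCyl.mul (hg.contCyl_pd j))).congr
    fun t ht x => pd_mul (hf.space t ht) (hg.space t ht) j x

lemma isC1_sum (hT : 0 < T) {ι : Type*} (s : Finset ι) {f : ι → ℝ → Torus d → ℝ}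
    (hf : ∀ i, IsC1 T (f i)) : IsC1 T (fun t x => ∑ i ∈ s, f i t x) ∧
      (∀ t ∈ Icc 0 T, ∀ x, dt T (fun t x => ∑ i ∈ s, f i t x) t x = ∑ i ∈ s, dt T (f i) t x) ∧
      ∀ t ∈ Icc 0 T, ∀ j x, pd j (fun x => ∑ i ∈ s, f i t x) x = ∑ i ∈ s, pd j (f i t) x := by
  classical
  induction s using Finset.induction_on with
  | empty =>
    refine ⟨by simpa using isC1_const hT 0, fun t _ x => ?_, fun t _ j x => ?_⟩
    · simp [dt]
    · simpa using pd_const 0 j x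
  | insert a s ha ih =>
    simp only [Finset.sum_insert ha]
    refine ⟨(hf a).add hT ih.1, fun t ht x => ?_, fun t ht j x => ?_⟩
    · rw [dt_add hT (hf a) ih.1 ht, ih.2.1 t ht]
    · rw [pd_add ((hf a).space t ht) (ih.1.space t ht), ih.2.2 t ht]

lemma hasDerivAt_rpow_pos {r : ℝ} (hr : 0 < r) (α : ℝ) :
    HasDerivAt (fun s : ℝ => s ^ α) (α * r ^ (α - 1)) r :=
  Real.hasDerivAt_rpow_const (Or.inl hr.ne')

lemma dt_rpow (hT : 0 < T) {f : ℝ → Torus d → ℝ} (hf : IsC1 T f)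
    (h0 : ∀ t ∈ Icc 0 T, ∀ x, 0 < f t x) (α : ℝ) {t : ℝ} (ht : t ∈ Icc 0 T) (x : Torus d) :
    dt T (fun t x => f t x ^ α) t x = α * f t x ^ (α - 1) * dt T f t x :=
  dt_eq hT ht (HasDerivAt.comp_hasDerivWithinAt (h₂ := fun s : ℝ => s ^ α) t
      (hasDerivAt_rpow_pos (h0 t ht x) α)
    (hf.time.hasDerivWithinAt ht x))

lemma IsC1.rpow (hT : 0 < T) {f : ℝ → Torus d → ℝ} (hf : IsC1 T f)
    (h0 : ∀ t ∈ Icc 0 T, ∀ x, 0 < f t x) (α : ℝ) : IsC1 T (fun t x => f t x ^ α) where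
  time := timeC1_of_hasDerivWithinAt hT (hf.contCyl.rpow h0 α)
    (((hf.contCyl.rpow h0 (α - 1)).const_mul α).mul hf.contCyl_dt) fun t ht x =>
      HasDerivAt.comp_hasDerivWithinAt (h₂ := fun s : ℝ => s ^ α) t
      (hasDerivAt_rpow_pos (h0 t ht x) α) (hf.time.hasDerivWithinAt ht x)
  space t ht := (hf.space t ht).rpow (h0 t ht) α
  cont_pd j := (((hf.contCyl.rpow h0 (α - 1)).const_mul α).mul (hf.contCyl_pd j)).congr
    fun t ht x => pd_comp (hf.space t ht) j x (hasDerivAt_rpow_pos (h0 t ht x) α)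

/-- The fundamental theorem of calculus in time, integrated over the torus. -/
lemma integral_dt {g : ℝ → Torus d → ℝ} (hg : TimeC1 T g) {τ : ℝ} (hτ : τ ∈ Icc 0 T) :
    ∫ t in Ioo 0 τ, ∫ x, dt T g t x = (∫ x, g τ x) - ∫ x, g 0 x := by
  have hsub : Ioo 0 τ ×ˢ (univ : Set (Torus d)) ⊆ Icc 0 T ×ˢ univ :=
    prod_mono (fun t ht => ⟨ht.1.le, ht.2.le.trans hτ.2⟩) le_rfl
  have hint : Integrable (fun z : ℝ × Torus d => dt T g z.1 z.2)
      ((volume.restrict (Ioo 0 τ)).prod volume) := by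
    have hc : IntegrableOn (fun z : ℝ × Torus d => dt T g z.1 z.2) (Icc 0 T ×ˢ univ) :=
      hg.cont_dt.integrableOn_compact (isCompact_Icc.prod isCompact_univ)
    have := hc.mono_set hsub
    rwa [IntegrableOn, Measure.volume_eq_prod, ← Measure.prod_restrict,
      Measure.restrict_univ] at this
  have h0 : (0 : ℝ) ∈ Icc 0 T := ⟨le_rfl, hτ.1.trans hτ.2⟩
  rw [integral_integral_swap hint, ← integral_sub]
  · refine integral_congr_ae (Eventually.of_forall fun x => ?_)
    simp only
    rw [← integral_Ioc_eq_integral_Ioo, ← intervalIntegral.integral_of_le hτ.1]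
    have hsub' : Icc 0 τ ⊆ Icc 0 T := Icc_subset_Icc_right hτ.2
    refine intervalIntegral.integral_eq_sub_of_hasDerivAt_of_le hτ.1
      ((ContCyl.continuousOn_time hg.cont x).mono hsub') (fun t ht => ?_) ?_
    · exact (hg.hasDerivWithinAt (hsub' (Ioo_subset_Icc_self ht)) x).hasDerivAt
        (Icc_mem_nhds ht.1 (ht.2.trans_le hτ.2))
    · refine ContinuousOn.intervalIntegrable ?_
      rw [uIcc_of_le hτ.1]
      exact (ContCyl.continuousOn_time hg.cont_dt x).mono hsub'
  · exact (ContCyl.continuous hg.cont hτ).integrable_of_hasCompactSupport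
      (HasCompactSupport.of_compactSpace _)
  · exact (ContCyl.continuous hg.cont h0).integrable_of_hasCompactSupport
      (HasCompactSupport.of_compactSpace _)

end TimeCalculus

/-! ### Constitutive functions -/

section Constitutive

variable {γ : ℝ}

lemma E_eq (hγ : 1 ≤ γ) (s : ℝ) : E γ s = s ^ (γ + 1) / (γ + 1) := by
  simp only [E, p]
  rw [integral_rpow (Or.inl (by linarith)), Real.zero_rpow (by linarith), sub_zero]

lemma E_nonneg (hγ : 1 ≤ γ) {s : ℝ} (hs : 0 ≤ s) : 0 ≤ E γ s := by
  rw [E_eq hγ]; positivity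

lemma Q_eq (hγ : 1 ≤ γ) {s : ℝ} (hs : 0 ≤ s) : Q γ s = γ / (γ + 1 / 2) * s ^ (γ + 1 / 2) := by
  have h : ∀ r ∈ uIcc 0 s, √r * deriv (p γ) r = γ * r ^ (γ - 1 / 2) := by
    intro r hr
    rw [uIcc_of_le hs] at hr
    have : deriv (p γ) r = γ * r ^ (γ - 1) := (Real.hasDerivAt_rpow_const (Or.inr hγ)).deriv
    rw [this, Real.sqrt_eq_rpow, mul_left_comm,
      ← Real.rpow_add_of_nonneg hr.1 (by norm_num) (by linarith)]
    ring_nf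
  rw [Q, intervalIntegral.integral_congr h, intervalIntegral.integral_const_mul,
    integral_rpow (Or.inl (by linarith))]
  rw [show γ - 1 / 2 + 1 = γ + 1 / 2 by ring, Real.zero_rpow (by linarith)]
  ring

/-- Convexity of `γ E` as a function of `Q`, whose derivative is the square root. -/
lemma sqrt_mul_Q_sub_le (hγ : 1 ≤ γ) {a b : ℝ} (ha : 0 ≤ a) (hb : 0 ≤ b) :
    √a * (Q γ b - Q γ a) ≤ γ * E γ b - γ * E γ a := by
  rw [Q_eq hγ ha, Q_eq hγ hb, E_eq hγ, E_eq hγ]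
  have hγ0 : 0 < γ := by linarith
  -- Weighted AM–GM, with weights chosen so that the geometric mean of b^(γ+1) and a^(γ+1) is
  -- b^(γ+1/2) √a.
  have h := Real.geom_mean_le_arith_mean2_weighted (w₁ := (γ + 1 / 2) / (γ + 1))
    (w₂ := (1 / 2) / (γ + 1)) (p₁ := b ^ (γ + 1)) (p₂ := a ^ (γ + 1)) (by positivity)
    (by positivity) (by positivity) (by positivity) (by field_simp; ring)
  rw [← Real.rpow_mul hb, ← Real.rpow_mul ha, mul_div_cancel₀ _ (by positivity),
    mul_div_cancel₀ _ (by positivity), ← Real.sqrt_eq_rpow] at h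
  have h1 : √a * a ^ (γ + 1 / 2) = a ^ (γ + 1) := by
    rw [Real.sqrt_eq_rpow, ← Real.rpow_add_of_nonneg ha (by norm_num) (by linarith)]
    ring_nf
  have h2 := mul_le_mul_of_nonneg_left h (show 0 ≤ γ / (γ + 1 / 2) by positivity)
  have h3 : √a * (γ / (γ + 1 / 2) * b ^ (γ + 1 / 2) - γ / (γ + 1 / 2) * a ^ (γ + 1 / 2))
      = γ / (γ + 1 / 2) * (b ^ (γ + 1 / 2) * √a) - γ / (γ + 1 / 2) * a ^ (γ + 1) := by
    rw [← h1]; ring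
  rw [h3]
  have h4 : γ / (γ + 1 / 2) * ((γ + 1 / 2) / (γ + 1) * b ^ (γ + 1)
      + 1 / 2 / (γ + 1) * a ^ (γ + 1)) - γ / (γ + 1 / 2) * a ^ (γ + 1)
      = γ * (b ^ (γ + 1) / (γ + 1)) - γ * (a ^ (γ + 1) / (γ + 1)) := by
    field_simp
    ring
  linarith

/-- Relative internal energy. -/
noncomputable def relE (γ s r : ℝ) : ℝ := E γ s - E γ r - p γ r * (s - r)

/-- After scaling by r^(γ+1), this is the strict Bernoulli inequality with exponent γ + 1 > 1 at
s/r. Strictness is what identifies the density at the end. -/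
lemma relE_pos (hγ : 1 ≤ γ) {s r : ℝ} (hs : 0 ≤ s) (hr : 0 < r) (hsr : s ≠ r) :
    0 < relE γ s r := by
  have h := one_add_mul_self_lt_rpow_one_add (s := s / r - 1) (p := γ + 1)
    (by have : 0 ≤ s / r := by positivity
        linarith)
    (by rw [sub_ne_zero]; exact fun h => hsr ((div_eq_one_iff_eq hr.ne').1 h)) (by linarith)
  rw [add_sub_cancel, Real.div_rpow hs hr.le, lt_div_iff₀ (by positivity)] at h
  have h1 : r ^ (γ + 1) = r ^ γ * r := by rw [Real.rpow_add hr, Real.rpow_one]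
  rw [relE, E_eq hγ, E_eq hγ, p]
  have h2 : s ^ (γ + 1) / (γ + 1) - r ^ (γ + 1) / (γ + 1) - r ^ γ * (s - r)
      = (s ^ (γ + 1) - (1 + (γ + 1) * (s / r - 1)) * r ^ (γ + 1)) / (γ + 1) := by
    rw [h1]
    have : 0 < γ + 1 := by linarith
    field_simp
    ring
  rw [h2]
  exact div_pos (by linarith) (by linarith)

lemma relE_self (γ r : ℝ) : relE γ r r = 0 := by simp [relE]

lemma relE_nonneg (hγ : 1 ≤ γ) {s r : ℝ} (hs : 0 ≤ s) (hr : 0 < r) : 0 ≤ relE γ s r := by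
  rcases eq_or_ne s r with rfl | h
  · rw [relE_self]
  · exact (relE_pos hγ hs hr h).le

end Constitutive

/-! ### Strong solutions -/

section Strong

variable {d : ℕ} {γ T : ℝ} {ρ : ℝ → Torus d → ℝ} {w : ℝ → Torus d → Vec d}

/-- The cost `p(ρ)`. -/
noncomputable def cost (γ : ℝ) (ρ : ℝ → Torus d → ℝ) (t : ℝ) (x : Torus d) : ℝ := ρ t x ^ γ

/-- The component `w_j - ∂_j p(ρ)` of the velocity. -/
noncomputable def vel (γ : ℝ) (ρ : ℝ → Torus d → ℝ) (w : ℝ → Torus d → Vec d) (j : Fin d) (t : ℝ)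
    (x : Torus d) : ℝ := w t x j - pd j (cost γ ρ t) x

/-- The divergence of the velocity, as given by the continuity equation. -/
noncomputable def divVel (γ T : ℝ) (ρ : ℝ → Torus d → ℝ) (w : ℝ → Torus d → Vec d) (t : ℝ)
    (x : Torus d) : ℝ := -(dt T ρ t x + ∑ j, pd j (ρ t) x * vel γ ρ w j t x) / ρ t x

namespace IsStrongSolution

variable (hs : IsStrongSolution d γ T ρ w)
include hs

lemma isC1_density : IsC1 T ρ := hs.reg_density.isC1

lemma isC1_velocity (i : Fin d) : IsC1 T (fun t x => w t x i) := (hs.reg_velocity i).isC1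

lemma isC1_cost (hT : 0 < T) : IsC1 T (cost γ ρ) := hs.isC1_density.rpow hT hs.pos γ

lemma isCk_vel {t : ℝ} (ht : t ∈ Icc 0 T) (j : Fin d) : IsCk 1 (vel γ ρ w j t) :=
  (((hs.reg_velocity j).space t ht).of_le (by norm_num)).sub
    (((hs.reg_density.space t ht).rpow (hs.pos t ht) γ).pd (m := 1) (by norm_num) j)

lemma contCyl_vel (hT : 0 < T) (j : Fin d) : ContCyl T (vel γ ρ w j) :=
  (hs.isC1_velocity j).contCyl.sub ((hs.isC1_cost hT).contCyl_pd j)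

/-- The formula defining `divVel` involves only first derivatives and makes sense up to the end
points of [0,T]. This gives the uniform bound, although the equations themselves hold only in the
open interval. -/
lemma contCyl_divVel (hT : 0 < T) : ContCyl T (divVel γ T ρ w) :=
  (hs.isC1_density.contCyl_dt.add
    (ContCyl.sum fun j => (hs.isC1_density.contCyl_pd j).mul (hs.contCyl_vel hT j))).neg.div
    hs.isC1_density.contCyl fun t ht x => (hs.pos t ht x).ne'

lemma pd_cost {t : ℝ} (ht : t ∈ Icc 0 T) (j : Fin d) (x : Torus d) :
    pd j (cost γ ρ t) x = γ * ρ t x ^ (γ - 1) * pd j (ρ t) x :=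
  pd_comp (hs.isC1_density.space t ht) j x (hasDerivAt_rpow_pos (hs.pos t ht x) γ)

/-- This is Q' = √s p'. It turns the flux √ρ ∇Q(ρ) into ρ ∇p(ρ), and hence the system into transport
with velocity w − ∇p(ρ). -/
lemma pd_Q (hγ : 1 ≤ γ) {t : ℝ} (ht : t ∈ Icc 0 T) (j : Fin d) (x : Torus d) :
    pd j (fun y => Q γ (ρ t y)) x = √(ρ t x) * pd j (cost γ ρ t) x := by
  have hpos := hs.pos t ht x
  have h1 : (fun y => Q γ (ρ t y)) = fun y => γ / (γ + 1 / 2) * ρ t y ^ (γ + 1 / 2) :=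
    funext fun y => Q_eq hγ (hs.pos t ht y).le
  rw [h1, pd_comp (φ := fun s => γ / (γ + 1 / 2) * s ^ (γ + 1 / 2)) (hs.isC1_density.space t ht) j x
    ((hasDerivAt_rpow_pos hpos (γ + 1 / 2)).const_mul _), hs.pd_cost ht, Real.sqrt_eq_rpow]
  have h2 : ρ t x ^ (γ + 1 / 2 - 1) = ρ t x ^ (1 / 2 : ℝ) * ρ t x ^ (γ - 1) := by
    rw [← Real.rpow_add hpos]; ring_nf
  rw [h2]
  field_simp

/-- Here γE plays the role of a pressure: γE'(s) = γs^γ = s p'(s). The same relation is proved in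
weak form for the measure-valued density in `GoodTime.integral_E_pd`. -/
lemma pd_E (hγ : 1 ≤ γ) {t : ℝ} (ht : t ∈ Icc 0 T) (j : Fin d) (x : Torus d) :
    pd j (fun y => γ * E γ (ρ t y)) x = ρ t x * pd j (cost γ ρ t) x := by
  have hpos := hs.pos t ht x
  have h1 : (fun y => γ * E γ (ρ t y)) = fun y => γ / (γ + 1) * ρ t y ^ (γ + 1) :=
    funext fun y => by rw [E_eq hγ]; ring
  rw [h1, pd_comp (φ := fun s => γ / (γ + 1) * s ^ (γ + 1)) (hs.isC1_density.space t ht) j x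
    ((hasDerivAt_rpow_pos hpos (γ + 1)).const_mul _), hs.pd_cost ht]
  have h2 : ρ t x ^ (γ + 1 - 1) = ρ t x * ρ t x ^ (γ - 1) := by
    nth_rewrite 2 [← Real.rpow_one (ρ t x)]
    rw [← Real.rpow_add hpos]; ring_nf
  rw [h2]
  field_simp

lemma isC1_E (hT : 0 < T) (hγ : 1 ≤ γ) : IsC1 T (fun t x => γ * E γ (ρ t x)) := by
  have h1 : (fun t x => γ * E γ (ρ t x)) = fun t x => γ / (γ + 1) * ρ t x ^ (γ + 1) :=
    funext fun t => funext fun y => by rw [E_eq hγ]; ring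
  rw [h1]
  exact (isC1_const hT _).mul hT (hs.isC1_density.rpow hT hs.pos (γ + 1))

lemma dt_cost (hT : 0 < T) {t : ℝ} (ht : t ∈ Icc 0 T) (x : Torus d) :
    dt T (cost γ ρ) t x = γ * ρ t x ^ (γ - 1) * dt T ρ t x :=
  dt_rpow hT hs.isC1_density hs.pos γ ht x

lemma dt_E (hT : 0 < T) (hγ : 1 ≤ γ) {t : ℝ} (ht : t ∈ Icc 0 T) (x : Torus d) :
    dt T (fun t x => γ * E γ (ρ t x)) t x = ρ t x * dt T (cost γ ρ) t x := by
  have hpos := hs.pos t ht x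
  have h1 : (fun t x => γ * E γ (ρ t x)) = fun t x => γ / (γ + 1) * ρ t x ^ (γ + 1) :=
    funext fun t => funext fun y => by rw [E_eq hγ]; ring
  rw [h1, dt_mul hT (isC1_const hT _) (hs.isC1_density.rpow hT hs.pos (γ + 1)) ht,
    dt_rpow hT hs.isC1_density hs.pos _ ht, hs.dt_cost hT ht]
  have h2 : ρ t x ^ (γ + 1 - 1) = ρ t x * ρ t x ^ (γ - 1) := by
    nth_rewrite 2 [← Real.rpow_one (ρ t x)]
    rw [← Real.rpow_add hpos]; ring_nf
  have h3 : dt T (fun (_ : ℝ) (_ : Torus d) => γ / (γ + 1)) t x = 0 :=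
    dt_eq hT ht (hasDerivWithinAt_const _ _ _)
  rw [h2, h3]
  field_simp
  ring

lemma continuity_vel (hγ : 1 ≤ γ) {t : ℝ} (ht : t ∈ Ioo 0 T) (x : Torus d) :
    dt T ρ t x + ∑ j, (pd j (ρ t) x * vel γ ρ w j t x + ρ t x * pd j (vel γ ρ w j t) x) = 0 := by
  have ht' := Ioo_subset_Icc_self ht
  have h := hs.continuity t ht x
  rw [add_sub_assoc, ← Finset.sum_sub_distrib] at h
  rw [← h]
  congr 1
  refine Finset.sum_congr rfl fun j _ => ?_
  have hρ := hs.isC1_density.space t ht'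
  have hP : IsCk 1 (pd j (cost γ ρ t)) :=
    ((hs.reg_density.space t ht').rpow (hs.pos t ht') γ).pd (m := 1) (by norm_num) j
  have hw := (hs.isC1_velocity j).space t ht'
  have h1 : (fun y => √(ρ t y) * pd j (fun y' => Q γ (ρ t y')) y)
      = fun y => ρ t y * pd j (cost γ ρ t) y := funext fun y => by
    rw [hs.pd_Q hγ ht', ← mul_assoc, Real.mul_self_sqrt (hs.pos t ht' y).le]
  rw [h1, pd_mul hρ hP, pd_mul hρ hw, show pd j (vel γ ρ w j t) x = _ from pd_sub hw hP j x, vel]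
  ring

lemma sum_pd_vel (hγ : 1 ≤ γ) {t : ℝ} (ht : t ∈ Ioo 0 T) (x : Torus d) :
    ∑ j, pd j (vel γ ρ w j t) x = divVel γ T ρ w t x := by
  have h := hs.continuity_vel hγ ht x
  have hpos := hs.pos t (Ioo_subset_Icc_self ht) x
  rw [Finset.sum_add_distrib, ← Finset.mul_sum] at h
  rw [divVel, eq_div_iff hpos.ne']
  linarith

/-- The momentum equation minus w_i times the continuity equation is ρ times this expression, and ρ
is positive. -/
lemma transport (hγ : 1 ≤ γ) (hT : 0 < T) {t : ℝ} (ht : t ∈ Ioo 0 T) (x : Torus d) (i : Fin d) :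
    dt T (fun t x => w t x i) t x + ∑ j, vel γ ρ w j t x * pd j (fun x => w t x i) x = 0 := by
  have ht' := Ioo_subset_Icc_self ht
  have h := hs.momentum t ht x i
  rw [← sub_eq_zero, add_sub_assoc, ← Finset.sum_sub_distrib] at h
  have hρ := hs.isC1_density.space t ht'
  have hwi := (hs.isC1_velocity i).space t ht'
  have key : ∀ j, pd j (fun y => ρ t y * w t y j * w t y i) x
      - pd j (fun y => pd j (fun y' => Q γ (ρ t y')) y * (√(ρ t y) * w t y i)) x
      = (pd j (ρ t) x * vel γ ρ w j t x + ρ t x * pd j (vel γ ρ w j t) x) * w t x i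
        + ρ t x * (vel γ ρ w j t x * pd j (fun x => w t x i) x) := by
    intro j
    have hP : IsCk 1 (pd j (cost γ ρ t)) :=
      ((hs.reg_density.space t ht').rpow (hs.pos t ht') γ).pd (m := 1) (by norm_num) j
    have hw := (hs.isC1_velocity j).space t ht'
    have h1 : (fun y => pd j (fun y' => Q γ (ρ t y')) y * (√(ρ t y) * w t y i))
        = fun y => ρ t y * pd j (cost γ ρ t) y * w t y i := funext fun y => by
      rw [hs.pd_Q hγ ht']
      linear_combination (pd j (cost γ ρ t) y * w t y i) * Real.mul_self_sqrt (hs.pos t ht' y).le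
    rw [h1, pd_mul (hρ.mul hw) hwi, pd_mul (hρ.mul hP) hwi, pd_mul hρ hw, pd_mul hρ hP,
      show pd j (vel γ ρ w j t) x = _ from pd_sub hw hP j x, vel]
    ring
  simp only [key] at h
  rw [dt_mul hT hs.isC1_density (hs.isC1_velocity i) ht', Finset.sum_add_distrib,
    ← Finset.sum_mul, ← Finset.mul_sum] at h
  have h2 := hs.continuity_vel hγ ht x
  refine (mul_eq_zero.1 (?_ : ρ t x * _ = 0)).resolve_left (hs.pos t ht' x).ne'
  linear_combination h - w t x i * h2

end IsStrongSolution

end Strong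

/-! ### Young measures with finite energy and dissipation -/

section Moments

variable {d : ℕ} {γ : ℝ} {X : Type*} [MeasurableSpace X]

/-- Bounded measurable coefficients. -/
def BddCoef (μ : Measure X) (c : X → ℝ) : Prop :=
  AEStronglyMeasurable c μ ∧ ∃ C, ∀ᵐ x ∂μ, |c x| ≤ C

lemma bddCoef_const {μ : Measure X} (a : ℝ) : BddCoef μ (fun _ => a) :=
  ⟨aestronglyMeasurable_const, |a|, Eventually.of_forall fun _ => le_rfl⟩

lemma BddCoef.integrable_mul {μ : Measure X} {c f : X → ℝ} (hc : BddCoef μ c)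
    (hf : Integrable f μ) : Integrable (fun x => f x * c x) μ := by
  obtain ⟨h, C, hC⟩ := hc
  exact hf.mul_bdd h hC

/-- The phase function of the momentum equation, for the coefficients `a = ∂_t φ`, `b = ∇φ`. -/
noncomputable def momentumFn (a : Fin d → ℝ) (b : Fin d → Fin d → ℝ) (y : Phase d) : ℝ :=
  ∑ i, √(y.1 : ℝ) * y.2.1 i * a i + ∑ i, ∑ j, y.2.1 i * y.2.1 j * b i j
    - ∑ i, ∑ j, y.2.1 i * y.2.2 j * b i j

/-- The phase function of the continuity equation, for the coefficients `a = ∂_t ψ`, `b = ∇ψ`. -/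
noncomputable def continuityFn (a : ℝ) (b : Fin d → ℝ) (y : Phase d) : ℝ :=
  (y.1 : ℝ) * a + ∑ j, √(y.1 : ℝ) * y.2.1 j * b j - ∑ j, √(y.1 : ℝ) * y.2.2 j * b j

/-- The phase function of the energy balance. -/
noncomputable def powerFn (y : Phase d) : ℝ := inner ℝ y.2.1 y.2.2 - ‖y.2.2‖ ^ 2

/-- The relative energy with respect to a state of density `r` and velocity `w`. -/
noncomputable def relEnergy (γ r : ℝ) (w : Fin d → ℝ) (y : Phase d) : ℝ :=
  1 / 2 * ∑ i, (y.2.1 i - √(y.1 : ℝ) * w i) ^ 2 + relE γ y.1 r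

/-- The relative dissipation with respect to a state of cost gradient `P`. -/
noncomputable def relDissipation (P : Fin d → ℝ) (y : Phase d) : ℝ :=
  ∑ j, (y.2.2 j - √(y.1 : ℝ) * P j) ^ 2

/-- The random phase variable `Y` has finite energy and dissipation. -/
structure FiniteMoments (γ : ℝ) (μ : Measure X) (Y : X → Phase d) : Prop where
  meas : Measurable Y
  intE : Integrable (fun x => ((Y x).1 : ℝ) ^ (γ + 1)) μ
  intW : Integrable (fun x => ‖(Y x).2.1‖ ^ 2) μ
  intF : Integrable (fun x => ‖(Y x).2.2‖ ^ 2) μ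

lemma sq_le_norm_sq (Z : Vec d) (i : Fin d) : Z i ^ 2 ≤ ‖Z‖ ^ 2 := by
  rw [EuclideanSpace.real_norm_sq_eq]
  exact Finset.single_le_sum (f := fun i => Z i ^ 2) (fun i _ => sq_nonneg _) (Finset.mem_univ i)

/-- Each term is one that a balance law controls: the energy, the momentum paired with w, the
density paired with ½|w|² − p(r), and a function of the strong state alone. The last comes from r
p(r) − E(r) = γE(r). -/
lemma relEnergy_eq (hγ : 1 ≤ γ) {r : ℝ} (hr : 0 < r) (w : Fin d → ℝ) (y : Phase d) :
    relEnergy γ r w y = 1 / 2 * ‖y.2.1‖ ^ 2 + E γ y.1 - ∑ i, √(y.1 : ℝ) * y.2.1 i * w i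
      + (y.1 : ℝ) * (∑ i, 1 / 2 * (w i * w i) - r ^ γ) + γ * E γ r := by
  have h1 : γ * E γ r = r ^ γ * r - E γ r := by
    have h2 : r ^ (γ + 1) = r ^ γ * r := by rw [Real.rpow_add hr, Real.rpow_one]
    rw [E_eq hγ, h2]
    have : 0 < γ + 1 := by linarith
    field_simp
    ring
  have h3 : ∑ i, (y.2.1 i - √(y.1 : ℝ) * w i) ^ 2
      = ‖y.2.1‖ ^ 2 - 2 * ∑ i, √(y.1 : ℝ) * y.2.1 i * w i
        + (y.1 : ℝ) * (2 * ∑ i, 1 / 2 * (w i * w i)) := by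
    rw [EuclideanSpace.real_norm_sq_eq, Finset.mul_sum, Finset.mul_sum, Finset.mul_sum,
      ← Finset.sum_sub_distrib, ← Finset.sum_add_distrib]
    refine Finset.sum_congr rfl fun i _ => ?_
    linear_combination (w i) ^ 2 * Real.sq_sqrt y.1.coe_nonneg
  rw [relEnergy, relE, p, h1, h3]
  ring

namespace FiniteMoments

variable {μ : Measure X} {Y : X → Phase d}

lemma of_continuous (h : FiniteMoments γ μ Y) {φ : Phase d → ℝ} (hφ : Continuous φ) :
    AEStronglyMeasurable (fun x => φ (Y x)) μ :=
  (hφ.measurable.comp h.meas).aestronglyMeasurable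

lemma integrable_E (h : FiniteMoments γ μ Y) (hγ : 1 ≤ γ) :
    Integrable (fun x => E γ (Y x).1) μ := by
  simp only [E_eq hγ]
  exact h.intE.div_const _

lemma integrable_WW (h : FiniteMoments γ μ Y) (i j : Fin d) :
    Integrable (fun x => (Y x).2.1 i * (Y x).2.1 j) μ := by
  refine h.intW.mono' (h.of_continuous (φ := fun y => y.2.1 i * y.2.1 j) (by fun_prop))
    (Eventually.of_forall fun x => ?_)
  rw [Real.norm_eq_abs, abs_le]
  constructor <;> nlinarith [sq_le_norm_sq (Y x).2.1 i, sq_le_norm_sq (Y x).2.1 j,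
    sq_nonneg ((Y x).2.1 i - (Y x).2.1 j), sq_nonneg ((Y x).2.1 i + (Y x).2.1 j)]

lemma integrable_WF (h : FiniteMoments γ μ Y) (i j : Fin d) :
    Integrable (fun x => (Y x).2.1 i * (Y x).2.2 j) μ := by
  refine (h.intW.add h.intF).mono'
    (h.of_continuous (φ := fun y => y.2.1 i * y.2.2 j) (by fun_prop))
    (Eventually.of_forall fun x => ?_)
  rw [Real.norm_eq_abs, abs_le]
  simp only [Pi.add_apply]
  constructor <;> nlinarith [sq_le_norm_sq (Y x).2.1 i, sq_le_norm_sq (Y x).2.2 j,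
    sq_nonneg ((Y x).2.1 i - (Y x).2.2 j), sq_nonneg ((Y x).2.1 i + (Y x).2.2 j)]

lemma integrable_powerFn (h : FiniteMoments γ μ Y) : Integrable (fun x => powerFn (Y x)) μ := by
  refine Integrable.sub ?_ h.intF
  have : ∀ x, inner ℝ (Y x).2.1 (Y x).2.2 = ∑ i, (Y x).2.1 i * (Y x).2.2 i := fun x => by
    simp [PiLp.inner_apply, mul_comm]
  simp only [this]
  exact integrable_finsetSum _ fun i _ => h.integrable_WF i i

variable [IsFiniteMeasure μ]

lemma integrable_density (h : FiniteMoments γ μ Y) (hγ : 1 ≤ γ) :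
    Integrable (fun x => ((Y x).1 : ℝ)) μ := by
  refine ((integrable_const (1 : ℝ)).add h.intE).mono'
    (h.of_continuous (φ := fun y => (y.1 : ℝ)) (by fun_prop)) (Eventually.of_forall fun x => ?_)
  have h0 : (0 : ℝ) ≤ (Y x).1 := (Y x).1.coe_nonneg
  rw [Real.norm_of_nonneg h0]
  simp only [Pi.add_apply]
  rcases le_total ((Y x).1 : ℝ) 1 with h1 | h1
  · have : 0 ≤ ((Y x).1 : ℝ) ^ (γ + 1) := by positivity
    linarith
  · have := Real.rpow_le_rpow_of_exponent_le h1 (show 1 ≤ γ + 1 by linarith)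
    rw [Real.rpow_one] at this
    linarith

lemma integrable_sqrt_W (h : FiniteMoments γ μ Y) (hγ : 1 ≤ γ) (i : Fin d) :
    Integrable (fun x => √((Y x).1 : ℝ) * (Y x).2.1 i) μ := by
  refine ((h.integrable_density hγ).add h.intW).mono'
    (h.of_continuous (φ := fun y => √(y.1 : ℝ) * y.2.1 i) (by fun_prop))
    (Eventually.of_forall fun x => ?_)
  have h0 := Real.sq_sqrt (Y x).1.coe_nonneg
  rw [Real.norm_eq_abs, abs_le]
  simp only [Pi.add_apply]
  constructor <;> nlinarith [sq_le_norm_sq (Y x).2.1 i,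
    sq_nonneg (√((Y x).1 : ℝ) - (Y x).2.1 i), sq_nonneg (√((Y x).1 : ℝ) + (Y x).2.1 i)]

lemma integrable_sqrt_F (h : FiniteMoments γ μ Y) (hγ : 1 ≤ γ) (i : Fin d) :
    Integrable (fun x => √((Y x).1 : ℝ) * (Y x).2.2 i) μ := by
  refine ((h.integrable_density hγ).add h.intF).mono'
    (h.of_continuous (φ := fun y => √(y.1 : ℝ) * y.2.2 i) (by fun_prop))
    (Eventually.of_forall fun x => ?_)
  have h0 := Real.sq_sqrt (Y x).1.coe_nonneg
  rw [Real.norm_eq_abs, abs_le]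
  simp only [Pi.add_apply]
  constructor <;> nlinarith [sq_le_norm_sq (Y x).2.2 i,
    sq_nonneg (√((Y x).1 : ℝ) - (Y x).2.2 i), sq_nonneg (√((Y x).1 : ℝ) + (Y x).2.2 i)]

lemma integrable_W (h : FiniteMoments γ μ Y) : Integrable (fun x => (Y x).2.1) μ := by
  refine ((integrable_const (1 : ℝ)).add h.intW).mono'
    ((measurable_fst.comp measurable_snd).comp h.meas).aestronglyMeasurable
    (Eventually.of_forall fun x => ?_)
  simp only [Pi.add_apply]
  nlinarith [sq_nonneg (‖(Y x).2.1‖ - 1)]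

lemma integrable_F (h : FiniteMoments γ μ Y) : Integrable (fun x => (Y x).2.2) μ := by
  refine ((integrable_const (1 : ℝ)).add h.intF).mono'
    ((measurable_snd.comp measurable_snd).comp h.meas).aestronglyMeasurable
    (Eventually.of_forall fun x => ?_)
  simp only [Pi.add_apply]
  nlinarith [sq_nonneg (‖(Y x).2.2‖ - 1)]

lemma integrable_momentumFn (h : FiniteMoments γ μ Y) (hγ : 1 ≤ γ) {a : Fin d → X → ℝ}
    {b : Fin d → Fin d → X → ℝ} (ha : ∀ i, BddCoef μ (a i)) (hb : ∀ i j, BddCoef μ (b i j)) :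
    Integrable (fun x => momentumFn (fun i => a i x) (fun i j => b i j x) (Y x)) μ := by
  refine ((integrable_finsetSum _ fun i _ => (ha i).integrable_mul (h.integrable_sqrt_W hγ i)).add
    (integrable_finsetSum _ fun i _ => integrable_finsetSum _ fun j _ =>
      (hb i j).integrable_mul (h.integrable_WW i j))).sub
    (integrable_finsetSum _ fun i _ => integrable_finsetSum _ fun j _ =>
      (hb i j).integrable_mul (h.integrable_WF i j))

lemma integrable_continuityFn (h : FiniteMoments γ μ Y) (hγ : 1 ≤ γ) {a : X → ℝ}
    {b : Fin d → X → ℝ} (ha : BddCoef μ a) (hb : ∀ j, BddCoef μ (b j)) :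
    Integrable (fun x => continuityFn (a x) (fun j => b j x) (Y x)) μ := by
  refine ((ha.integrable_mul (h.integrable_density hγ)).add
    (integrable_finsetSum _ fun j _ => (hb j).integrable_mul (h.integrable_sqrt_W hγ j))).sub
    (integrable_finsetSum _ fun j _ => (hb j).integrable_mul (h.integrable_sqrt_F hγ j))

lemma integrable_relEnergy (h : FiniteMoments γ μ Y) (hγ : 1 ≤ γ) {r : X → ℝ}
    {w : Fin d → X → ℝ} (hr : ∀ᵐ x ∂μ, 0 < r x) (hw : ∀ i, BddCoef μ (w i))
    (hψ : BddCoef μ (fun x => ∑ i, 1 / 2 * (w i x * w i x) - r x ^ γ))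
    (hE : BddCoef μ (fun x => γ * E γ (r x))) :
    Integrable (fun x => relEnergy γ (r x) (fun i => w i x) (Y x)) μ := by
  have key : Integrable (fun x => 1 / 2 * ‖(Y x).2.1‖ ^ 2 + E γ (Y x).1
      - ∑ i, √((Y x).1 : ℝ) * (Y x).2.1 i * w i x
      + ((Y x).1 : ℝ) * (∑ i, 1 / 2 * (w i x * w i x) - r x ^ γ) + γ * E γ (r x)) μ := by
    refine ((((h.intW.const_mul _).add (h.integrable_E hγ)).sub
      (integrable_finsetSum _ fun i _ => (hw i).integrable_mul (h.integrable_sqrt_W hγ i))).add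
      (hψ.integrable_mul (h.integrable_density hγ))).add ?_
    simpa using hE.integrable_mul (integrable_const (1 : ℝ))
  refine key.congr ?_
  filter_upwards [hr] with x hx
  exact (relEnergy_eq hγ hx _ _).symm

lemma integrable_relDissipation (h : FiniteMoments γ μ Y) (hγ : 1 ≤ γ) {P : Fin d → X → ℝ}
    (hP : ∀ i, BddCoef μ (P i)) (hPP : ∀ i, BddCoef μ (fun x => P i x * P i x)) :
    Integrable (fun x => relDissipation (fun i => P i x) (Y x)) μ := by
  have key : Integrable (fun x => ‖(Y x).2.2‖ ^ 2 - ∑ i, √((Y x).1 : ℝ) * (Y x).2.2 i * P i x * 2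
      + ∑ i, ((Y x).1 : ℝ) * (P i x * P i x)) μ :=
    (h.intF.sub (integrable_finsetSum _ fun i _ =>
      ((hP i).integrable_mul (h.integrable_sqrt_F hγ i)).mul_const 2)).add
      (integrable_finsetSum _ fun i _ => (hPP i).integrable_mul (h.integrable_density hγ))
  refine key.congr (Eventually.of_forall fun x => ?_)
  simp only [relDissipation]
  rw [EuclideanSpace.real_norm_sq_eq, ← Finset.sum_sub_distrib, ← Finset.sum_add_distrib]
  refine Finset.sum_congr rfl fun i _ => ?_
  linear_combination -(P i x) ^ 2 * Real.sq_sqrt (Y x).1.coe_nonneg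

end FiniteMoments

/-! ### Averages of the phase functions when the density does not fluctuate -/

section Mean

variable {ν : Measure (Phase d)} [IsFiniteMeasure ν] {r : ℝ}

lemma integral_W_apply (h : FiniteMoments γ ν id) (i : Fin d) :
    ∫ y, y.2.1 i ∂ν = (∫ y, y.2.1 ∂ν) i :=
  (EuclideanSpace.proj (𝕜 := ℝ) i).integral_comp_comm h.integrable_W

lemma integral_F_apply (h : FiniteMoments γ ν id) (i : Fin d) :
    ∫ y, y.2.2 i ∂ν = (∫ y, y.2.2 ∂ν) i :=
  (EuclideanSpace.proj (𝕜 := ℝ) i).integral_comp_comm h.integrable_F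

lemma integral_sqrt_W (h : FiniteMoments γ ν id) (hr : ∀ᵐ y ∂ν, (y.1 : ℝ) = r) (i : Fin d) :
    ∫ y, √(y.1 : ℝ) * y.2.1 i ∂ν = √r * (∫ y, y.2.1 ∂ν) i := by
  rw [← integral_W_apply h, ← integral_const_mul]
  refine integral_congr_ae ?_
  filter_upwards [hr] with y hy
  rw [hy]

lemma integral_sqrt_F (h : FiniteMoments γ ν id) (hr : ∀ᵐ y ∂ν, (y.1 : ℝ) = r) (i : Fin d) :
    ∫ y, √(y.1 : ℝ) * y.2.2 i ∂ν = √r * (∫ y, y.2.2 ∂ν) i := by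
  rw [← integral_F_apply h, ← integral_const_mul]
  refine integral_congr_ae ?_
  filter_upwards [hr] with y hy
  rw [hy]

/-- The weak formulation contains products of separate averages, such as √ϱ⟨W⟩. Since s is almost
surely constant, they combine into the average of one phase function, and the later algebra can be
done pointwise in phase space. -/
lemma integral_momentumFn (hγ : 1 ≤ γ) (h : FiniteMoments γ ν id) (hr : ∀ᵐ y ∂ν, (y.1 : ℝ) = r)
    (a : Fin d → ℝ) (b : Fin d → Fin d → ℝ) :
    ∫ y, momentumFn a b y ∂ν = √r * ∑ i, (∫ y, y.2.1 ∂ν) i * a i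
      + ∑ i, ∑ j, (∫ y, y.2.1 i * y.2.1 j ∂ν) * b i j
      - ∑ i, ∑ j, (∫ y, y.2.1 i * y.2.2 j ∂ν) * b i j := by
  have i1 : ∀ i, Integrable (fun y : Phase d => √(y.1 : ℝ) * y.2.1 i * a i) ν := fun i =>
    (h.integrable_sqrt_W hγ i).mul_const _
  have i2 : ∀ i j, Integrable (fun y : Phase d => y.2.1 i * y.2.1 j * b i j) ν := fun i j =>
    (h.integrable_WW i j).mul_const _
  have i3 : ∀ i j, Integrable (fun y : Phase d => y.2.1 i * y.2.2 j * b i j) ν := fun i j =>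
    (h.integrable_WF i j).mul_const _
  have i2' : ∀ i, Integrable (fun y : Phase d => ∑ j, y.2.1 i * y.2.1 j * b i j) ν := fun i =>
    integrable_finsetSum _ fun j _ => i2 i j
  have i3' : ∀ i, Integrable (fun y : Phase d => ∑ j, y.2.1 i * y.2.2 j * b i j) ν := fun i =>
    integrable_finsetSum _ fun j _ => i3 i j
  have j1 := integrable_finsetSum Finset.univ fun i _ => i1 i
  have j2 := integrable_finsetSum Finset.univ fun i _ => i2' i
  have j3 := integrable_finsetSum Finset.univ fun i _ => i3' i
  simp only [momentumFn]
  rw [integral_sub (j1.fun_add j2) j3, integral_add j1 j2, integral_finsetSum _ fun i _ => i1 i,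
    integral_finsetSum _ fun i _ => i2' i, integral_finsetSum _ fun i _ => i3' i]
  simp only [integral_finsetSum _ fun j _ => i2 _ j, integral_finsetSum _ fun j _ => i3 _ j,
    integral_mul_const, integral_sqrt_W h hr]
  simp only [Finset.mul_sum, mul_assoc]

lemma integral_continuityFn (hγ : 1 ≤ γ) (h : FiniteMoments γ ν id)
    (hr : ∀ᵐ y ∂ν, (y.1 : ℝ) = r) (a : ℝ) (b : Fin d → ℝ) :
    ∫ y, continuityFn a b y ∂ν = (∫ y, (y.1 : ℝ) ∂ν) * a + √r * ∑ j, (∫ y, y.2.1 ∂ν) j * b j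
      - √r * ∑ j, (∫ y, y.2.2 ∂ν) j * b j := by
  have i0 : Integrable (fun y : Phase d => (y.1 : ℝ) * a) ν :=
    (h.integrable_density hγ).mul_const _
  have i1 : ∀ i, Integrable (fun y : Phase d => √(y.1 : ℝ) * y.2.1 i * b i) ν := fun i =>
    (h.integrable_sqrt_W hγ i).mul_const _
  have i2 : ∀ i, Integrable (fun y : Phase d => √(y.1 : ℝ) * y.2.2 i * b i) ν := fun i =>
    (h.integrable_sqrt_F hγ i).mul_const _
  have j1 := integrable_finsetSum Finset.univ fun i _ => i1 i
  have j2 := integrable_finsetSum Finset.univ fun i _ => i2 i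
  simp only [continuityFn]
  rw [integral_sub (i0.fun_add j1) j2, integral_add i0 j1, integral_finsetSum _ fun i _ => i1 i,
    integral_finsetSum _ fun i _ => i2 i]
  simp only [integral_mul_const, integral_sqrt_W h hr, integral_sqrt_F h hr]
  simp only [Finset.mul_sum, mul_assoc]

end Mean

end Moments

/-! ### Algebra of the relative energy identity -/

section Algebra

variable {d : ℕ} {γ : ℝ}

/-- The part of the relative energy production which is controlled by the relative energy and the
relative dissipation. Here `r`, `w`, `P`, `g`, `δ` stand for the density, the velocity `w`, the
cost gradient, `∇w` and the divergence of `w - P`. -/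
noncomputable def production (γ r : ℝ) (w P : Fin d → ℝ) (g : Fin d → Fin d → ℝ) (δ : ℝ)
    (y : Phase d) : ℝ :=
  ∑ j, (y.2.1 j - √(y.1 : ℝ) * w j) * (y.2.2 j - √(y.1 : ℝ) * P j) - relDissipation P y
    - ∑ i, ∑ j, (y.2.1 i - √(y.1 : ℝ) * w i) *
        ((y.2.1 j - √(y.1 : ℝ) * w j) - (y.2.2 j - √(y.1 : ℝ) * P j)) * g i j
    - γ * relE γ y.1 r * δ

/-- The part of the relative energy production which integrates to zero. -/
noncomputable def transportFn (γ : ℝ) (u : Fin d → ℝ) (δ : ℝ) (y : Phase d) : ℝ :=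
  ∑ j, √(y.1 : ℝ) * y.2.2 j * u j + E γ y.1 * (γ * δ)

/-- The combination is the one dictated by `relEnergy_eq`: energy minus momentum plus continuity,
with r q standing for ∂_t(γE(ρ̄)) = ρ̄ ∂_t p(ρ̄). The hypotheses are the transport equation for w
and the equation for q = ∂_t p(ρ̄). The last bracket is div(γE(ρ̄)u) for the strong solution. -/
lemma production_identity (r : ℝ) (w P dw : Fin d → ℝ) (g : Fin d → Fin d → ℝ)
    (δ q : ℝ) (hdw : ∀ i, dw i = -∑ j, (w j - P j) * g i j)
    (hq : q = -γ * p γ r * δ - ∑ j, (w j - P j) * P j) (y : Phase d) :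
    powerFn y - momentumFn dw g y
        + continuityFn (∑ i, w i * dw i - q) (fun j => ∑ i, w i * g i j - P j) y + r * q
      = production γ r w P g δ y + transportFn γ (fun j => w j - P j) δ y
        - (∑ j, r * P j * (w j - P j) + γ * E γ r * δ) := by
  obtain ⟨s, W, F⟩ := y
  have hss := Real.mul_self_sqrt s.coe_nonneg
  simp only [powerFn, momentumFn, continuityFn, production, transportFn, relDissipation, relE]
  have hin : inner ℝ W F = ∑ j, W j * F j := by simp [PiLp.inner_apply, mul_comm]
  rw [hin, EuclideanSpace.real_norm_sq_eq]
  set c := √(s : ℝ) with hc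
  have hL : ∑ j, W j * F j - ∑ j, F j ^ 2 - ∑ j, c * W j * -P j * (-1)
      + ∑ j, c * F j * P j + ((s : ℝ) - r) * ∑ j, (w j - P j) * P j
      = ∑ j, (W j - c * w j) * (F j - c * P j) - ∑ j, (F j - c * P j) ^ 2
        + ∑ j, c * F j * (w j - P j) - ∑ j, r * P j * (w j - P j) := by
    simp only [Finset.mul_sum, ← Finset.sum_sub_distrib, ← Finset.sum_add_distrib]
    refine Finset.sum_congr rfl fun j _ => ?_
    linear_combination (-(w j - P j) * P j) * hss
  -- Terms linear in ∇w: by the transport equation they collapse to a product of deviations from the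
  -- strong state.
  have hG : -(∑ i, c * W i * dw i + ∑ i, ∑ j, W i * W j * g i j - ∑ i, ∑ j, W i * F j * g i j)
      + ((s : ℝ) * ∑ i, w i * dw i + ∑ j, c * W j * ∑ i, w i * g i j
        - ∑ j, c * F j * ∑ i, w i * g i j)
      = -∑ i, ∑ j, (W i - c * w i) * ((W j - c * w j) - (F j - c * P j)) * g i j := by
    have e1 : ∑ j, c * W j * ∑ i, w i * g i j = ∑ i, ∑ j, c * W j * (w i * g i j) := by
      simp only [Finset.mul_sum]; exact Finset.sum_comm
    have e2 : ∑ j, c * F j * ∑ i, w i * g i j = ∑ i, ∑ j, c * F j * (w i * g i j) := by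
      simp only [Finset.mul_sum]; exact Finset.sum_comm
    rw [e1, e2]
    simp only [hdw, Finset.mul_sum, ← Finset.sum_neg_distrib, ← Finset.sum_sub_distrib,
      ← Finset.sum_add_distrib]
    refine Finset.sum_congr rfl fun i _ => Finset.sum_congr rfl fun j _ => ?_
    linear_combination (w i * (w j - P j) * g i j) * hss
  have e3 : ∑ j, c * W j * (∑ i, w i * g i j - P j)
      = ∑ j, c * W j * ∑ i, w i * g i j + ∑ j, c * W j * -P j := by
    rw [← Finset.sum_add_distrib]; exact Finset.sum_congr rfl fun j _ => by ring
  have e4 : ∑ j, c * F j * (∑ i, w i * g i j - P j)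
      = ∑ j, c * F j * ∑ i, w i * g i j - ∑ j, c * F j * P j := by
    rw [← Finset.sum_sub_distrib]; exact Finset.sum_congr rfl fun j _ => by ring
  have e5 : ∑ j, c * W j * -P j * (-1) = -∑ j, c * W j * -P j := by
    rw [← Finset.sum_neg_distrib]; exact Finset.sum_congr rfl fun j _ => by ring
  rw [e5] at hL
  rw [e3, e4]
  linear_combination hL + hG - ((s : ℝ) - r) * hq

/-- The relative energy production is controlled by the relative energy and the relative
dissipation. -/
lemma production_le (hγ : 1 ≤ γ) {r : ℝ} (hr : 0 < r) {w P : Fin d → ℝ}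
    {g : Fin d → Fin d → ℝ} {δ L N : ℝ} (hg : ∀ i j, |g i j| ≤ L) (hδ : |δ| ≤ N) (y : Phase d) :
    production γ r w P g δ y ≤ (2 * (1 + L * d + L ^ 2 * d ^ 2) + γ * N) * relEnergy γ r w y
      - 1 / 2 * relDissipation P y := by
  obtain ⟨s, W, F⟩ := y
  simp only [production, relEnergy, relDissipation]
  set c := √(s : ℝ)
  set A : Fin d → ℝ := fun j => W j - c * w j with hA
  set B : Fin d → ℝ := fun j => F j - c * P j with hB
  have hrel := relE_nonneg hγ (s := (s : ℝ)) s.coe_nonneg hr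
  have hN : 0 ≤ N := (abs_nonneg δ).trans hδ
  -- Without an index i, the bound on `g` says nothing about the sign of `L`.
  rcases Nat.eq_zero_or_pos d with rfl | hd
  · simp only [Finset.univ_eq_empty, Finset.sum_empty]
    have h1 := mul_le_mul_of_nonneg_left (neg_le_of_abs_le hδ)
      (mul_nonneg (by linarith : 0 ≤ γ) hrel)
    norm_num
    nlinarith
  have hL : 0 ≤ L := (abs_nonneg _).trans (hg ⟨0, hd⟩ ⟨0, hd⟩)
  have hd' : (0 : ℝ) < d := by exact_mod_cast hd
  -- Of the full relative dissipation, one quarter is spent on this cross term and one quarter on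
  -- the one in `h2`, which leaves the half in the conclusion.
  have h1 : ∑ j, A j * B j ≤ ∑ j, A j ^ 2 + 1 / 4 * ∑ j, B j ^ 2 := by
    rw [Finset.mul_sum, ← Finset.sum_add_distrib]
    exact Finset.sum_le_sum fun j _ => by nlinarith [sq_nonneg (A j - 1 / 2 * B j)]
  have h2 : -∑ i, ∑ j, A i * (A j - B j) * g i j
      ≤ (L * d + L ^ 2 * d ^ 2) * ∑ j, A j ^ 2 + 1 / 4 * ∑ j, B j ^ 2 := by
    -- The weight 1/(4d) on B_j² sums over i to 1/4; Young's inequality then forces L²d on A_i²,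
    -- which sums over j to L²d².
    have h3 : ∀ i j, -(A i * (A j - B j) * g i j) ≤ L * (1 / 2 * A i ^ 2 + 1 / 2 * A j ^ 2)
        + (L ^ 2 * d * A i ^ 2 + 1 / (4 * d) * B j ^ 2) := by
      intro i j
      have k1 : -(A i * A j * g i j) ≤ L * (1 / 2 * A i ^ 2 + 1 / 2 * A j ^ 2) := by
        refine (neg_le_abs _).trans ?_
        rw [abs_mul, abs_mul, mul_comm]
        refine mul_le_mul (hg i j) ?_ (by positivity) hL
        nlinarith [sq_nonneg (|A i| - |A j|), sq_abs (A i), sq_abs (A j)]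
      have k2 : A i * B j * g i j ≤ L ^ 2 * d * A i ^ 2 + 1 / (4 * d) * B j ^ 2 := by
        have k3 : A i * B j * g i j ≤ L * |A i| * |B j| := by
          refine (le_abs_self _).trans ?_
          rw [abs_mul, abs_mul, mul_comm, mul_assoc]
          gcongr
          exact hg i j
        have k4 : 1 / (4 * d) * (2 * d * L * |A i| - |B j|) ^ 2
            = L ^ 2 * d * A i ^ 2 + 1 / (4 * d) * B j ^ 2 - L * |A i| * |B j| := by
          rw [← sq_abs (A i), ← sq_abs (B j)]
          field_simp
          ring
        have k5 : 0 ≤ 1 / (4 * (d : ℝ)) * (2 * d * L * |A i| - |B j|) ^ 2 := by positivity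
        linarith
      linarith
    rw [← Finset.sum_neg_distrib]
    simp only [← Finset.sum_neg_distrib]
    refine (Finset.sum_le_sum fun i _ => Finset.sum_le_sum fun j _ => h3 i j).trans (le_of_eq ?_)
    simp only [Finset.sum_add_distrib, ← Finset.mul_sum, Finset.sum_const, Finset.card_univ,
      Fintype.card_fin, nsmul_eq_mul]
    field_simp
    ring
  have h4 : -(γ * relE γ s r * δ) ≤ γ * N * relE γ s r := by
    have := mul_le_mul_of_nonneg_left (neg_le_of_abs_le hδ)
      (mul_nonneg (by linarith : 0 ≤ γ) hrel)
    linarith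
  have h5 : 0 ≤ ∑ j, A j ^ 2 := Finset.sum_nonneg fun j _ => sq_nonneg _
  have h6 : 0 ≤ γ * N * (∑ j, A j ^ 2) := mul_nonneg (mul_nonneg (by linarith) hN) h5
  have h7 : 0 ≤ (2 * (1 + L * d + L ^ 2 * d ^ 2)) * relE γ s r := by positivity
  change ∑ j, A j * B j - ∑ j, B j ^ 2 - ∑ i, ∑ j, A i * (A j - B j) * g i j
    - γ * relE γ s r * δ ≤ (2 * (1 + L * d + L ^ 2 * d ^ 2) + γ * N)
      * (1 / 2 * ∑ i, A i ^ 2 + relE γ s r) - 1 / 2 * ∑ j, B j ^ 2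
  linarith

lemma relEnergy_nonneg (hγ : 1 ≤ γ) {r : ℝ} (hr : 0 < r) (w : Fin d → ℝ) (y : Phase d) :
    0 ≤ relEnergy γ r w y :=
  add_nonneg (mul_nonneg (by norm_num) (Finset.sum_nonneg fun _ _ => sq_nonneg _))
    (relE_nonneg hγ y.1.coe_nonneg hr)

lemma relDissipation_nonneg (P : Fin d → ℝ) (y : Phase d) : 0 ≤ relDissipation P y :=
  Finset.sum_nonneg fun _ _ => sq_nonneg _

lemma eq_of_relEnergy_eq_zero (hγ : 1 ≤ γ) {r : ℝ} (hr : 0 < r) {w : Vec d} {P : Fin d → ℝ}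
    {y : Phase d} (h1 : relEnergy γ r w y = 0) (h2 : relDissipation P y = 0) :
    y = (r.toNNReal, √r • w, WithLp.toLp 2 fun j => √r * P j) := by
  obtain ⟨s, W, F⟩ := y
  have a1 : 0 ≤ 1 / 2 * ∑ i, (W i - √(s : ℝ) * w i) ^ 2 :=
    mul_nonneg (by norm_num) (Finset.sum_nonneg fun _ _ => sq_nonneg _)
  have a2 := relE_nonneg hγ (s := (s : ℝ)) s.coe_nonneg hr
  simp only [relEnergy] at h1
  have hs : (s : ℝ) = r := by
    by_contra hne
    have := relE_pos hγ s.coe_nonneg hr hne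
    linarith
  have hW : ∑ i, (W i - √(s : ℝ) * w i) ^ 2 = 0 := by linarith
  rw [Finset.sum_eq_zero_iff_of_nonneg fun _ _ => sq_nonneg _] at hW
  simp only [relDissipation] at h2
  rw [Finset.sum_eq_zero_iff_of_nonneg fun _ _ => sq_nonneg _] at h2
  refine Prod.ext ?_ (Prod.ext ?_ ?_)
  · simp [← hs]
  · ext i
    have := hW i (Finset.mem_univ i)
    rw [sq_eq_zero_iff, sub_eq_zero, hs] at this
    simpa using this
  · ext i
    have := h2 i (Finset.mem_univ i)
    rw [sq_eq_zero_iff, sub_eq_zero, hs] at this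
    simpa using this

end Algebra

/-! ### Time slices of a Young measure -/

section Slices

variable {d : ℕ} {γ T : ℝ} {V : YoungMeasure d}

/-- The kernel assigning to a time `t` the measure `dx ⊗ V_{t,x}`. -/
noncomputable def sliceKernel (V : YoungMeasure d) : Kernel ℝ (Torus d × Phase d) :=
  Kernel.const ℝ volume ⊗ₖ V

variable [IsMarkovKernel V]

instance : IsFiniteKernel (sliceKernel V) := by
  unfold sliceKernel; infer_instance

omit [IsMarkovKernel V] in
-- The definition disintegrates over space-time, whereas the relative energy argument runs at fixed
-- time. This regrouping transfers integrability and null sets between the two.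
lemma map_prodAssoc_cylMeasure :
    (cylMeasure d T ⊗ₘ V).map MeasurableEquiv.prodAssoc = timeMeasure T ⊗ₘ sliceKernel V := by
  rw [cylMeasure, ← Measure.compProd_const, Measure.compProd_assoc', sliceKernel]

omit [IsMarkovKernel V] in
lemma integrable_cylMeasure_iff {f : (ℝ × Torus d) × Phase d → ℝ} :
    Integrable f (cylMeasure d T ⊗ₘ V)
      ↔ Integrable (fun z => f ((z.1, z.2.1), z.2.2)) (timeMeasure T ⊗ₘ sliceKernel V) := by
  rw [← map_prodAssoc_cylMeasure, integrable_map_equiv]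
  rfl

lemma integral_slice {t : ℝ} {f : Torus d × Phase d → ℝ} (hf : Integrable f (sliceKernel V t)) :
    ∫ q, f q ∂(sliceKernel V t) = ∫ x, ∫ y, f (x, y) ∂(V (t, x)) :=
  ProbabilityTheory.integral_compProd hf

lemma integral_slice_fst {t : ℝ} {c : Torus d → ℝ} (hc : Continuous c) :
    Integrable (fun q => c q.1) (sliceKernel V t) ∧
      ∫ q, c q.1 ∂(sliceKernel V t) = ∫ x, c x := by
  obtain ⟨C, hC⟩ := isCompact_univ.exists_bound_of_continuousOn hc.continuousOn
  have h : Integrable (fun q => c q.1) (sliceKernel V t) :=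
    Integrable.of_bound (hc.comp continuous_fst).aestronglyMeasurable C
      (Eventually.of_forall fun q => hC _ (mem_univ _))
  refine ⟨h, ?_⟩
  rw [integral_slice h]
  simp

omit [IsMarkovKernel V] in
lemma bddCoef_slice {t : ℝ} {c : Torus d → ℝ} (hc : Continuous c) :
    BddCoef (sliceKernel V t) (fun q => c q.1) := by
  obtain ⟨C, hC⟩ := isCompact_univ.exists_bound_of_continuousOn hc.continuousOn
  exact ⟨(hc.comp continuous_fst).aestronglyMeasurable, C,
    Eventually.of_forall fun q => hC _ (mem_univ _)⟩

omit [IsMarkovKernel V] in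
lemma ae_mem_timeMeasure_compProd {S : Type*} [MeasurableSpace S] {K : Kernel ℝ S} :
    ∀ᵐ z ∂(timeMeasure T ⊗ₘ K), z.1 ∈ Ioo 0 T := by
  refine Measure.ae_compProd_of_ae_ae (measurable_fst measurableSet_Ioo) ?_
  filter_upwards [ae_restrict_mem measurableSet_Ioo] with t ht
  exact Eventually.of_forall fun _ => ht

omit [IsMarkovKernel V] in
lemma bddCoef_spaceTime {c : ℝ → Torus d → ℝ} (hc : ContCyl T c) :
    BddCoef (timeMeasure T ⊗ₘ sliceKernel V) (fun z => c z.1 z.2.1) := by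
  obtain ⟨C, -, hC⟩ := hc.exists_bound
  have hS : ∀ᵐ z ∂(timeMeasure T ⊗ₘ sliceKernel V),
      z ∈ (Icc 0 T ×ˢ univ : Set (ℝ × (Torus d × Phase d))) := by
    filter_upwards [ae_mem_timeMeasure_compProd] with z hz using
      ⟨Ioo_subset_Icc_self hz, mem_univ _⟩
  refine ⟨?_, C, ?_⟩
  · rw [← Measure.restrict_eq_self_of_ae_mem hS]
    refine ContinuousOn.aestronglyMeasurable ?_ (measurableSet_Icc.prod MeasurableSet.univ)
    exact ContinuousOn.comp (f := fun z : ℝ × (Torus d × Phase d) => (z.1, z.2.1)) hc (by fun_prop)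
      fun z hz => ⟨hz.1, mem_univ _⟩
  · filter_upwards [hS] with z hz using hC z.1 hz.1 z.2.1

/-- Equality in Jensen's inequality for the square root. -/
lemma ae_eq_mean_of_sqrt {ν : Measure (Phase d)} [IsProbabilityMeasure ν] (hγ : 1 ≤ γ)
    (h : FiniteMoments γ ν id)
    (hm : (∫ y, (y.1 : ℝ) ∂ν) ^ (1 / 2 : ℝ) = ∫ y, (y.1 : ℝ) ^ (1 / 2 : ℝ) ∂ν) :
    ∀ᵐ y ∂ν, (y.1 : ℝ) = ∫ y, (y.1 : ℝ) ∂ν := by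
  set m := ∫ y, (y.1 : ℝ) ∂ν with hmdef
  have hm0 : 0 ≤ m := integral_nonneg fun y => y.1.coe_nonneg
  simp only [← Real.sqrt_eq_rpow] at hm
  have i1 : Integrable (fun y : Phase d => (y.1 : ℝ)) ν := h.integrable_density hγ
  have i2 : Integrable (fun y : Phase d => √(y.1 : ℝ)) ν := by
    refine ((integrable_const (1 : ℝ)).add i1).mono'
      (h.of_continuous (φ := fun y => √(y.1 : ℝ)) (by fun_prop)) (Eventually.of_forall fun y => ?_)
    rw [Real.norm_of_nonneg (Real.sqrt_nonneg _)]
    simp only [Pi.add_apply]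
    nlinarith [Real.sq_sqrt y.1.coe_nonneg, sq_nonneg (√(y.1 : ℝ) - 1)]
  have e : ∀ y : Phase d, (√(y.1 : ℝ) - √m) ^ 2 = (y.1 : ℝ) - 2 * √m * √(y.1 : ℝ) + m := fun y => by
    linear_combination Real.sq_sqrt y.1.coe_nonneg + Real.sq_sqrt hm0
  have i3 : Integrable (fun y : Phase d => (y.1 : ℝ) - 2 * √m * √(y.1 : ℝ)) ν :=
    i1.sub (i2.const_mul _)
  -- The variance of √s about √m: expanded, it is m − 2√m ∫√s + m, which vanishes because the mean
  -- of √s is √m.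
  have h0 : ∫ y : Phase d, (√(y.1 : ℝ) - √m) ^ 2 ∂ν = 0 := by
    simp only [e]
    rw [integral_add i3 (integrable_const _), integral_sub i1 (i2.const_mul _),
      integral_const_mul, ← hm, ← hmdef]
    simp only [integral_const, probReal_univ, one_smul]
    linear_combination (-2) * Real.mul_self_sqrt hm0
  have i4 : Integrable (fun y : Phase d => (√(y.1 : ℝ) - √m) ^ 2) ν := by
    simp only [e]; exact i3.add (integrable_const _)
  have h1 := (integral_eq_zero_iff_of_nonneg (fun y => sq_nonneg _) i4).1 h0
  filter_upwards [h1] with y hy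
  have h2 : √(y.1 : ℝ) = √m := by
    simpa [sub_eq_zero] using hy
  exact (Real.sqrt_inj y.1.coe_nonneg hm0).1 h2

/-- Times at which the slice of a measure-valued solution has all the regularity needed. -/
structure GoodTime (γ : ℝ) (V : YoungMeasure d) (t : ℝ) : Prop where
  moments : FiniteMoments γ (sliceKernel V t) Prod.snd
  density : ∀ᵐ x, ∀ᵐ y ∂(V (t, x)), (y.1 : ℝ) = dens V t x
  memQ : MemLp (fun x => Q γ (dens V t x)) 2
  memF : MemLp (avD V t) 2
  weakGrad : IsWeakGrad (fun x => Q γ (dens V t x)) (avD V t)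

omit [IsMarkovKernel V] in
-- Both parts of the energy are nonnegative, so each is dominated by a multiple of the whole.
lemma finiteMoments_spaceTime {V₀ : InitialYoungMeasure d} {D : ℝ → ℝ} (hγ : 1 ≤ γ)
    (hV : IsMeasureValuedSolution d γ T V₀ V D) :
    FiniteMoments γ (timeMeasure T ⊗ₘ sliceKernel V) (fun z => z.2.2) := by
  have h1 := integrable_cylMeasure_iff.1 hV.integrable_energy
  have h2 := integrable_cylMeasure_iff.1 hV.integrable_dissipation
  have hE : ∀ s : ℝ≥0, 0 ≤ E γ s := fun s => E_nonneg hγ s.coe_nonneg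
  have hY : Measurable (fun z : ℝ × (Torus d × Phase d) => z.2.2) := by fun_prop
  refine ⟨hY, ?_, ?_, h2⟩
  · refine (h1.const_mul (γ + 1)).mono' ?_ (Eventually.of_forall fun z => ?_)
    · have : Measurable (fun y : Phase d => (y.1 : ℝ) ^ (γ + 1)) := by fun_prop
      exact (this.comp hY).aestronglyMeasurable
    · have h3 : (z.2.2.1 : ℝ) ^ (γ + 1) = (γ + 1) * E γ z.2.2.1 := by
        rw [E_eq hγ, mul_div_cancel₀ _ (by linarith)]
      rw [Real.norm_of_nonneg (by positivity), h3]
      have : 0 ≤ γ + 1 := by linarith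
      gcongr
      have := sq_nonneg ‖z.2.2.2.1‖
      linarith
  · refine (h1.const_mul 2).mono' ?_ (Eventually.of_forall fun z => ?_)
    · have : Measurable (fun y : Phase d => ‖y.2.1‖ ^ 2) := by fun_prop
      exact (this.comp hY).aestronglyMeasurable
    · rw [Real.norm_of_nonneg (by positivity)]
      have := hE z.2.2.1
      linarith

omit [IsMarkovKernel V] in
lemma FiniteMoments.ae_time {K : Kernel ℝ (Torus d × Phase d)} [IsFiniteKernel K]
    (h : FiniteMoments γ (timeMeasure T ⊗ₘ K) (fun z => z.2.2)) :
    ∀ᵐ t ∂(timeMeasure T), FiniteMoments γ (K t) Prod.snd := by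
  filter_upwards [((Measure.integrable_compProd_iff h.intE.1).1 h.intE).1,
    ((Measure.integrable_compProd_iff h.intW.1).1 h.intW).1,
    ((Measure.integrable_compProd_iff h.intF.1).1 h.intF).1] with t h1 h2 h3
  exact ⟨measurable_snd, h1, h2, h3⟩

lemma FiniteMoments.ae_space {t : ℝ} (h : FiniteMoments γ (sliceKernel V t) Prod.snd) :
    ∀ᵐ x : Torus d, FiniteMoments γ (V (t, x)) id := by
  filter_upwards [h.intE.ae_of_compProd, h.intW.ae_of_compProd, h.intF.ae_of_compProd]
    with x h1 h2 h3
  exact ⟨measurable_id, h1, h2, h3⟩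

omit [IsMarkovKernel V] in
lemma ae_memLp_two_slice {F : Type*} [NormedAddCommGroup F] {f : ℝ × Torus d → F}
    (hf : MemLp f 2 (cylMeasure d T)) :
    ∀ᵐ t ∂(timeMeasure T), MemLp (fun x => f (t, x)) 2 := by
  have h1 := (memLp_two_iff_integrable_sq_norm hf.1).1 hf
  filter_upwards [h1.prod_right_ae, hf.1.prodMk_left] with t h2 h3
  exact (memLp_two_iff_integrable_sq_norm h3).2 h2

lemma IsMeasureValuedSolution.ae_goodTime {V₀ : InitialYoungMeasure d} {D : ℝ → ℝ} (hγ : 1 ≤ γ)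
    (hV : IsMeasureValuedSolution d γ T V₀ V D) : ∀ᵐ t ∂(timeMeasure T), GoodTime γ V t := by
  -- The single exponent ½ suffices: strict concavity of the square root already excludes
  -- oscillation of the density.
  have hd := (hV.density_power (1 / 2) ⟨by norm_num, by linarith⟩).1
  filter_upwards [(finiteMoments_spaceTime hγ hV).ae_time, Measure.ae_ae_of_ae_prod hd,
    ae_memLp_two_slice hV.Q_sobolev.1, ae_memLp_two_slice hV.Q_sobolev.2.1, hV.Q_sobolev.2.2]
    with t h1 h2 h3 h4 h5
  refine ⟨h1, ?_, h3, h4, h5⟩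
  filter_upwards [h1.ae_space, h2] with x hx hx2
  exact ae_eq_mean_of_sqrt hγ hx hx2

namespace GoodTime

variable {t : ℝ}

lemma integral_momentum (h : GoodTime γ V t) (hγ : 1 ≤ γ) {a : Fin d → Torus d → ℝ}
    {b : Fin d → Fin d → Torus d → ℝ} (ha : ∀ i, Continuous (a i)) (hb : ∀ i j, Continuous (b i j)) :
    ∫ x, (√(dens V t x) * ∑ i, avW V t x i * a i x
        + ∑ i, ∑ j, av V (fun y => y.2.1 i * y.2.1 j) t x * b i j x
        - ∑ i, ∑ j, av V (fun y => y.2.1 i * y.2.2 j) t x * b i j x)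
      = ∫ q, momentumFn (fun i => a i q.1) (fun i j => b i j q.1) q.2 ∂(sliceKernel V t) := by
  rw [integral_slice (h.moments.integrable_momentumFn hγ (fun i => bddCoef_slice (ha i))
    fun i j => bddCoef_slice (hb i j))]
  refine integral_congr_ae ?_
  filter_upwards [h.moments.ae_space, h.density] with x hx hx2
  exact (integral_momentumFn hγ hx hx2 _ _).symm

lemma integral_continuity (h : GoodTime γ V t) (hγ : 1 ≤ γ) {a : Torus d → ℝ}
    {b : Fin d → Torus d → ℝ} (ha : Continuous a) (hb : ∀ j, Continuous (b j)) :
    ∫ x, (dens V t x * a x + √(dens V t x) * ∑ j, avW V t x j * b j x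
        - √(dens V t x) * ∑ j, avD V t x j * b j x)
      = ∫ q, continuityFn (a q.1) (fun j => b j q.1) q.2 ∂(sliceKernel V t) := by
  rw [integral_slice (h.moments.integrable_continuityFn hγ (bddCoef_slice ha)
    fun j => bddCoef_slice (hb j))]
  refine integral_congr_ae ?_
  filter_upwards [h.moments.ae_space, h.density] with x hx hx2
  exact (integral_continuityFn hγ hx hx2 _ _).symm

/-- The weak form of `√ρ ∇Q(ρ) = ∇(γ E(ρ))`. -/
lemma integral_E_pd (h : GoodTime γ V t) (hγ : 1 ≤ γ) {η : Torus d → ℝ} (hη : IsCk 1 η)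
    (j : Fin d) :
    ∫ q, (√(q.2.1 : ℝ) * q.2.2.2 j * η q.1 + E γ q.2.1 * (γ * pd j η q.1)) ∂(sliceKernel V t)
      = 0 := by
  have hs := h.moments.integrable_density hγ
  have hE := h.moments.integrable_E hγ
  have i1 : Integrable (fun q : Torus d × Phase d => √(q.2.1 : ℝ) * q.2.2.2 j * η q.1)
      (sliceKernel V t) :=
    (bddCoef_slice hη.continuous).integrable_mul (h.moments.integrable_sqrt_F hγ j)
  have i2 : Integrable (fun q : Torus d × Phase d => E γ q.2.1 * (γ * pd j η q.1))
      (sliceKernel V t) :=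
    (bddCoef_slice ((hη.continuous_pd le_rfl j).const_mul γ)).integrable_mul hE
  have hdens : Integrable (dens V t) := hs.integral_compProd
  have hdens0 : ∀ x, 0 ≤ dens V t x := fun x => integral_nonneg fun y => y.1.coe_nonneg
  have eE : ∀ᵐ x, ∫ y, E γ y.1 ∂(V (t, x)) = E γ (dens V t x) := by
    filter_upwards [h.density] with x hx
    rw [integral_congr_ae (g := fun _ => E γ (dens V t x))
      (by filter_upwards [hx] with y hy; rw [hy])]
    simp
  have hEd : Integrable (fun x => γ * E γ (dens V t x)) :=
    (Integrable.congr hE.integral_compProd eE).const_mul γ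
  have hsq : MemLp (fun x => √(dens V t x)) 2 := by
    rw [memLp_two_iff_integrable_sq (hdens.1.aemeasurable.sqrt.aestronglyMeasurable)]
    exact hdens.congr (Eventually.of_forall fun x => (Real.sq_sqrt (hdens0 x)).symm)
  have hGj : MemLp (fun x => avD V t x j) 2 := by
    refine h.memF.mono ((EuclideanSpace.proj (𝕜 := ℝ) j).continuous.comp_aestronglyMeasurable
      h.memF.1) (Eventually.of_forall fun x => ?_)
    exact PiLp.norm_apply_le _ _
  -- Here g = Q(ϱ), Φ = γE(ϱ), and σ = √ϱ is the derivative of γE with respect to Q. Membership of σ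
  -- in L² is just integrability of ϱ.
  have chain := integral_mul_pd_of_convex h.memQ j hGj h.weakGrad hEd hsq
    (fun x y => sqrt_mul_Q_sub_le hγ (hdens0 x) (hdens0 y)) hη
  rw [integral_add i1 i2, integral_slice i1, integral_slice i2]
  have e1 : ∫ x, ∫ y, √(y.1 : ℝ) * y.2.2 j * η x ∂(V (t, x))
      = ∫ x, √(dens V t x) * avD V t x j * η x := by
    refine integral_congr_ae ?_
    filter_upwards [h.moments.ae_space, h.density] with x hx hx2
    rw [integral_mul_const, integral_sqrt_F hx hx2]
    rfl
  have e2 : ∫ x, ∫ y, E γ y.1 * (γ * pd j η x) ∂(V (t, x))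
      = ∫ x, γ * E γ (dens V t x) * pd j η x := by
    refine integral_congr_ae ?_
    filter_upwards [eE] with x hx
    rw [integral_mul_const, hx]
    ring
  rw [e1, e2, chain]
  ring

lemma integral_transportFn (h : GoodTime γ V t) (hγ : 1 ≤ γ) {u : Fin d → Torus d → ℝ}
    (hu : ∀ j, IsCk 1 (u j)) :
    Integrable (fun q => transportFn γ (fun j => u j q.1) (∑ j, pd j (u j) q.1) q.2)
        (sliceKernel V t) ∧
      ∫ q, transportFn γ (fun j => u j q.1) (∑ j, pd j (u j) q.1) q.2 ∂(sliceKernel V t) = 0 := by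
  have hi : ∀ j, Integrable (fun q : Torus d × Phase d =>
      √(q.2.1 : ℝ) * q.2.2.2 j * u j q.1 + E γ q.2.1 * (γ * pd j (u j) q.1)) (sliceKernel V t) :=
    fun j => ((bddCoef_slice (hu j).continuous).integrable_mul
      (h.moments.integrable_sqrt_F hγ j)).add
      ((bddCoef_slice (((hu j).continuous_pd le_rfl j).const_mul γ)).integrable_mul
        (h.moments.integrable_E hγ))
  have e : (fun q : Torus d × Phase d =>
      transportFn γ (fun j => u j q.1) (∑ j, pd j (u j) q.1) q.2)
      = fun q => ∑ j, (√(q.2.1 : ℝ) * q.2.2.2 j * u j q.1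
        + E γ q.2.1 * (γ * pd j (u j) q.1)) := by
    funext q
    simp only [transportFn, Finset.sum_add_distrib, Finset.mul_sum]
  rw [e]
  refine ⟨integrable_finsetSum _ fun j _ => hi j, ?_⟩
  rw [integral_finsetSum _ fun j _ => hi j]
  exact Finset.sum_eq_zero fun j _ => h.integral_E_pd hγ (hu j) j

end GoodTime

end Slices

/-! ### The relative energy balance at a fixed time -/

section Balance

lemma integrable_fun_sub {X : Type*} [MeasurableSpace X] {μ : Measure X} {f g : X → ℝ}
    (hf : Integrable f μ) (hg : Integrable g μ) : Integrable (fun x => f x - g x) μ := hf.sub hg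

variable {d : ℕ} {γ T : ℝ} {V : YoungMeasure d} [IsMarkovKernel V]
  {ρ : ℝ → Torus d → ℝ} {w : ℝ → Torus d → Vec d}

/-- The test function for the continuity equation. -/
noncomputable def testFn (γ : ℝ) (ρ : ℝ → Torus d → ℝ) (w : ℝ → Torus d → Vec d) (t : ℝ)
    (x : Torus d) : ℝ := ∑ i, 1 / 2 * (w t x i * w t x i) - cost γ ρ t x

namespace IsStrongSolution

variable (hs : IsStrongSolution d γ T ρ w)
include hs

lemma isC1_testFn (hT : 0 < T) : IsC1 T (testFn γ ρ w) ∧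
    (∀ t ∈ Icc 0 T, ∀ x, dt T (testFn γ ρ w) t x
      = ∑ i, w t x i * dt T (fun t x => w t x i) t x - dt T (cost γ ρ) t x) ∧
    ∀ t ∈ Icc 0 T, ∀ j x, pd j (testFn γ ρ w t) x
      = ∑ i, w t x i * pd j (fun x => w t x i) x - pd j (cost γ ρ t) x := by
  have hc : ∀ c : ℝ, IsC1 T (fun (_ : ℝ) (_ : Torus d) => c) := isC1_const hT
  have dtc : ∀ (c : ℝ), ∀ t ∈ Icc 0 T, ∀ x : Torus d,
      dt T (fun (_ : ℝ) (_ : Torus d) => c) t x = 0 := fun c t ht x =>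
    dt_eq hT ht (hasDerivWithinAt_const _ _ _)
  have hww : ∀ i, IsC1 T (fun t x => w t x i * w t x i) := fun i =>
    (hs.isC1_velocity i).mul hT (hs.isC1_velocity i)
  obtain ⟨s1, s2, s3⟩ := isC1_sum hT Finset.univ fun i => (hc (1 / 2)).mul hT (hww i)
  have hn := (hc (-1)).mul hT (hs.isC1_cost hT)
  have e : testFn γ ρ w = fun t x => ∑ i, 1 / 2 * (w t x i * w t x i) + -1 * cost γ ρ t x := by
    funext t x; simp only [testFn]; ring
  rw [e]
  refine ⟨s1.add hT hn, fun t ht x => ?_, fun t ht j x => ?_⟩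
  · rw [dt_add hT s1 hn ht, s2 t ht, dt_mul hT (hc (-1)) (hs.isC1_cost hT) ht, dtc (-1) t ht]
    have : ∀ i, dt T (fun t x => 1 / 2 * (w t x i * w t x i)) t x
        = w t x i * dt T (fun t x => w t x i) t x := fun i => by
      rw [dt_mul hT (hc (1 / 2)) (hww i) ht, dtc _ t ht,
        dt_mul hT (hs.isC1_velocity i) (hs.isC1_velocity i) ht]
      ring
    simp only [this]
    ring
  · rw [pd_add (s1.space t ht) (hn.space t ht), s3 t ht,
      pd_mul (isCk_const (-1)) ((hs.isC1_cost hT).space t ht), pd_const]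
    have : ∀ i, pd j (fun x => 1 / 2 * (w t x i * w t x i)) x
        = w t x i * pd j (fun x => w t x i) x := fun i => by
      rw [pd_mul (isCk_const (1 / 2)) ((hww i).space t ht), pd_const,
        pd_mul ((hs.isC1_velocity i).space t ht) ((hs.isC1_velocity i).space t ht)]
      ring
    simp only [this]
    ring

/-- The integrand is div(γE(ρ)u), by `pd_E` and the continuity equation. -/
lemma integral_pd_E_vel (hT : 0 < T) (hγ : 1 ≤ γ) {t : ℝ} (ht : t ∈ Ioo 0 T) :
    ∫ x, (∑ j, ρ t x * pd j (cost γ ρ t) x * vel γ ρ w j t x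
      + γ * E γ (ρ t x) * divVel γ T ρ w t x) = 0 := by
  have ht' := Ioo_subset_Icc_self ht
  have hE := (hs.isC1_E hT hγ).space t ht'
  have e : ∀ x, ∑ j, ρ t x * pd j (cost γ ρ t) x * vel γ ρ w j t x
      + γ * E γ (ρ t x) * divVel γ T ρ w t x
      = ∑ j, pd j (fun x => γ * E γ (ρ t x) * vel γ ρ w j t x) x := fun x => by
    rw [← hs.sum_pd_vel hγ ht, Finset.mul_sum, ← Finset.sum_add_distrib]
    refine Finset.sum_congr rfl fun j _ => ?_
    rw [pd_mul hE (hs.isCk_vel ht' j), hs.pd_E hγ ht']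
  simp only [e]
  have hk : ∀ j, IsCk 1 (fun x => γ * E γ (ρ t x) * vel γ ρ w j t x) := fun j =>
    hE.mul (hs.isCk_vel ht' j)
  rw [integral_finsetSum _ fun j _ => ((hk j).continuous_pd le_rfl j).integrable_of_hasCompactSupport
    (HasCompactSupport.of_compactSpace _)]
  exact Finset.sum_eq_zero fun j _ => integral_pd_eq_zero (hk j) j

/-- Uniform bounds on the strong solution. -/
lemma exists_bounds (hT : 0 < T) : ∃ L N : ℝ, 0 ≤ L ∧ 0 ≤ N ∧
    (∀ t ∈ Icc 0 T, ∀ x i j, |pd j (fun x => w t x i) x| ≤ L) ∧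
    ∀ t ∈ Icc 0 T, ∀ x, |divVel γ T ρ w t x| ≤ N := by
  choose L hL0 hL using fun i j => ((hs.isC1_velocity i).contCyl_pd j).exists_bound
  obtain ⟨N, hN0, hN⟩ := (hs.contCyl_divVel hT).exists_bound
  refine ⟨∑ i, ∑ j, L i j, N, Finset.sum_nonneg fun i _ => Finset.sum_nonneg fun j _ => hL0 i j,
    hN0, fun t ht x i j => (hL i j t ht x).trans ?_, hN⟩
  calc L i j ≤ ∑ j, L i j :=
        Finset.single_le_sum (f := fun j => L i j) (fun j _ => hL0 i j) (Finset.mem_univ j)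
    _ ≤ ∑ i, ∑ j, L i j := Finset.single_le_sum (f := fun i => ∑ j, L i j)
        (fun i _ => Finset.sum_nonneg fun j _ => hL0 i j) (Finset.mem_univ i)

lemma integrable_relEnergy_slice {t : ℝ} (hT : 0 < T) (hγ : 1 ≤ γ) (ht : t ∈ Icc 0 T)
    (h : FiniteMoments γ (sliceKernel V t) Prod.snd) :
    Integrable (fun q => relEnergy γ (ρ t q.1) (w t q.1) q.2) (sliceKernel V t) :=
  h.integrable_relEnergy hγ (r := fun q => ρ t q.1) (w := fun i q => w t q.1 i)
    (Eventually.of_forall fun _ => hs.pos t ht _)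
    (fun i => bddCoef_slice (c := fun x => w t x i) ((hs.isC1_velocity i).contCyl.continuous ht))
    (bddCoef_slice (c := testFn γ ρ w t) ((hs.isC1_testFn hT).1.contCyl.continuous ht))
    (bddCoef_slice (c := fun x => γ * E γ (ρ t x)) ((hs.isC1_E hT hγ).contCyl.continuous ht))

lemma integrable_relDissipation_slice {t : ℝ} (hT : 0 < T) (hγ : 1 ≤ γ) (ht : t ∈ Icc 0 T)
    (h : FiniteMoments γ (sliceKernel V t) Prod.snd) :
    Integrable (fun q => relDissipation (fun j => pd j (cost γ ρ t) q.1) q.2) (sliceKernel V t) :=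
  have hc : ∀ j, Continuous (pd j (cost γ ρ t)) := fun j =>
    ((hs.isC1_cost hT).contCyl_pd j).continuous ht
  h.integrable_relDissipation hγ (P := fun j q => pd j (cost γ ρ t) q.1)
    (fun j => bddCoef_slice (hc j))
    (fun j => bddCoef_slice (c := fun x => pd j (cost γ ρ t) x * pd j (cost γ ρ t) x)
      ((hc j).mul (hc j)))

/-- The relative energy balance at a fixed time. -/
lemma balance_le (hT : 0 < T) (hγ : 1 ≤ γ) {L N : ℝ}
    (hL : ∀ t ∈ Icc 0 T, ∀ x i j, |pd j (fun x => w t x i) x| ≤ L)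
    (hN : ∀ t ∈ Icc 0 T, ∀ x, |divVel γ T ρ w t x| ≤ N) {t : ℝ} (ht : t ∈ Ioo 0 T)
    (h : GoodTime γ V t) :
    (∫ q, powerFn q.2 ∂(sliceKernel V t))
      - (∫ q, momentumFn (fun i => dt T (fun t x => w t x i) t q.1)
          (fun i j => pd j (fun x => w t x i) q.1) q.2 ∂(sliceKernel V t))
      + (∫ q, continuityFn (dt T (testFn γ ρ w) t q.1) (fun j => pd j (testFn γ ρ w t) q.1) q.2
          ∂(sliceKernel V t))
      + (∫ x, dt T (fun t x => γ * E γ (ρ t x)) t x)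
      ≤ (2 * (1 + L * d + L ^ 2 * d ^ 2) + γ * N) *
          (∫ q, relEnergy γ (ρ t q.1) (w t q.1) q.2 ∂(sliceKernel V t))
        - 1 / 2 * ∫ q, relDissipation (fun j => pd j (cost γ ρ t) q.1) q.2 ∂(sliceKernel V t) := by
  have ht' := Ioo_subset_Icc_self ht
  obtain ⟨hψ, hψt, hψx⟩ := hs.isC1_testFn hT
  have i1 := h.moments.integrable_powerFn
  have i2 := h.moments.integrable_momentumFn hγ
    (fun i => bddCoef_slice ((hs.isC1_velocity i).contCyl_dt.continuous ht'))
    (fun i j => bddCoef_slice (((hs.isC1_velocity i).contCyl_pd j).continuous ht'))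
  have i3 := h.moments.integrable_continuityFn hγ (bddCoef_slice (hψ.contCyl_dt.continuous ht'))
    (fun j => bddCoef_slice ((hψ.contCyl_pd j).continuous ht'))
  obtain ⟨i4, e4⟩ := integral_slice_fst (V := V) (t := t)
    ((hs.isC1_E hT hγ).contCyl_dt.continuous ht')
  obtain ⟨i5, e5⟩ := h.integral_transportFn hγ (hs.isCk_vel ht')
  have hcont : Continuous fun x => ∑ j, ρ t x * pd j (cost γ ρ t) x * vel γ ρ w j t x
      + γ * E γ (ρ t x) * divVel γ T ρ w t x := by
    refine (continuous_finsetSum _ fun j _ => ?_).add ?_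
    · exact ((hs.isC1_density.contCyl.continuous ht').mul
        (((hs.isC1_cost hT).contCyl_pd j).continuous ht')).mul (hs.isCk_vel ht' j).continuous
    · exact ((hs.isC1_E hT hγ).contCyl.continuous ht').mul ((hs.contCyl_divVel hT).continuous ht')
  obtain ⟨i6, e6⟩ := integral_slice_fst (V := V) (t := t) hcont
  rw [hs.integral_pd_E_vel hT hγ ht] at e6
  have i7 := hs.integrable_relEnergy_slice (V := V) hT hγ ht' h.moments
  have i8 := hs.integrable_relDissipation_slice (V := V) hT hγ ht' h.moments
  have j1 := integrable_fun_sub i1 i2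
  have j2 := j1.fun_add i3
  have j3 := j2.fun_add i4
  have j4 := integrable_fun_sub i5 i6
  rw [← e4, ← integral_sub i1 i2, ← integral_add j1 i3, ← integral_add j2 i4, ← integral_const_mul, ← integral_const_mul,
    ← integral_sub (i7.const_mul _) (i8.const_mul _)]
  -- The weak chain rule disposes of the transport part and the divergence theorem of the strong
  -- part. Subtracting this zero leaves exactly `production` under the integral.
  have hzero : ∫ q, (transportFn γ (fun j => vel γ ρ w j t q.1)
      (∑ j, pd j (vel γ ρ w j t) q.1) q.2
      - (∑ j, ρ t q.1 * pd j (cost γ ρ t) q.1 * vel γ ρ w j t q.1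
      + γ * E γ (ρ t q.1) * divVel γ T ρ w t q.1)) ∂(sliceKernel V t) = 0 := by
    rw [integral_sub i5 i6, e5, e6, sub_zero]
  rw [← sub_zero (integral _ _), ← hzero,
    ← integral_sub j3 j4]
  refine integral_mono (j3.sub j4)
    ((i7.const_mul _).sub (i8.const_mul _)) fun q => ?_
  refine le_trans (le_of_eq ?_) (production_le hγ (hs.pos t ht' q.1)
    (w := w t q.1) (g := fun i j => pd j (fun x => w t x i) q.1) (fun i j => hL t ht' q.1 i j)
    (hN t ht' q.1) q.2)
  have hid := production_identity (γ := γ) (ρ t q.1) (w t q.1) (fun j => pd j (cost γ ρ t) q.1)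
    (fun i => dt T (fun t x => w t x i) t q.1) (fun i j => pd j (fun x => w t x i) q.1)
    (divVel γ T ρ w t q.1) (dt T (cost γ ρ) t q.1)
    (fun i => by
      have := hs.transport hγ hT ht q.1 i
      simp only [vel] at this
      linarith)
    (by
      -- The equation for q is the continuity equation multiplied by p'(ρ), with ρ p'(ρ) = γ p(ρ).
      have hpos := hs.pos t ht' q.1
      have h1 : divVel γ T ρ w t q.1 * ρ t q.1
          = -(dt T ρ t q.1 + ∑ j, pd j (ρ t) q.1 * vel γ ρ w j t q.1) := by
        rw [divVel, div_mul_cancel₀ _ hpos.ne']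
      have h2 : p γ (ρ t q.1) = ρ t q.1 ^ (γ - 1) * ρ t q.1 := by
        rw [p, ← Real.rpow_add_one hpos.ne', sub_add_cancel]
      have h3 : ∑ j, (w t q.1 j - pd j (cost γ ρ t) q.1) * pd j (cost γ ρ t) q.1
          = γ * ρ t q.1 ^ (γ - 1) * ∑ j, pd j (ρ t) q.1 * vel γ ρ w j t q.1 := by
        rw [Finset.mul_sum]
        refine Finset.sum_congr rfl fun j _ => ?_
        rw [vel, hs.pd_cost ht']
        ring
      rw [h3, h2, hs.dt_cost hT ht']
      linear_combination (γ * ρ t q.1 ^ (γ - 1)) * h1) q.2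
  rw [hs.sum_pd_vel hγ ht, hs.dt_E hT hγ ht', hψt t ht']
  simp only [hψx t ht', vel]
  linarith

end IsStrongSolution

end Balance

/-! ### A Grönwall inequality with an integrable weight -/

section Gronwall

variable {T : ℝ}

lemma timeMeasure_mono {τ : ℝ} (hτ : τ ≤ T) : timeMeasure τ ≤ timeMeasure T :=
  Measure.restrict_mono (Ioo_subset_Ioo_right hτ) le_rfl

/-- `Y` is controlled only almost everywhere and `a` is only integrable, so the argument is run on
the continuous monotone primitive Z of aY. On an interval where the integral of `a` is below 1, Z
cannot leave zero; continuous induction covers [0,T]. -/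
lemma ae_eq_zero_of_le_integral_mul {a Y : ℝ → ℝ} (ha : Integrable a (timeMeasure T))
    (haY : Integrable (fun t => a t * Y t) (timeMeasure T)) (ha0 : ∀ᵐ t ∂(timeMeasure T), 0 ≤ a t)
    (hY0 : ∀ᵐ t ∂(timeMeasure T), 0 ≤ Y t)
    (h : ∀ᵐ τ ∂(timeMeasure T), Y τ ≤ ∫ t in Ioo 0 τ, a t * Y t) :
    ∀ᵐ t ∂(timeMeasure T), Y t = 0 := by
  -- Extension by zero makes both primitives continuous on the whole line.
  set f : ℝ → ℝ := (Ioo 0 T).indicator a with hf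
  set F : ℝ → ℝ := (Ioo 0 T).indicator (fun t => a t * Y t) with hF
  have hfi : Integrable f := (integrable_indicator_iff measurableSet_Ioo).2 ha
  have hFi : Integrable F := (integrable_indicator_iff measurableSet_Ioo).2 haY
  set Z : ℝ → ℝ := fun τ => ∫ t in (0 : ℝ)..τ, F t with hZ
  set A : ℝ → ℝ := fun τ => ∫ t in (0 : ℝ)..τ, f t with hA
  have hZc : Continuous Z :=
    intervalIntegral.continuous_primitive (fun _ _ => hFi.intervalIntegrable) 0
  have hAc : Continuous A :=
    intervalIntegral.continuous_primitive (fun _ _ => hfi.intervalIntegrable) 0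
  rw [ae_restrict_iff' measurableSet_Ioo] at ha0 hY0 h
  have hf0 : ∀ᵐ t, 0 ≤ f t := by
    filter_upwards [ha0] with t h1
    by_cases ht : t ∈ Ioo 0 T
    · rw [hf, indicator_of_mem ht]; exact h1 ht
    · rw [hf, indicator_of_notMem ht]
  have hF0 : ∀ᵐ t, 0 ≤ F t := by
    filter_upwards [ha0, hY0] with t h1 h2
    by_cases ht : t ∈ Ioo 0 T
    · rw [hF, indicator_of_mem ht]; exact mul_nonneg (h1 ht) (h2 ht)
    · rw [hF, indicator_of_notMem ht]
  have hZsub : ∀ x y, Z y - Z x = ∫ t in x..y, F t := fun x y =>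
    intervalIntegral.integral_interval_sub_left hFi.intervalIntegrable hFi.intervalIntegrable
  have hAsub : ∀ x y, A y - A x = ∫ t in x..y, f t := fun x y =>
    intervalIntegral.integral_interval_sub_left hfi.intervalIntegrable hfi.intervalIntegrable
  have hZmono : Monotone Z := fun x y hxy => by
    rw [← sub_nonneg, hZsub]
    exact intervalIntegral.integral_nonneg_of_ae hxy hF0
  have hYZ : ∀ᵐ t, t ∈ Ioo 0 T → Y t ≤ Z t := by
    filter_upwards [h] with t ht htT
    refine (ht htT).trans (le_of_eq ?_)
    rw [hZ]
    simp only
    rw [intervalIntegral.integral_of_le htT.1.le, integral_Ioc_eq_integral_Ioo]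
    refine setIntegral_congr_fun measurableSet_Ioo fun s hs => ?_
    rw [hF, indicator_of_mem (show s ∈ Ioo 0 T from ⟨hs.1, hs.2.trans htT.2⟩)]
  have hFf : ∀ τ, ∀ᵐ t, t ≤ τ → F t ≤ Z τ * f t := by
    intro τ
    filter_upwards [hYZ, ha0] with t h1 h2 htτ
    by_cases ht : t ∈ Ioo 0 T
    · rw [hF, hf, indicator_of_mem ht, indicator_of_mem ht, mul_comm]
      exact mul_le_mul_of_nonneg_right ((h1 ht).trans (hZmono htτ)) (h2 ht)
    · rw [hF, hf, indicator_of_notMem ht, indicator_of_notMem ht, mul_zero]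
  have hsub : Icc 0 T ⊆ {τ | Z τ ≤ 0} := by
    refine IsClosed.Icc_subset_of_forall_exists_gt
      ((isClosed_le hZc continuous_const).inter isClosed_Icc) (by simp [hZ]) ?_
    rintro x ⟨hx, hxT⟩ y hy
    have h1 : ∀ᶠ τ in 𝓝[>] x, A τ - A x < 1 :=
      ((hAc.sub continuous_const).tendsto' x 0 (sub_self _)).eventually (gt_mem_nhds one_pos)
        |>.filter_mono nhdsWithin_le_nhds
    obtain ⟨τ, hτ1, hτ2⟩ := (h1.and (Ioc_mem_nhdsGT hy)).exists
    refine ⟨τ, ?_, hτ2⟩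
    -- On (x, τ], aY ≤ aZ ≤ a Z(τ). With Z(x) ≤ 0 and A(τ) − A(x) < 1 this forces Z(τ) ≤ 0.
    have h2 : Z τ - Z x ≤ Z τ * (A τ - A x) := by
      rw [hZsub, hAsub, ← intervalIntegral.integral_const_mul,
        intervalIntegral.integral_of_le hτ2.1.le, intervalIntegral.integral_of_le hτ2.1.le]
      refine setIntegral_mono_on_ae hFi.integrableOn (hfi.const_mul _).integrableOn
        measurableSet_Ioc ?_
      filter_upwards [hFf τ] with t ht htx using ht htx.2
    have hx' : Z x ≤ 0 := hx
    change Z τ ≤ 0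
    nlinarith
  rw [ae_restrict_iff' measurableSet_Ioo]
  filter_upwards [hYZ, hY0] with t h1 h2 ht
  exact le_antisymm ((h1 ht).trans (hsub (Ioo_subset_Icc_self ht))) (h2 ht)

/-- The dissipation estimate is available on (0,τ) for almost every τ < T, but not at τ = T.
Admissible τ accumulate at T, and countably many of these intervals exhaust (0,T). -/
lemma ae_timeMeasure_of_ae_ae {P : ℝ → Prop}
    (h : ∀ᵐ τ ∂(timeMeasure T), ∀ᵐ t ∂(timeMeasure τ), P t) : ∀ᵐ t ∂(timeMeasure T), P t := by
  rcases le_or_gt T 0 with hT | hT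
  · simp [timeMeasure, Ioo_eq_empty_of_le hT]
  obtain ⟨u, -, hu, hlim⟩ := exists_seq_strictMono_tendsto' hT
  have hex : ∀ n, ∃ τ, u n < τ ∧ ∀ᵐ t ∂(timeMeasure τ), P t := by
    intro n
    have h1 : timeMeasure (u n) ≤ timeMeasure T := timeMeasure_mono (hu n).2.le
    have h2 : ∀ᵐ τ ∂(volume.restrict (Ioo (u n) T)), ∀ᵐ t ∂(timeMeasure τ), P t :=
      ae_mono (Measure.restrict_mono (Ioo_subset_Ioo_left (hu n).1.le) le_rfl) h
    have h3 : (ae (volume.restrict (Ioo (u n) T))).NeBot := by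
      rw [ae_neBot, Ne, Measure.restrict_eq_zero, Real.volume_Ioo]
      simpa using (hu n).2
    obtain ⟨τ, h4, h5⟩ := (h2.and (ae_restrict_mem measurableSet_Ioo)).exists
    exact ⟨τ, h5.1, h4⟩
  have hU : Ioo 0 T ⊆ ⋃ n, Ioo 0 (u n) := fun t ht => by
    obtain ⟨n, hn⟩ := (hlim.eventually (lt_mem_nhds ht.2)).exists
    exact mem_iUnion.2 ⟨n, ht.1, hn⟩
  refine ae_restrict_of_ae_restrict_of_subset hU ?_
  rw [ae_restrict_iUnion_iff]
  intro n
  obtain ⟨τ, h1, h2⟩ := hex n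
  exact ae_mono (timeMeasure_mono h1.le) h2

end Gronwall

/-! ### Bounds for the test function of the momentum equation -/

section Bounds

variable {d : ℕ} {T : ℝ}

/-- The test function will be the fixed field w, so its norms enter the defect estimate only through
one constant, uniform in τ. -/
lemma exists_normC1_bound {φ : ℝ → Torus d → Vec d} (hφ : ∀ i, IsC1 T (fun t x => φ t x i)) :
    ∃ N, 0 ≤ N ∧ (∀ t ∈ Icc 0 T, normC1 (φ t) ≤ N) ∧
      ∀ τ ∈ Icc 0 T, normC1T T τ φ ≤ N := by
  choose a ha0 ha using fun i => (hφ i).contCyl.exists_bound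
  choose b hb0 hb using fun i => (hφ i).contCyl_dt.exists_bound
  choose c hc0 hc using fun i j => ((hφ i).contCyl_pd j).exists_bound
  refine ⟨∑ i, (a i + b i + ∑ j, c i j), Finset.sum_nonneg fun i _ => add_nonneg
    (add_nonneg (ha0 i) (hb0 i)) (Finset.sum_nonneg fun j _ => hc0 i j), fun t ht => ?_,
    fun τ hτ => ?_⟩
  · refine Finset.sum_le_sum fun i _ => add_le_add ?_ (Finset.sum_le_sum fun j _ => ?_)
    · exact (Real.iSup_le (fun x => ha i t ht x) (ha0 i)).trans (by linarith [hb0 i])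
    · exact Real.iSup_le (fun x => hc i j t ht x) (hc0 i j)
  · have hm : ∀ z : Icc (0 : ℝ) τ × Torus d, (z.1 : ℝ) ∈ Icc 0 T := fun z =>
      ⟨z.1.2.1, z.1.2.2.trans hτ.2⟩
    refine Finset.sum_le_sum fun i _ => add_le_add (add_le_add ?_ ?_)
      (Finset.sum_le_sum fun j _ => ?_)
    · exact Real.iSup_le (fun z => ha i _ (hm z) z.2) (ha0 i)
    · exact Real.iSup_le (fun z => hb i _ (hm z) z.2) (hb0 i)
    · exact Real.iSup_le (fun z => hc i j _ (hm z) z.2) (hc0 i j)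

end Bounds

/-! ### The relative energy inequality -/

section RelativeEnergy

variable {d : ℕ} {γ T : ℝ} {V₀ : InitialYoungMeasure d} {V : YoungMeasure d} [IsMarkovKernel V]
  {D : ℝ → ℝ} {ρ : ℝ → Torus d → ℝ} {w : ℝ → Torus d → Vec d}

lemma integrable_integral_compProd {μ : Measure ℝ} [SFinite μ] {S : Type*} [MeasurableSpace S]
    {K : Kernel ℝ S} [IsSFiniteKernel K] {f : ℝ × S → ℝ} (hf : Integrable f (μ ⊗ₘ K)) :
    Integrable (fun t => ∫ q, f (t, q) ∂(K t)) μ := by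
  have := Integrable.integral_compProd (κ := Kernel.const Unit μ) (η := Kernel.prodMkLeft Unit K)
    (a := ()) hf
  simpa using this

/-- The relative energy at time `t`. -/
noncomputable def totalRelEnergy (γ : ℝ) (V : YoungMeasure d) (ρ : ℝ → Torus d → ℝ)
    (w : ℝ → Torus d → Vec d) (t : ℝ) : ℝ :=
  ∫ q, relEnergy γ (ρ t q.1) (w t q.1) q.2 ∂(sliceKernel V t)

/-- The relative dissipation at time `t`. -/
noncomputable def totalRelDissipation (γ : ℝ) (V : YoungMeasure d) (ρ : ℝ → Torus d → ℝ)
    (t : ℝ) : ℝ :=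
  ∫ q, relDissipation (fun j => pd j (cost γ ρ t) q.1) q.2 ∂(sliceKernel V t)

namespace IsStrongSolution

variable (hs : IsStrongSolution d γ T ρ w)
include hs

lemma integrable_relEnergy (hT : 0 < T) (hγ : 1 ≤ γ)
    (h : FiniteMoments γ (timeMeasure T ⊗ₘ sliceKernel V) (fun z => z.2.2)) :
    Integrable (fun z => relEnergy γ (ρ z.1 z.2.1) (w z.1 z.2.1) z.2.2)
      (timeMeasure T ⊗ₘ sliceKernel V) := by
  refine h.integrable_relEnergy hγ (r := fun z => ρ z.1 z.2.1) (w := fun i z => w z.1 z.2.1 i)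
    ?_ (fun i => bddCoef_spaceTime (hs.isC1_velocity i).contCyl)
    (bddCoef_spaceTime (c := testFn γ ρ w) (hs.isC1_testFn hT).1.contCyl)
    (bddCoef_spaceTime (hs.isC1_E hT hγ).contCyl)
  filter_upwards [ae_mem_timeMeasure_compProd] with z hz using
    hs.pos _ (Ioo_subset_Icc_self hz) _

lemma integrable_relDissipation (hT : 0 < T) (hγ : 1 ≤ γ)
    (h : FiniteMoments γ (timeMeasure T ⊗ₘ sliceKernel V) (fun z => z.2.2)) :
    Integrable (fun z => relDissipation (fun j => pd j (cost γ ρ z.1) z.2.1) z.2.2)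
      (timeMeasure T ⊗ₘ sliceKernel V) :=
  have hc := fun j => (hs.isC1_cost hT).contCyl_pd j
  h.integrable_relDissipation hγ (P := fun j z => pd j (cost γ ρ z.1) z.2.1)
    (fun j => bddCoef_spaceTime (hc j))
    (fun j => bddCoef_spaceTime (c := fun t x => pd j (cost γ ρ t) x * pd j (cost γ ρ t) x)
      ((hc j).mul (hc j)))

/-- The relative energy vanishes initially. -/
lemma initial_relEnergy (hT : 0 < T) (hγ : 1 ≤ γ)
    (h₀ : ∀ᵐ x : Torus d, V₀ x = Measure.dirac ((ρ 0 x).toNNReal, √(ρ 0 x) • w 0 x)) :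
    (∫ x, ∫ y, (1 / 2 * ‖y.2‖ ^ 2 + E γ y.1) ∂(V₀ x))
      - (∫ x, ∑ i, (∫ y, √(y.1 : ℝ) * y.2 i ∂(V₀ x)) * w 0 x i)
      + (∫ x, (∫ y, (y.1 : ℝ) ∂(V₀ x)) * testFn γ ρ w 0 x) + ∫ x, γ * E γ (ρ 0 x) = 0 := by
  have h0 : (0 : ℝ) ∈ Icc 0 T := ⟨le_rfl, hT.le⟩
  have hρ := hs.isC1_density.contCyl.continuous h0
  have hw := fun i => (hs.isC1_velocity i).contCyl.continuous h0
  have hψ := (hs.isC1_testFn hT).1.contCyl.continuous h0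
  have hE := (hs.isC1_E hT hγ).contCyl.continuous h0
  have hci : ∀ {c : Torus d → ℝ}, Continuous c → Integrable c := fun hc =>
    hc.integrable_of_hasCompactSupport (HasCompactSupport.of_compactSpace _)
  have hE' : Continuous fun x => E γ (ρ 0 x) := by
    have : (fun x => E γ (ρ 0 x)) = fun x => 1 / γ * (γ * E γ (ρ 0 x)) := by
      funext x
      field_simp
    rw [this]
    exact hE.const_mul _
  have hw' : Continuous fun x => w 0 x :=
    (PiLp.continuous_toLp 2 _).comp (continuous_pi hw)
  have e1 : ∫ x, ∫ y, (1 / 2 * ‖y.2‖ ^ 2 + E γ y.1) ∂(V₀ x)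
      = ∫ x, (1 / 2 * ‖√(ρ 0 x) • w 0 x‖ ^ 2 + E γ (ρ 0 x)) := by
    refine integral_congr_ae ?_
    filter_upwards [h₀] with x hx
    rw [hx, integral_dirac]
    simp only [Real.coe_toNNReal _ (hs.pos 0 h0 x).le]
  have e2 : ∫ x, ∑ i, (∫ y, √(y.1 : ℝ) * y.2 i ∂(V₀ x)) * w 0 x i
      = ∫ x, ∑ i, √(ρ 0 x) * (√(ρ 0 x) * w 0 x i) * w 0 x i := by
    refine integral_congr_ae ?_
    filter_upwards [h₀] with x hx
    refine Finset.sum_congr rfl fun i _ => ?_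
    rw [hx, integral_dirac]
    simp [Real.coe_toNNReal _ (hs.pos 0 h0 x).le]
  have e3 : ∫ x, (∫ y, (y.1 : ℝ) ∂(V₀ x)) * testFn γ ρ w 0 x
      = ∫ x, ρ 0 x * testFn γ ρ w 0 x := by
    refine integral_congr_ae ?_
    filter_upwards [h₀] with x hx
    rw [hx, integral_dirac]
    simp only [Real.coe_toNNReal _ (hs.pos 0 h0 x).le]
  have i1 : Integrable fun x => 1 / 2 * ‖√(ρ 0 x) • w 0 x‖ ^ 2 + E γ (ρ 0 x) :=
    hci (((((hρ.sqrt).smul hw').norm.pow 2).const_mul _).add hE')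
  have i2 : Integrable fun x => ∑ i, √(ρ 0 x) * (√(ρ 0 x) * w 0 x i) * w 0 x i :=
    hci (continuous_finsetSum _ fun i _ => ((hρ.sqrt).mul ((hρ.sqrt).mul (hw i))).mul (hw i))
  have i3 : Integrable fun x => ρ 0 x * testFn γ ρ w 0 x := hci (hρ.mul hψ)
  have j1 := integrable_fun_sub i1 i2
  have j2 := j1.fun_add i3
  rw [e1, e2, e3, ← integral_sub i1 i2, ← integral_add j1 i3, ← integral_add j2 (hci hE)]
  refine integral_eq_zero_of_ae (Eventually.of_forall fun x => ?_)
  have hpos := hs.pos 0 h0 x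
  -- The relative energy does not see the third phase variable, so it is filled with 0.
  have h1 := relEnergy_eq hγ hpos (w 0 x) ((ρ 0 x).toNNReal, √(ρ 0 x) • w 0 x, 0)
  simp only [relEnergy, Real.coe_toNNReal _ hpos.le, relE_self, PiLp.smul_apply, smul_eq_mul,
    sub_self, ne_eq, OfNat.ofNat_ne_zero, not_false_eq_true, zero_pow, Finset.sum_const_zero,
    mul_zero, add_zero] at h1
  simp only [testFn, cost, Pi.zero_apply]
  linarith

/-- The relative energy at a good time in terms of the quantities in the balance laws. -/
lemma totalRelEnergy_eq (hT : 0 < T) (hγ : 1 ≤ γ) {τ : ℝ} (hτ : τ ∈ Icc 0 T)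
    (h : GoodTime γ V τ) :
    totalRelEnergy γ V ρ w τ = (∫ x, av V (fun y => 1 / 2 * ‖y.2.1‖ ^ 2 + E γ y.1) τ x)
      - (∫ x, √(dens V τ x) * ∑ i, avW V τ x i * w τ x i)
      + (∫ x, dens V τ x * testFn γ ρ w τ x) + ∫ x, γ * E γ (ρ τ x) := by
  have hw := fun i => (hs.isC1_velocity i).contCyl.continuous hτ
  have hψ := (hs.isC1_testFn hT).1.contCyl.continuous hτ
  have hE := (hs.isC1_E hT hγ).contCyl.continuous hτ
  -- The pairings at the single time τ are instances of the slice formulas with the gradient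
  -- coefficients set to zero.
  have e2 := h.integral_momentum hγ hw (b := fun _ _ _ => 0) fun _ _ => continuous_const
  have e3 := h.integral_continuity hγ hψ (b := fun _ _ => 0) fun _ => continuous_const
  have i2 := h.moments.integrable_momentumFn hγ (b := fun _ _ _ => 0)
    (fun i => bddCoef_slice (hw i)) fun _ _ => bddCoef_const 0
  have i3 := h.moments.integrable_continuityFn hγ (b := fun _ _ => 0)
    (bddCoef_slice hψ) fun _ => bddCoef_const 0
  simp only [mul_zero, Finset.sum_const_zero, add_zero, sub_zero] at e2 e3
  have i1 : Integrable (fun q : Torus d × Phase d => 1 / 2 * ‖q.2.2.1‖ ^ 2 + E γ q.2.1)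
      (sliceKernel V τ) := (h.moments.intW.const_mul _).add (h.moments.integrable_E hγ)
  obtain ⟨i4, e4⟩ := integral_slice_fst (V := V) (t := τ) hE
  have e1 : ∫ x, av V (fun y => 1 / 2 * ‖y.2.1‖ ^ 2 + E γ y.1) τ x
      = ∫ q, (1 / 2 * ‖q.2.2.1‖ ^ 2 + E γ q.2.1) ∂(sliceKernel V τ) := (integral_slice i1).symm
  have j1 := integrable_fun_sub i1 i2
  have j2 := j1.fun_add i3
  rw [e1, e2, e3, ← e4, ← integral_sub i1 i2, ← integral_add j1 i3, ← integral_add j2 i4]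
  refine integral_congr_ae (Eventually.of_forall fun q => ?_)
  simp only
  rw [relEnergy_eq hγ (hs.pos τ hτ _)]
  simp [momentumFn, continuityFn, testFn, cost]

/-- The relative energy inequality. -/
lemma relative_energy_inequality (hT : 0 < T) (hγ : 1 ≤ γ)
    (hV : IsMeasureValuedSolution d γ T V₀ V D)
    (h₀ : ∀ᵐ x : Torus d, V₀ x = Measure.dirac ((ρ 0 x).toNNReal, √(ρ 0 x) • w 0 x))
    {L N : ℝ} (hL : ∀ t ∈ Icc 0 T, ∀ x i j, |pd j (fun x => w t x i) x| ≤ L)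
    (hN : ∀ t ∈ Icc 0 T, ∀ x, |divVel γ T ρ w t x| ≤ N) {R : DefectMeasure d T}
    {r : Fin d → Fin d → DefectMeasure d T} {τ : ℝ} (hτ : τ ∈ Ioo 0 T) (hg : GoodTime γ V τ)
    (hc : ContinuityEq T V₀ V τ (testFn γ ρ w)) (hm : MomentumEq T V₀ V r τ w)
    (he : EnergyIneq γ T V₀ V D R τ) :
    totalRelEnergy γ V ρ w τ + D τ + 1 / 2 * (∫ t in Ioo 0 τ, totalRelDissipation γ V ρ t)
      ≤ (2 * (1 + L * d + L ^ 2 * d ^ 2) + γ * N) * (∫ t in Ioo 0 τ, totalRelEnergy γ V ρ w t)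
        + R.pair (Ioo 0 τ) (fun _ _ => 1)
        - ∑ i, ∑ j, (r i j).pair (Icc 0 τ) (fun t x => pd j (fun y => w t y i) x) := by
  have hτ' := Ioo_subset_Icc_self hτ
  have hfm := finiteMoments_spaceTime hγ hV
  have hle := timeMeasure_mono (T := T) hτ.2.le
  have hgood : ∀ᵐ t ∂(timeMeasure τ), GoodTime γ V t ∧ t ∈ Ioo 0 T := by
    filter_upwards [ae_mono hle (hV.ae_goodTime hγ), ae_restrict_mem measurableSet_Ioo]
      with t h1 h2 using ⟨h1, h2.1, h2.2.trans hτ.2⟩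
  obtain ⟨hψ, -, -⟩ := hs.isC1_testFn hT
  have iP := (integrable_integral_compProd hfm.integrable_powerFn).mono_measure hle
  have iF := (integrable_integral_compProd hfm.intF).mono_measure hle
  have iM := (integrable_integral_compProd (hfm.integrable_momentumFn hγ
    (fun i => bddCoef_spaceTime (hs.isC1_velocity i).contCyl_dt)
    (fun i j => bddCoef_spaceTime ((hs.isC1_velocity i).contCyl_pd j)))).mono_measure hle
  have iC := (integrable_integral_compProd (hfm.integrable_continuityFn hγ
    (bddCoef_spaceTime hψ.contCyl_dt) (fun j => bddCoef_spaceTime (hψ.contCyl_pd j)))).mono_measure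
    hle
  have iE := (integrable_integral_compProd (hs.integrable_relEnergy hT hγ hfm)).mono_measure hle
  have iB := (integrable_integral_compProd
    (hs.integrable_relDissipation hT hγ hfm)).mono_measure hle
  have iX : Integrable (fun t => ∫ x, dt T (fun t x => γ * E γ (ρ t x)) t x) (timeMeasure τ) := by
    have h1 := integrable_integral_compProd (f := fun z => dt T (fun t x => γ * E γ (ρ t x)) z.1 z.2.1)
      (K := sliceKernel V) (μ := timeMeasure T) (by
        obtain ⟨h1, C, hC⟩ := bddCoef_spaceTime (V := V) (hs.isC1_E hT hγ).contCyl_dt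
        exact Integrable.of_bound h1 C hC)
    refine (h1.mono_measure hle).congr ?_
    filter_upwards [hgood] with t ht
    exact (integral_slice_fst ((hs.isC1_E hT hγ).contCyl_dt.continuous
      (Ioo_subset_Icc_self ht.2))).2
  have eX := integral_dt (hs.isC1_E hT hγ).time hτ'
  have eC : ∫ t in Ioo 0 τ, ∫ x, (dens V t x * dt T (testFn γ ρ w) t x
      + √(dens V t x) * ∑ j, avW V t x j * pd j (testFn γ ρ w t) x
      - √(dens V t x) * ∑ j, avD V t x j * pd j (testFn γ ρ w t) x)
      = ∫ t in Ioo 0 τ, ∫ q, continuityFn (dt T (testFn γ ρ w) t q.1)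
          (fun j => pd j (testFn γ ρ w t) q.1) q.2 ∂(sliceKernel V t) := by
    refine integral_congr_ae ?_
    filter_upwards [hgood] with t ht
    have ht' := Ioo_subset_Icc_self ht.2
    exact ht.1.integral_continuity hγ (hψ.contCyl_dt.continuous ht')
      fun j => (hψ.contCyl_pd j).continuous ht'
  have eM : (∫ t in Ioo 0 τ, ∫ x,
        (√(dens V t x) * ∑ i, avW V t x i * dt T (fun s y => w s y i) t x
          + ∑ i, ∑ j, av V (fun y => y.2.1 i * y.2.1 j) t x * pd j (fun y => w t y i) x
          - ∑ i, ∑ j, av V (fun y => y.2.1 i * y.2.2 j) t x * pd j (fun y => w t y i) x))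
      = ∫ t in Ioo 0 τ, ∫ q, momentumFn (fun i => dt T (fun t x => w t x i) t q.1)
          (fun i j => pd j (fun x => w t x i) q.1) q.2 ∂(sliceKernel V t) := by
    refine integral_congr_ae ?_
    filter_upwards [hgood] with t ht
    have ht' := Ioo_subset_Icc_self ht.2
    exact ht.1.integral_momentum hγ (fun i => (hs.isC1_velocity i).contCyl_dt.continuous ht')
      fun i j => ((hs.isC1_velocity i).contCyl_pd j).continuous ht'
  have eF : ∫ t in Ioo 0 τ, ∫ x, av V (fun y => ‖y.2.2‖ ^ 2) t x
      = ∫ t in Ioo 0 τ, ∫ q, ‖q.2.2.2‖ ^ 2 ∂(sliceKernel V t) := by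
    refine integral_congr_ae ?_
    filter_upwards [hgood] with t ht
    exact (integral_slice ht.1.moments.intF).symm
  -- The power W·F is split as `powerFn` plus |F|², so that the last term cancels the dissipation in
  -- the energy inequality.
  have eP : ∫ t in Ioo 0 τ, ∫ x, av V (fun y => inner ℝ y.2.1 y.2.2) t x
      = (∫ t in Ioo 0 τ, ∫ q, powerFn q.2 ∂(sliceKernel V t))
        + ∫ t in Ioo 0 τ, ∫ q, ‖q.2.2.2‖ ^ 2 ∂(sliceKernel V t) := by
    rw [← integral_add iP iF]
    refine integral_congr_ae ?_
    filter_upwards [hgood] with t ht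
    have hp := ht.1.moments.integrable_powerFn
    have hf := ht.1.moments.intF
    have hi : ∀ q : Torus d × Phase d, powerFn q.2 + ‖q.2.2.2‖ ^ 2 = inner ℝ q.2.2.1 q.2.2.2 :=
      fun q => sub_add_cancel _ _
    have hpf := hp.fun_add hf
    rw [← integral_add hp hf]
    simp only [hi] at hpf ⊢
    exact (integral_slice hpf).symm
  have eI := hs.initial_relEnergy hT hγ h₀
  have eT := hs.totalRelEnergy_eq hT hγ hτ' hg
  rw [EnergyIneq, eF, eP] at he
  rw [MomentumEq, eM] at hm
  rw [ContinuityEq, eC] at hc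
  have j1 := integrable_fun_sub iP iM
  have j2 := j1.fun_add iC
  have j3 := j2.fun_add iX
  have hbal : ((((∫ t in Ioo 0 τ, ∫ q, powerFn q.2 ∂(sliceKernel V t))
      - ∫ t in Ioo 0 τ, ∫ q, momentumFn (fun i => dt T (fun t x => w t x i) t q.1)
          (fun i j => pd j (fun x => w t x i) q.1) q.2 ∂(sliceKernel V t))
      + ∫ t in Ioo 0 τ, ∫ q, continuityFn (dt T (testFn γ ρ w) t q.1)
          (fun j => pd j (testFn γ ρ w t) q.1) q.2 ∂(sliceKernel V t))
      + ∫ t in Ioo 0 τ, ∫ x, dt T (fun t x => γ * E γ (ρ t x)) t x)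
      ≤ (2 * (1 + L * d + L ^ 2 * d ^ 2) + γ * N) * (∫ t in Ioo 0 τ, totalRelEnergy γ V ρ w t)
        - 1 / 2 * ∫ t in Ioo 0 τ, totalRelDissipation γ V ρ t := by
    rw [← integral_sub iP iM, ← integral_add j1 iC, ← integral_add j2 iX, ← integral_const_mul,
      ← integral_const_mul]
    refine (integral_mono_ae j3 (integrable_fun_sub (iE.const_mul _) (iB.const_mul _)) ?_).trans_eq
      (integral_sub (iE.const_mul _) (iB.const_mul _))
    filter_upwards [hgood] with t ht
    exact hs.balance_le hT hγ hL hN ht.2 ht.1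
  -- Energy inequality, minus the momentum equation, plus the continuity equation, plus the time
  -- integral of ∂_t(γE(ρ̄)); the initial terms sum to zero. The momentum defect therefore enters
  -- with a minus sign.
  linarith

end IsStrongSolution

end RelativeEnergy

/-! ### Weak-strong uniqueness -/

section Uniqueness

variable {d : ℕ} {γ T : ℝ} {V₀ : InitialYoungMeasure d} {V : YoungMeasure d} [IsMarkovKernel V]
  {D : ℝ → ℝ} {ρ : ℝ → Torus d → ℝ} {w : ℝ → Torus d → Vec d}

lemma eq_dirac_of_ae_eq {X : Type*} [MeasurableSpace X] {ν : Measure X} [IsProbabilityMeasure ν]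
    {a : X} (h : ∀ᵐ y ∂ν, y = a) : ν = Measure.dirac a := by
  have h1 : ν.map id = ν.map (fun _ => a) := Measure.map_congr h
  rw [Measure.map_id, Measure.map_const] at h1
  simpa using h1

/-- No sign is imposed on `ξ`, so the Grönwall weight has to be built from |ξ|. -/
lemma abs_setIntegral_mul_le {ξ f : ℝ → ℝ} {N τ : ℝ}
    (hξ : Integrable (fun t => |ξ t| * D t) (timeMeasure τ)) (hD : ∀ᵐ t ∂(timeMeasure τ), 0 ≤ D t)
    (hf0 : ∀ t, 0 ≤ f t) (hf : ∀ᵐ t ∂(timeMeasure τ), f t ≤ N) :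
    ∫ t in Ioo 0 τ, ξ t * D t * f t ≤ N * ∫ t in Ioo 0 τ, |ξ t| * D t := by
  rw [← integral_const_mul]
  refine (Real.le_norm_self _).trans (norm_integral_le_of_norm_le (hξ.const_mul N) ?_)
  filter_upwards [hD, hf] with t h1 h2
  rw [norm_mul, norm_mul, Real.norm_eq_abs, Real.norm_of_nonneg h1, Real.norm_of_nonneg (hf0 t),
    mul_comm]
  gcongr

lemma normC1_nonneg (φ : Torus d → Vec d) : 0 ≤ normC1 φ :=
  Finset.sum_nonneg fun _ _ => add_nonneg (Real.iSup_nonneg fun _ => abs_nonneg _)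
    (Finset.sum_nonneg fun _ _ => Real.iSup_nonneg fun _ => abs_nonneg _)

/-- The relative energy inequality, with the defect measures estimated by the dissipation defect. -/
lemma IsStrongSolution.exists_gronwall_bound (hs : IsStrongSolution d γ T ρ w) (hT : 0 < T)
    (hγ : 1 ≤ γ) (hV : IsMeasureValuedSolution d γ T V₀ V D)
    (h₀ : ∀ᵐ x : Torus d, V₀ x = Measure.dirac ((ρ 0 x).toNNReal, √(ρ 0 x) • w 0 x)) :
    ∃ (K : ℝ) (m : ℝ → ℝ), 0 ≤ K ∧ (∀ t, 0 ≤ m t) ∧ Integrable m (timeMeasure T) ∧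
      Integrable (fun t => m t * D t) (timeMeasure T) ∧
      ∀ᵐ τ ∂(timeMeasure T), totalRelEnergy γ V ρ w τ + 1 / 2 * D τ
          + 1 / 2 * (∫ t in Ioo 0 τ, totalRelDissipation γ V ρ t)
        ≤ ∫ t in Ioo 0 τ, (K * totalRelEnergy γ V ρ w t + m t * D t) := by
  obtain ⟨L, N, hL0, hN0, hL, hN⟩ := hs.exists_bounds hT
  obtain ⟨N₁, hN₁, hb1, hb2⟩ := exists_normC1_bound hs.isC1_velocity
  obtain ⟨r, ξ, hξ, hmom⟩ := hV.momentum
  obtain ⟨R, C, hen⟩ := hV.energy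
  have hfm := finiteMoments_spaceTime hγ hV
  have iE : Integrable (totalRelEnergy γ V ρ w) (timeMeasure T) :=
    integrable_integral_compProd (hs.integrable_relEnergy hT hγ hfm)
  have iD : Integrable D (timeMeasure T) := hV.defect_bounded.integrable le_top
  have iξD : Integrable (fun t => |ξ t| * D t) (timeMeasure T) :=
    Integrable.mul_of_top_left hξ.abs hV.defect_bounded
  -- The momentum defect costs εN₁D(τ) and the energy defect εD(τ); this ε makes their sum D(τ)/2,
  -- which the left-hand side absorbs.
  set ε : ℝ := 1 / (2 * (1 + N₁)) with hε
  have hε0 : 0 < ε := by positivity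
  set κ : ℝ := 1 + 1 / (4 * ε) with hκ
  have hκ0 : 0 ≤ κ := by positivity
  set m : ℝ → ℝ := fun t => κ * (N₁ * |ξ t| + |C|) with hm
  have imD : Integrable (fun t => m t * D t) (timeMeasure T) := by
    have : (fun t => m t * D t) = fun t => κ * (N₁ * (|ξ t| * D t) + |C| * D t) := by
      funext t; simp only [hm]; ring
    rw [this]
    exact ((iξD.const_mul _).add (iD.const_mul _)).const_mul _
  have hγ0 : 0 ≤ γ := by linarith
  refine ⟨2 * (1 + L * d + L ^ 2 * d ^ 2) + γ * N, m, by positivity, fun t => by positivity,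
    ((hξ.abs.const_mul _).add (integrable_const _)).const_mul _, imD, ?_⟩
  filter_upwards [ae_restrict_mem measurableSet_Ioo, hV.ae_goodTime hγ, hV.continuity, hmom, hen,
    hV.defect_nonneg] with τ hτ hg hc h1 h2 hDτ
  have hτ' := Ioo_subset_Icc_self hτ
  have hle := timeMeasure_mono (T := T) hτ.2.le
  obtain ⟨hm1, hm2⟩ := h1 ε hε0 w hs.isC1_velocity
  obtain ⟨he1, he2⟩ := h2 ε hε0
  have hD0 := ae_mono hle hV.defect_nonneg
  have hmain := hs.relative_energy_inequality hT hγ hV h₀ hL hN hτ hg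
    (hc _ (hs.isC1_testFn hT).1) hm1 he1
  have hξb := abs_setIntegral_mul_le (f := fun t => normC1 (w t)) (N := N₁)
    (iξD.mono_measure hle) hD0 (fun t => normC1_nonneg _) (by
      filter_upwards [ae_restrict_mem measurableSet_Ioo] with t ht
      exact hb1 t ⟨ht.1.le, ht.2.le.trans hτ.2.le⟩)
  have hDint : 0 ≤ ∫ t in Ioo 0 τ, D t := integral_nonneg_of_ae hD0
  have hr := (neg_le_abs _).trans hm2
  have hR := (le_abs_self _).trans he2
  have hnD : ε * normC1T T τ w * D τ ≤ ε * N₁ * D τ := by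
    gcongr
    exact hb2 τ hτ'
  have hεN : ε * N₁ + ε = 1 / 2 := by
    rw [hε]
    field_simp
    ring
  have hCD : C * κ * ∫ t in Ioo 0 τ, D t ≤ |C| * κ * ∫ t in Ioo 0 τ, D t := by
    gcongr
    exact le_abs_self C
  have hξκ := mul_le_mul_of_nonneg_left hξb hκ0
  have eint : ∫ t in Ioo 0 τ, ((2 * (1 + L * d + L ^ 2 * d ^ 2) + γ * N)
      * totalRelEnergy γ V ρ w t + m t * D t)
      = (2 * (1 + L * d + L ^ 2 * d ^ 2) + γ * N) * (∫ t in Ioo 0 τ, totalRelEnergy γ V ρ w t)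
        + κ * (N₁ * (∫ t in Ioo 0 τ, |ξ t| * D t) + |C| * ∫ t in Ioo 0 τ, D t) := by
    have hmD : ∀ t, m t * D t = κ * (N₁ * (|ξ t| * D t) + |C| * D t) := fun t => by
      simp only [hm]; ring
    simp only [hmD]
    have k1 := (iξD.mono_measure hle).const_mul N₁
    have k2 := (iD.mono_measure hle).const_mul |C|
    rw [integral_add ((iE.mono_measure hle).const_mul _) ((k1.fun_add k2).const_mul κ),
      integral_const_mul, integral_const_mul, integral_add k1 k2, integral_const_mul,
      integral_const_mul]
  rw [eint]
  have hεD : ε * N₁ * D τ + ε * D τ = 1 / 2 * D τ := by rw [← hεN]; ring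
  linarith

omit [IsMarkovKernel V] in
lemma IsStrongSolution.totalRelEnergy_nonneg (hs : IsStrongSolution d γ T ρ w) (hγ : 1 ≤ γ) {t : ℝ}
    (ht : t ∈ Icc 0 T) : 0 ≤ totalRelEnergy γ V ρ w t :=
  integral_nonneg fun _ => relEnergy_nonneg hγ (hs.pos t ht _) _ _

omit [IsMarkovKernel V] in
lemma totalRelDissipation_nonneg (t : ℝ) : 0 ≤ totalRelDissipation γ V ρ t :=
  integral_nonneg fun _ => relDissipation_nonneg _ _

/-- The relative energy, the dissipation defect and the relative dissipation vanish. -/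
lemma IsStrongSolution.ae_eq_zero (hs : IsStrongSolution d γ T ρ w) (hT : 0 < T)
    (hγ : 1 ≤ γ) (hV : IsMeasureValuedSolution d γ T V₀ V D)
    (h₀ : ∀ᵐ x : Torus d, V₀ x = Measure.dirac ((ρ 0 x).toNNReal, √(ρ 0 x) • w 0 x)) :
    ∀ᵐ t ∂(timeMeasure T), totalRelEnergy γ V ρ w t = 0 ∧ D t = 0 ∧
      totalRelDissipation γ V ρ t = 0 := by
  obtain ⟨K, m, hK, hm0, him, himD, hmain⟩ := hs.exists_gronwall_bound hT hγ hV h₀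
  have hfm := finiteMoments_spaceTime hγ hV
  have iE : Integrable (totalRelEnergy γ V ρ w) (timeMeasure T) :=
    integrable_integral_compProd (hs.integrable_relEnergy hT hγ hfm)
  have iB : Integrable (totalRelDissipation γ V ρ) (timeMeasure T) :=
    integrable_integral_compProd (hs.integrable_relDissipation hT hγ hfm)
  have iD : Integrable D (timeMeasure T) := hV.defect_bounded.integrable le_top
  have iH : Integrable (fun t => K * totalRelEnergy γ V ρ w t + m t * D t) (timeMeasure T) :=
    (iE.const_mul K).add himD
  have hE0 : ∀ᵐ t ∂(timeMeasure T), 0 ≤ totalRelEnergy γ V ρ w t := by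
    filter_upwards [ae_restrict_mem measurableSet_Ioo] with t ht using
      hs.totalRelEnergy_nonneg hγ (Ioo_subset_Icc_self ht)
  have hH0 : ∀ᵐ t ∂(timeMeasure T), 0 ≤ K * totalRelEnergy γ V ρ w t + m t * D t := by
    filter_upwards [hE0, hV.defect_nonneg] with t h1 h2
    exact add_nonneg (mul_nonneg hK h1) (mul_nonneg (hm0 t) h2)
  set Y : ℝ → ℝ := fun t => totalRelEnergy γ V ρ w t + 1 / 2 * D t with hY
  have iY : Integrable Y (timeMeasure T) := iE.add (iD.const_mul _)
  have hY0 : ∀ᵐ t ∂(timeMeasure T), 0 ≤ Y t := by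
    filter_upwards [hE0, hV.defect_nonneg] with t h1 h2
    simp only [hY]
    positivity
  have hB0 : ∀ τ, 0 ≤ ∫ t in Ioo 0 τ, totalRelDissipation γ V ρ t := fun τ =>
    integral_nonneg fun t => totalRelDissipation_nonneg t
  -- The right-hand side over all of (0,T) is finite and independent of τ. The essential bound on
  -- `Y` makes its product with the integrable weight `a` integrable, as Grönwall requires.
  have hYb : ∀ᵐ t ∂(timeMeasure T),
      ‖Y t‖ ≤ ∫ t in Ioo 0 T, (K * totalRelEnergy γ V ρ w t + m t * D t) := by
    filter_upwards [hmain, hY0, ae_restrict_mem measurableSet_Ioo] with τ h1 h2 hτ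
    rw [Real.norm_of_nonneg h2]
    have h3 : ∫ t in Ioo 0 τ, (K * totalRelEnergy γ V ρ w t + m t * D t)
        ≤ ∫ t in Ioo 0 T, (K * totalRelEnergy γ V ρ w t + m t * D t) :=
      integral_mono_measure (timeMeasure_mono hτ.2.le) hH0 iH
    have := hB0 τ
    simp only [hY]
    linarith
  -- The factor 2 compensates the ½ in front of D in `Y`, so that K·(relative energy) + mD ≤ aY.
  set a : ℝ → ℝ := fun t => K + 2 * m t with ha
  have ia : Integrable a (timeMeasure T) := (integrable_const K).add (him.const_mul 2)
  have iaY : Integrable (fun t => a t * Y t) (timeMeasure T) := ia.mul_bdd iY.1 hYb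
  have hmain' : ∀ᵐ τ ∂(timeMeasure T),
      Y τ + 1 / 2 * (∫ t in Ioo 0 τ, totalRelDissipation γ V ρ t)
        ≤ ∫ t in Ioo 0 τ, a t * Y t := by
    filter_upwards [hmain, ae_restrict_mem measurableSet_Ioo] with τ h1 hτ
    have hle := timeMeasure_mono (T := T) hτ.2.le
    refine h1.trans (integral_mono_ae (iH.mono_measure hle) (iaY.mono_measure hle) ?_)
    filter_upwards [ae_mono hle hE0, ae_mono hle hV.defect_nonneg] with t h2 h3
    simp only [ha, hY]
    nlinarith [mul_nonneg hK h3, mul_nonneg (hm0 t) h2]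
  have hYz := ae_eq_zero_of_le_integral_mul ia iaY
    (Eventually.of_forall fun t => by have := hm0 t; simp only [ha]; positivity) hY0 (by
      filter_upwards [hmain'] with τ h1
      linarith [hB0 τ])
  -- With Y = 0 the right-hand side vanishes, so the nonnegative relative dissipation has zero
  -- integral over (0,τ).
  have hBz : ∀ᵐ t ∂(timeMeasure T), totalRelDissipation γ V ρ t = 0 := by
    refine ae_timeMeasure_of_ae_ae ?_
    filter_upwards [hmain', hY0, ae_restrict_mem measurableSet_Ioo] with τ h1 h2 hτ
    have hle := timeMeasure_mono (T := T) hτ.2.le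
    have h3 : ∫ t in Ioo 0 τ, a t * Y t = 0 := by
      refine integral_eq_zero_of_ae ?_
      filter_upwards [ae_mono hle hYz] with t ht
      simp [ht]
    refine (integral_eq_zero_iff_of_nonneg (fun t => totalRelDissipation_nonneg t)
      (iB.mono_measure hle)).1 (le_antisymm ?_ (hB0 τ))
    linarith
  filter_upwards [hYz, hBz, hE0, hV.defect_nonneg] with t h1 h2 h3 h4
  simp only [hY] at h1
  exact ⟨by linarith, by linarith, h2⟩

/-- A measure-valued solution coincides with the strong solution with the same initial datum. -/
lemma IsStrongSolution.weak_strong_uniqueness (hs : IsStrongSolution d γ T ρ w) (hT : 0 < T)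
    (hγ : 1 ≤ γ) (hV : IsMeasureValuedSolution d γ T V₀ V D)
    (h₀ : ∀ᵐ x : Torus d, V₀ x = Measure.dirac ((ρ 0 x).toNNReal, √(ρ 0 x) • w 0 x)) :
    (∀ᵐ τ ∂(timeMeasure T), D τ = 0) ∧
    ∀ᵐ z ∂(cylMeasure d T),
      V z = Measure.dirac ((ρ z.1 z.2).toNNReal, √(ρ z.1 z.2) • w z.1 z.2,
        grad (fun y => Q γ (ρ z.1 y)) z.2) := by
  have hzero := hs.ae_eq_zero hT hγ hV h₀
  refine ⟨hzero.mono fun t ht => ht.2.1, ?_⟩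
  have hfm := finiteMoments_spaceTime hγ hV
  have iE := hs.integrable_relEnergy hT hγ hfm
  have iB := hs.integrable_relDissipation hT hγ hfm
  have hmem := ae_mem_timeMeasure_compProd (T := T) (K := sliceKernel V)
  have hE : ∀ᵐ z ∂(timeMeasure T ⊗ₘ sliceKernel V),
      relEnergy γ (ρ z.1 z.2.1) (w z.1 z.2.1) z.2.2 = 0 := by
    refine (integral_eq_zero_iff_of_nonneg_ae ?_ iE).1 ?_
    · filter_upwards [hmem] with z hz
      exact relEnergy_nonneg hγ (hs.pos _ (Ioo_subset_Icc_self hz) _) _ _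
    · rw [Measure.integral_compProd iE]
      exact integral_eq_zero_of_ae (hzero.mono fun t ht => ht.1)
  have hB : ∀ᵐ z ∂(timeMeasure T ⊗ₘ sliceKernel V),
      relDissipation (fun j => pd j (cost γ ρ z.1) z.2.1) z.2.2 = 0 := by
    refine (integral_eq_zero_iff_of_nonneg (fun z => relDissipation_nonneg _ _) iB).1 ?_
    rw [Measure.integral_compProd iB]
    exact integral_eq_zero_of_ae (hzero.mono fun t ht => ht.2.2)
  have hall := (hmem.and hE).and hB
  rw [← map_prodAssoc_cylMeasure] at hall
  -- Back in the space-time grouping, a null set of phase points becomes, for almost every (t,x), a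
  -- null set of V_{t,x}.
  have hall' := Measure.ae_ae_of_ae_compProd
    (ae_of_ae_map MeasurableEquiv.prodAssoc.measurable.aemeasurable hall)
  filter_upwards [hall'] with z hz
  refine eq_dirac_of_ae_eq ?_
  filter_upwards [hz] with y hy
  obtain ⟨⟨h1, h2⟩, h3⟩ := hy
  have ht : z.1 ∈ Icc 0 T := Ioo_subset_Icc_self h1
  have h4 := eq_of_relEnergy_eq_zero (y := y) (w := w z.1 z.2)
    (P := fun j => pd j (cost γ ρ z.1) z.2) hγ (hs.pos z.1 ht z.2) h2 h3
  rw [h4]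
  simp only [grad, hs.pd_Q hγ ht]

end Uniqueness

end DissipativeAR

theorem theorem2p3 (d : ℕ) (hd : 0 < d) (γ : ℝ) (hγ : 1 ≤ γ) (T : ℝ) (hT : 0 < T)
    (V₀ : DissipativeAR.InitialYoungMeasure d) [IsMarkovKernel V₀]
    (V : DissipativeAR.YoungMeasure d) [IsMarkovKernel V]
    (D : ℝ → ℝ) (hV : DissipativeAR.IsMeasureValuedSolution d γ T V₀ V D)
    (ρ : ℝ → DissipativeAR.Torus d → ℝ) (w : ℝ → DissipativeAR.Torus d → DissipativeAR.Vec d)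
    (hs : DissipativeAR.IsStrongSolution d γ T ρ w)
    (h₀ : ∀ᵐ x : DissipativeAR.Torus d,
      V₀ x = Measure.dirac ((ρ 0 x).toNNReal, √(ρ 0 x) • w 0 x)) :
    (∀ᵐ τ ∂(DissipativeAR.timeMeasure T), D τ = 0) ∧
    ∀ᵐ z ∂(DissipativeAR.cylMeasure d T),
      V z = Measure.dirac ((ρ z.1 z.2).toNNReal, √(ρ z.1 z.2) • w z.1 z.2,
        DissipativeAR.grad (fun y => DissipativeAR.Q γ (ρ z.1 y)) z.2) :=
  hs.weak_strong_uniqueness hT hγ hV h₀
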